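/- **Setting.** Let $Z_t$ be a time-homogeneous Markov chain on a finite set $\mathsf Z$ with transition probability matrix $P$, and let $\beta_t=\beta(Z_t,\varepsilon_t)$, $R_t=R(Z_t,\zeta_t)$, $Y_t=Y(Z_t,\eta_t)$ ($t\ge 1$), where $\beta,R,Y\ge 0$ are measurable and the innovations $\varepsilon_t,\zeta_t,\eta_t$ are i.i.d. over time, mutually independent and independent of the chain; put $\beta_0=1$. For a utility function $u:[0,\infty)\to\mathbb R\cup\{-\infty\}$, the income fluctuation problem with initial wealth $a>0$ and initial state $z$ is to maximize $$\mathrm E_z\sum_{t=0}^\infty\Big(\prod_{i=0}^t\beta_i\Big)u(c_t)\quad\text{subject to}\quad a_0=a,\quad a_{t+1}=R_{t+1}(a_t-c_t)+Y_{t+1},\quad 0\le c_t\le a_t,$$ over adapted consumption plans $(c_t)$. A consumption function is a function $c(a,z)$ such that, for every $a>0$ and $z\in\mathsf Z$, the plan $c_t=c(a_t,Z_t)$ solves this problem. For a random variable $X$ depending on the state and the innovations, $D_X$ denotes the diagonal matrix with entries $\mathrm E_zX=\mathrm E[X\mid Z=z]$, and $r(\cdot)$ denotes the spectral radius. Write $\beta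 R^{1-\gamma}=(\beta R)R^{-\gamma}$, which is $0$ whenever $\beta=0$ or $R=0$, and $D=D_{\beta R^{1-\gamma}}$. **Assumptions.** 1. $u$ is twice continuously differentiable on $(0,\infty)$ with $u'>0$, $u''<0$, $u'(0)=\infty$, $u'(\infty)<1$, and $u(0)\le u(c)$ for all $c>0$. 2. For all $z$: $\mathrm E_z\beta<\infty$, $\mathrm E_z\beta R<\infty$, $\mathrm E_zY<\infty$, $\mathrm E_zu'(Y)<\infty$; moreover $r(PD_\beta)<1$ and $r(PD_{\beta R})<1$. 3. $u'$ is regularly varying with index $-\gamma<0$, that is, $u'(\lambda x)/u'(x)\to\lambda^{-\gamma}$ as $x\to\infty$ for every $\lambda>0$. 4. There is $\delta>0$ such that $R\in\{0\}\cup[\delta,\infty)$ almost surely. **Statement (irrelevance of additive shocks).** Fix $\gamma>0$, $P$, $\beta$ and $R$ (with the laws of $\varepsilon,\zeta$). There is a vector $(\bar c(z))_{z\in\mathsf Z}$, determined by these data alone, such that for every income process $Y$ (with any law of $\eta$) and every utility function $u$ for which Assumptions 1–4 hold, the consumption function $c(a,z)$ has the following properties. * For every $z$ for which the asymptotic MPC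 $\lim_{a\to\infty}c(a,z)/a$ exists, it equals $\bar c(z)$. * If either $r(PD)<1$ and $\liminf_{a\to\infty}c(a,z)/a>0$ for all $z$, or $r(PD)\ge1$ and $PD$ is irreducible, then for every $z$ the limit exists, so $\lim_{a\to\infty}c(a,z)/a=\bar c(z)$. In particular the asymptotic MPCs depend only on $\gamma$, $P$, $\beta$ and $R$, and not on $Y$. -/

import Mathlib

open MeasureTheory ProbabilityTheory Filter Topology
open scoped ENNReal

noncomputable section

namespace IncomeFluctuation

/-- Spectral radius of a real square matrix: the largest modulus of its complex eigenvalues. -/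
def specRad {N : ℕ} (A : Matrix (Fin N) (Fin N) ℝ) : ℝ≥0∞ :=
  spectralRadius ℂ (A.map (fun x : ℝ => (x : ℂ)))

/-- The multiplicative primitives: transition matrix `P` of the Markov chain on the states `Fin N`,
laws of the innovations `ε` and `ζ`, discount factor `β(z, ε)` and gross return `R(z, ζ)`. -/
structure Multiplicative (N : ℕ) (Eε Eζ : Type*) [MeasurableSpace Eε] [MeasurableSpace Eζ] where
  P : Matrix (Fin N) (Fin N) ℝ
  P_stochastic : P ∈ Matrix.rowStochastic ℝ (Fin N)
  με : Measure Eε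
  prob_ε : IsProbabilityMeasure με
  μζ : Measure Eζ
  prob_ζ : IsProbabilityMeasure μζ
  β : Fin N → Eε → ℝ
  β_measurable : ∀ z, Measurable (β z)
  β_nonneg : ∀ z e, 0 ≤ β z e
  R : Fin N → Eζ → ℝ
  R_measurable : ∀ z, Measurable (R z)
  R_nonneg : ∀ z e, 0 ≤ R z e

/-- The additive primitives: law of the innovation `η` and non-financial income `Y(z, η)`. -/
structure Income (N : ℕ) (Eη : Type*) [MeasurableSpace Eη] where
  μη : Measure Eη
  prob_η : IsProbabilityMeasure μη
  Y : Fin N → Eη → ℝ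
  Y_measurable : ∀ z, Measurable (Y z)
  Y_nonneg : ∀ z e, 0 ≤ Y z e

attribute [instance] Multiplicative.prob_ε Multiplicative.prob_ζ Income.prob_η

section Utility

/-- Marginal utility `u'(c)`, for `c > 0`. -/
def marginal (u : ℝ → EReal) (c : ℝ) : ℝ := deriv (fun x => (u x).toReal) c

open Classical in
/-- Marginal utility on `[0, ∞)` with values in `[0, ∞]`, where `u'(0) = ∞`. -/
def marginalExt (u : ℝ → EReal) (c : ℝ) : ℝ≥0∞ :=
  if 0 < c then ENNReal.ofReal (marginal u c) else ⊤

/-- Conditions on the utility function `u : [0, ∞) → ℝ ∪ {-∞}`; the values of `u` at negative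
arguments play no role. -/
structure InadaUtility (u : ℝ → EReal) : Prop where
  finite : ∀ c, 0 < c → u c ≠ ⊥ ∧ u c ≠ ⊤
  zero_le : ∀ c, 0 < c → u 0 ≤ u c
  contDiffOn : ContDiffOn ℝ 2 (fun c => (u c).toReal) (Set.Ioi 0)
  marginal_pos : ∀ c, 0 < c → 0 < marginal u c
  marginal_deriv_neg : ∀ c, 0 < c → deriv (marginal u) c < 0
  marginal_zero : Tendsto (marginal u) (𝓝[>] 0) atTop
  marginal_infty : ∃ l < 1, Tendsto (marginal u) atTop (𝓝 l)

/-- `f` is regularly varying at infinity with index `ρ`. -/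
def RegularlyVarying (f : ℝ → ℝ) (ρ : ℝ) : Prop :=
  ∀ t : ℝ, 0 < t → Tendsto (fun x => f (t * x) / f x) atTop (𝓝 (t ^ ρ))

end Utility

variable {N : ℕ} {Eε Eζ Eη : Type*} [MeasurableSpace Eε] [MeasurableSpace Eζ] [MeasurableSpace Eη]

namespace Multiplicative

variable (M : Multiplicative N Eε Eζ)

/-- The diagonal matrix `D_X` with entries `E_z X`, for `X` a function of `z`, `ε` and `ζ`. -/
def diagMean (X : Fin N → Eε → Eζ → ℝ) : Matrix (Fin N) (Fin N) ℝ :=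
  Matrix.diagonal fun z => ∫ p, X z p.1 p.2 ∂(M.με.prod M.μζ)

/-- The matrix `P D_β`. -/
def PDβ : Matrix (Fin N) (Fin N) ℝ := M.P * M.diagMean fun z e _ => M.β z e

/-- The matrix `P D_{βR}`. -/
def PDβR : Matrix (Fin N) (Fin N) ℝ := M.P * M.diagMean fun z e f => M.β z e * M.R z f

/-- The matrix `P D` with `D = D_{βR^{1-γ}}`, where `βR^{1-γ}` means `(βR)R^{-γ}` and is `0`
whenever `β = 0` or `R = 0`. -/
def PD (γ : ℝ) : Matrix (Fin N) (Fin N) ℝ :=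
  M.P * M.diagMean fun z e f => M.β z e * M.R z f * M.R z f ^ (-γ)

/-- Finite conditional means of `β` and `βR`, with `r(P D_β) < 1` and `r(P D_{βR}) < 1`. -/
structure Impatient : Prop where
  integrable_β : ∀ z, Integrable (M.β z) M.με
  integrable_βR : ∀ z, Integrable (fun p : Eε × Eζ => M.β z p.1 * M.R z p.2) (M.με.prod M.μζ)
  specRad_β : specRad M.PDβ < 1
  specRad_βR : specRad M.PDβR < 1

/-- For some `δ > 0`, the return is almost surely in `{0} ∪ [δ, ∞)`. -/
def ReturnGap : Prop :=
  ∃ δ > 0, ∀ z, ∀ᵐ e ∂M.μζ, M.R z e = 0 ∨ δ ≤ M.R z e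

end Multiplicative

/-- `E_z Y < ∞` and `E_z u'(Y) < ∞` for every state `z`. -/
structure Income.Admissible (I : Income N Eη) (u : ℝ → EReal) : Prop where
  integrable_Y : ∀ z, Integrable (I.Y z) I.μη
  marginal_Y : ∀ z, ∫⁻ e, marginalExt u (I.Y z e) ∂I.μη < ⊤

section Problem

/-- One-period realization `(Z_t, ε_t, ζ_t, η_t)`. -/
abbrev Shock (N : ℕ) (Eε Eζ Eη : Type*) := Fin N × Eε × Eζ × Eη

/-- Realizations of the whole exogenous process. -/
abbrev Path (N : ℕ) (Eε Eζ Eη : Type*) := ℕ → Shock N Eε Eζ Eη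

variable (M : Multiplicative N Eε Eζ) (I : Income N Eη)

/-- Law of `(Z_t, ε_t, ζ_t, η_t)` given `Z_t = z`: the innovations are independent of each other
and of the state. -/
def shockLaw (z : Fin N) : Measure (Shock N Eε Eζ Eη) :=
  (Measure.dirac z).prod (M.με.prod (M.μζ.prod I.μη))

instance (z : Fin N) : IsProbabilityMeasure (shockLaw M I z) := by
  unfold shockLaw; infer_instance

/-- One-step transition: given `Z_t = z`, draw `Z_{t+1}` from the row `P(z, ·)`, then fresh
innovations. -/
def step : Kernel (Fin N) (Shock N Eε Eζ Eη) where
  toFun z := ∑ z', ENNReal.ofReal (M.P z z') • shockLaw M I z'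
  measurable' := measurable_of_finite _

instance : IsMarkovKernel (step M I) where
  isProbabilityMeasure z := by
    constructor
    have h : ∑ z', M.P z z' = 1 := by
      have := congrFun M.P_stochastic.2 z
      simpa [Matrix.mulVec, dotProduct] using this
    have hs : step M I z = ∑ z', ENNReal.ofReal (M.P z z') • shockLaw M I z' := rfl
    rw [hs]
    simp only [Measure.coe_finsetSum, Finset.sum_apply, Measure.smul_apply, measure_univ,
      smul_eq_mul, mul_one]
    rw [← ENNReal.ofReal_sum_of_nonneg fun z' _ => M.P_stochastic.1 z z', h, ENNReal.ofReal_one]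

/-- The same transition as a kernel on histories up to date `t`. -/
def historyStep (t : ℕ) :
    Kernel ((i : Finset.Iic t) → Shock N Eε Eζ Eη) (Shock N Eε Eζ Eη) :=
  (step M I).comap (fun h => (h ⟨t, Finset.mem_Iic.2 le_rfl⟩).1)
    (measurable_fst.comp (measurable_pi_apply _))

instance (t : ℕ) : IsMarkovKernel (historyStep M I t) := by
  unfold historyStep; infer_instance

/-- Law of the exogenous process started at `Z_0 = z`. -/
def pathLaw (z : Fin N) : Measure (Path N Eε Eζ Eη) :=
  Kernel.trajMeasure (X := fun _ => Shock N Eε Eζ Eη) (shockLaw M I z) (historyStep M I)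

/-- Information available at date `t`: the exogenous process up to and including date `t`. -/
def info : Filtration ℕ (MeasurableSpace.pi : MeasurableSpace (Path N Eε Eζ Eη)) :=
  Filtration.piLE (X := fun _ => Shock N Eε Eζ Eη)

/-- The state `Z_t`. -/
def state (t : ℕ) (ω : Path N Eε Eζ Eη) : Fin N := (ω t).1

/-- `β_t` (used for `t ≥ 1` only). -/
def discAt (t : ℕ) (ω : Path N Eε Eζ Eη) : ℝ := M.β (ω t).1 (ω t).2.1

/-- `R_t` (used for `t ≥ 1` only). -/
def retAt (t : ℕ) (ω : Path N Eε Eζ Eη) : ℝ := M.R (ω t).1 (ω t).2.2.1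

/-- `Y_t` (used for `t ≥ 1` only). -/
def incAt (t : ℕ) (ω : Path N Eε Eζ Eη) : ℝ := I.Y (ω t).1 (ω t).2.2.2

/-- `∏_{i=0}^t β_i` with `β_0 = 1`. -/
def cumDisc (t : ℕ) (ω : Path N Eε Eζ Eη) : ℝ := ∏ i ∈ Finset.range t, discAt M (i + 1) ω

/-- Wealth generated by a consumption plan `C` from initial wealth `a`. -/
def wealth (a : ℝ) (C : ℕ → Path N Eε Eζ Eη → ℝ) : ℕ → Path N Eε Eζ Eη → ℝ
  | 0, _ => a
  | t + 1, ω => retAt M (t + 1) ω * (wealth a C t ω - C t ω) + incAt I (t + 1) ω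

/-- A feasible plan from `(a, z)`: consumption is adapted and almost surely `0 ≤ c_t ≤ a_t`. -/
structure Feasible (a : ℝ) (z : Fin N) (C : ℕ → Path N Eε Eζ Eη → ℝ) : Prop where
  adapted : ∀ t, Measurable[info t] (C t)
  constraint : ∀ᵐ ω ∂pathLaw M I z, ∀ t, 0 ≤ C t ω ∧ C t ω ≤ wealth M I a C t ω

/-- Expected lifetime utility `E_0 ∑_t (∏_{i ≤ t} β_i) u(c_t)` from `Z_0 = z`, as the expectation
of the positive part minus that of the negative part (and `0 · ∞ = 0`). -/
def lifetimeUtility (u : ℝ → EReal) (z : Fin N) (C : ℕ → Path N Eε Eζ Eη → ℝ) : EReal :=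
  ((∫⁻ ω, ∑' t, ENNReal.ofReal (cumDisc M t ω) * (u (C t ω)).toENNReal ∂pathLaw M I z : ℝ≥0∞) :
      EReal) -
    ((∫⁻ ω, ∑' t, ENNReal.ofReal (cumDisc M t ω) * (-u (C t ω)).toENNReal ∂pathLaw M I z : ℝ≥0∞) :
      EReal)

/-- `C` solves the income fluctuation problem with initial wealth `a` and initial state `z`. -/
structure Solves (u : ℝ → EReal) (a : ℝ) (z : Fin N) (C : ℕ → Path N Eε Eζ Eη → ℝ) : Prop where
  feasible : Feasible M I a z C
  optimal : ∀ C', Feasible M I a z C' → lifetimeUtility M I u z C' ≤ lifetimeUtility M I u z C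

/-- Wealth when consumption is `c(a_t, Z_t)` at every date. -/
def policyWealth (c : ℝ → Fin N → ℝ) (a : ℝ) : ℕ → Path N Eε Eζ Eη → ℝ
  | 0, _ => a
  | t + 1, ω =>
    retAt M (t + 1) ω * (policyWealth c a t ω - c (policyWealth c a t ω) (state t ω)) +
      incAt I (t + 1) ω

/-- The plan `c_t = c(a_t, Z_t)`. -/
def policyPlan (c : ℝ → Fin N → ℝ) (a : ℝ) (t : ℕ) (ω : Path N Eε Eζ Eη) : ℝ :=
  c (policyWealth M I c a t ω) (state t ω)

/-- `c(a, z)` is the consumption function: from every initial wealth `a > 0` and initial state `z`,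
consuming `c(a_t, Z_t)` at every date solves the income fluctuation problem. -/
def IsConsumptionFunction (u : ℝ → EReal) (c : ℝ → Fin N → ℝ) : Prop :=
  ∀ a, 0 < a → ∀ z, Solves M I u a z (policyPlan M I c a)

end Problem

end IncomeFluctuation

end

/-! Write `A = M.PD γ`. The consumption function satisfies `c(a,z)/a → 1/s(z)`, where `s` is the
increasing limit of `s₀ = 1`, `s_{n+1} = 1 + (A s_n^γ)^{1/γ}`, with `1/∞ = 0`. The recursion
involves only `A` and `γ`, so income cannot matter. The reason is regular variation: after division
by `u'(a)`, the marginal value `E βR u'(vRa + q)` tends to `E βR (vR)^{-γ}`, whatever the additive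
term `q` (`tendsto_eulerIntegral`).

Optimality enters through two Euler inequalities, obtained from feasible deviations. Saving a little
more for one period gives `IsConsumptionFunction.euler_ge`. The reverse deviation, consuming more
now, may be impossible to repay at the next date, so it is repaid gradually by cutting later
consumption down to truncated income. The total loss is integrable because `r(P D_{βR}) < 1` and `E
u'(Y) < ∞`. This first shows that consumption is positive, with bounded marginal utility whenever
savings are positive, and then gives `IsConsumptionFunction.euler_le`.

Upper bound: `c ≤ a` is the case `s₀ = 1`, and `euler_ge` turns an asymptotic bound `a/s_n` into
`a/s_{n+1}` (`upper_step`). Where the iterates are unbounded, this already forces the limit `0`.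

Lower bound: the states with bounded iterates form a set closed under the transitions of `A`, on
which the limit satisfies `A s^γ ≤ (s - 1)^γ`. A comparison argument based on `euler_le` shows that
`c/a` stays away from zero there (`exists_marginal_le`, `exists_lower`). A bound `c ≥ a/((1+m)s)`
then improves itself by a fixed factor in `m`, so `m` can be made arbitrarily small (`lower`). -/

noncomputable section

namespace IncomeFluctuation

set_option linter.unusedSectionVars false

/-! ### Nonnegative matrices of spectral radius below one. -/

section Spectral

attribute [local instance] Matrix.linftyOpNormedRing Matrix.linftyOpNormedAlgebra

lemma summable_pow_entries {N : ℕ} (A : Matrix (Fin N) (Fin N) ℝ) (h : specRad A < 1)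
    (i j : Fin N) : Summable fun n : ℕ => (A ^ n) i j := by
  set B : Matrix (Fin N) (Fin N) ℂ := A.map (fun x : ℝ => (x : ℂ)) with hB
  have hpow : ∀ n : ℕ, B ^ n = (A ^ n).map (fun x : ℝ => (x : ℂ)) := fun n => by
    have := (Matrix.map_pow A (Complex.ofRealHom : ℝ →+* ℂ) n)
    exact this.symm
  have hentry : ∀ (C : Matrix (Fin N) (Fin N) ℂ), ‖C i j‖₊ ≤ ‖C‖₊ := by
    intro C
    rw [Matrix.linfty_opNNNorm_def]
    exact (Finset.single_le_sum (f := fun j => ‖C i j‖₊) (fun _ _ => zero_le) (Finset.mem_univ j)).trans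
      (Finset.le_sup (f := fun i => ∑ j, ‖C i j‖₊) (Finset.mem_univ i))
  -- Gelfand's formula: for `r` strictly between the spectral radius and `1`, eventually `‖Bⁿ‖ ≤
  -- rⁿ`, and the operator norm dominates each entry.
  have hgel := spectrum.pow_nnnorm_pow_one_div_tendsto_nhds_spectralRadius B
  obtain ⟨r, hr1, hr2⟩ := ENNReal.lt_iff_exists_nnreal_btwn.1 (show spectralRadius ℂ B < 1 from h)
  have hr2' : r < 1 := by exact_mod_cast hr2
  have hev := hgel.eventually_lt_const hr1
  have hbound : ∀ᶠ n : ℕ in atTop, ‖(A ^ n) i j‖ ≤ (r : ℝ) ^ n := by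
    filter_upwards [hev, eventually_gt_atTop 0] with n hn hn0
    have h1 : ((‖B ^ n‖₊ : ℝ≥0∞)) ≤ (r : ℝ≥0∞) ^ n := by
      have := ENNReal.rpow_le_rpow hn.le (show (0 : ℝ) ≤ n by positivity)
      rwa [← ENNReal.rpow_mul, one_div, inv_mul_cancel₀ (by positivity), ENNReal.rpow_one,
        ENNReal.rpow_natCast] at this
    have h2 : ‖B ^ n‖₊ ≤ r ^ n := by exact_mod_cast h1
    have h3 := (hentry (B ^ n)).trans h2
    have h4 : ‖(B ^ n) i j‖ ≤ (r : ℝ) ^ n := by exact_mod_cast h3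
    rw [hpow] at h4
    simpa using h4
  exact Summable.of_norm_bounded_eventually_nat
    (summable_geometric_of_lt_one r.2 (by exact_mod_cast hr2')) hbound

/-- For a nonnegative matrix of spectral radius less than one and `q ≥ 0`, the equation
`w = q + A w` has a solution `w ≥ q`. -/
lemma exists_eq_add_mulVec {N : ℕ} (A : Matrix (Fin N) (Fin N) ℝ) (hA : ∀ i j, 0 ≤ A i j)
    (h : specRad A < 1) (q : Fin N → ℝ) (hq : ∀ i, 0 ≤ q i) :
    ∃ w : Fin N → ℝ, (∀ i, q i ≤ w i) ∧ ∀ i, w i = q i + ∑ j, A i j * w j := by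
  have hpow : ∀ n i j, 0 ≤ (A ^ n) i j := by
    intro n
    induction n with
    | zero => intro i j; simp only [pow_zero, Matrix.one_apply]; split_ifs <;> norm_num
    | succ n ih =>
      intro i j
      rw [pow_succ, Matrix.mul_apply]
      exact Finset.sum_nonneg fun k _ => mul_nonneg (ih i k) (hA k j)
  -- The solution is the Neumann series `∑ Aⁿ q`.
  have hs : ∀ i, Summable fun n : ℕ => ∑ j, (A ^ n) i j * q j := fun i =>
    summable_sum fun j _ => (summable_pow_entries A h i j).mul_right _
  have hn : ∀ n i, 0 ≤ ∑ j, (A ^ n) i j * q j := fun n i =>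
    Finset.sum_nonneg fun j _ => mul_nonneg (hpow n i j) (hq j)
  have hstep : ∀ i, ∑' n : ℕ, ∑ j, (A ^ n) i j * q j =
      q i + ∑ j, A i j * ∑' n : ℕ, ∑ k, (A ^ n) j k * q k := by
    intro i
    rw [(hs i).tsum_eq_zero_add]
    congr 1
    · simp [Matrix.one_apply]
    · simp_rw [← tsum_mul_left]
      rw [← Summable.tsum_finsetSum fun j _ => (hs j).mul_left _]
      congr 1
      ext n
      simp_rw [pow_succ', Matrix.mul_apply, Finset.sum_mul, Finset.mul_sum]
      rw [Finset.sum_comm]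
      simp_rw [mul_assoc]
  refine ⟨fun i => ∑' n : ℕ, ∑ j, (A ^ n) i j * q j, fun i => ?_, hstep⟩
  show q i ≤ ∑' n : ℕ, ∑ j, (A ^ n) i j * q j
  rw [hstep i]
  exact le_add_of_nonneg_right
    (Finset.sum_nonneg fun j _ => mul_nonneg (hA i j) (tsum_nonneg fun n => hn n j))

end Spectral


/-! ### The Markov property and integrals against the one-step transition law. -/

section Markov

variable {N : ℕ} {Eε Eζ Eη : Type*} [MeasurableSpace Eε] [MeasurableSpace Eζ] [MeasurableSpace Eη]
variable (M : Multiplicative N Eε Eζ) (I : Income N Eη)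

instance (z : Fin N) : IsProbabilityMeasure (pathLaw M I z) := by
  unfold pathLaw; infer_instance

lemma measurable_coord {s t : ℕ} (h : s ≤ t) :
    Measurable[info t] (fun ω : Path N Eε Eζ Eη => ω s) := by
  have : Measurable[info t] (Preorder.frestrictLe (π := fun _ : ℕ => Shock N Eε Eζ Eη) t) := by
    rw [info, Filtration.piLE_eq_comap_frestrictLe]
    exact comap_measurable _
  exact (measurable_pi_apply (⟨s, Finset.mem_Iic.2 h⟩ : Finset.Iic t)).comp this

lemma measurable_path_apply (t : ℕ) : Measurable (fun ω : Path N Eε Eζ Eη => ω t) :=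
  measurable_pi_apply t

/-- Markov property: conditionally on the information at date `t`, the shock at date `t + 1` is
drawn from `step (Z_t)`. -/
lemma lintegral_mul_next (z : Fin N) (t : ℕ) {G : Path N Eε Eζ Eη → ℝ≥0∞}
    (hG : Measurable[info t] G) {F : Shock N Eε Eζ Eη → ℝ≥0∞} (hF : Measurable F) :
    ∫⁻ ω, G ω * F (ω (t + 1)) ∂pathLaw M I z =
      ∫⁻ ω, G ω * ∫⁻ x, F x ∂step M I (state t ω) ∂pathLaw M I z := by
  rw [info, Filtration.piLE_eq_comap_frestrictLe] at hG
  obtain ⟨g, hg, rfl⟩ := hG.exists_eq_measurable_comp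
  -- `G` factors through the history up to `t`; the joint law of this history and the next shock is
  -- the history law composed with the transition kernel.
  have key := Kernel.map_frestrictLe_trajMeasure_compProd_eq_map_trajMeasure
    (X := fun _ => Shock N Eε Eζ Eη) (μ₀ := shockLaw M I z) (κ := historyStep M I) (a := t)
  have hm : Measurable fun p : ((i : Finset.Iic t) → Shock N Eε Eζ Eη) × Shock N Eε Eζ Eη =>
      g p.1 * F p.2 := (hg.comp measurable_fst).mul (hF.comp measurable_snd)
  have h1 : ∫⁻ ω, g (Preorder.frestrictLe t ω) * F (ω (t + 1)) ∂pathLaw M I z =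
      ∫⁻ p, g p.1 * F p.2 ∂((pathLaw M I z).map
        (fun x => (Preorder.frestrictLe t x, x (t + 1)))) := by
    rw [lintegral_map hm (by fun_prop)]
  simp only [Function.comp_apply]
  rw [h1]
  unfold pathLaw
  rw [← key, Measure.lintegral_compProd hm, lintegral_map _ (by fun_prop)]
  · refine lintegral_congr fun ω => ?_
    simp only
    rw [lintegral_const_mul _ hF]
    rfl
  · exact hm.lintegral_kernel_prod_right'

lemma map_zero_pathLaw (z : Fin N) :
    (pathLaw M I z).map (fun ω => ω 0) = shockLaw M I z := by
  have h0 : (fun ω : Path N Eε Eζ Eη => ω 0) =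
      (fun h : (i : Finset.Iic 0) → Shock N Eε Eζ Eη => h ⟨0, Finset.mem_Iic.2 le_rfl⟩) ∘
        Preorder.frestrictLe (π := fun _ : ℕ => Shock N Eε Eζ Eη) 0 := rfl
  rw [h0, ← Measure.map_map (measurable_pi_apply _) (by fun_prop)]
  unfold pathLaw Kernel.trajMeasure
  rw [Measure.map_comp _ _ (by fun_prop), Kernel.traj_map_frestrictLe, Kernel.partialTraj_self,
    Measure.id_comp, Measure.map_map (measurable_pi_apply _) (MeasurableEquiv.measurable _)]
  exact Measure.map_id

lemma state_zero_ae (z : Fin N) : ∀ᵐ ω ∂pathLaw M I z, state 0 ω = z := by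
  have h : ∀ᵐ x ∂shockLaw M I z, x.1 = z := by
    have h1 : Measure.QuasiMeasurePreserving Prod.fst (shockLaw M I z) (Measure.dirac z) :=
      Measure.quasiMeasurePreserving_fst
    refine h1.ae (p := fun y => y = z) ?_
    rw [ae_dirac_eq]
    exact Filter.eventually_pure.2 rfl
  rw [← map_zero_pathLaw] at h
  exact ae_of_ae_map (measurable_pi_apply _).aemeasurable h

lemma lintegral_next_zero (z : Fin N) {F : Shock N Eε Eζ Eη → ℝ≥0∞} (hF : Measurable F) :
    ∫⁻ ω, F (ω 1) ∂pathLaw M I z = ∫⁻ x, F x ∂step M I z := by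
  have := lintegral_mul_next M I z 0 (G := fun _ => 1) (measurable_const) hF
  simp only [one_mul, zero_add] at this
  rw [this]
  have h2 : ∀ᵐ ω ∂pathLaw M I z, ∫⁻ x, F x ∂step M I (state 0 ω) = ∫⁻ x, F x ∂step M I z := by
    filter_upwards [state_zero_ae M I z] with ω hω
    rw [hω]
  rw [lintegral_congr_ae h2]
  simp

lemma lintegral_step (z : Fin N) {F : Shock N Eε Eζ Eη → ℝ≥0∞} (hF : Measurable F) :
    ∫⁻ x, F x ∂step M I z = ∑ z', ENNReal.ofReal (M.P z z') *
      ∫⁻ p, F (z', p) ∂(M.με.prod (M.μζ.prod I.μη)) := by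
  have hs : step M I z = ∑ z', ENNReal.ofReal (M.P z z') • shockLaw M I z' := rfl
  rw [hs, lintegral_finsetSum_measure]
  refine Finset.sum_congr rfl fun z' _ => ?_
  rw [lintegral_smul_measure, smul_eq_mul, shockLaw, lintegral_prod _ hF.aemeasurable,
    lintegral_dirac' _ hF.lintegral_prod_right']

/-- Given the new state, `η` is independent of `(ε, ζ)`, so the integral factors. -/
lemma lintegral_step_mul (z : Fin N) {X : Fin N → Eε → Eζ → ℝ≥0∞}
    (hX : ∀ z, Measurable fun p : Eε × Eζ => X z p.1 p.2)
    {k : Fin N → Eη → ℝ≥0∞} (hk : ∀ z, Measurable (k z)) :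
    ∫⁻ x, X x.1 x.2.1 x.2.2.1 * k x.1 x.2.2.2 ∂step M I z = ∑ z', ENNReal.ofReal (M.P z z') *
      ((∫⁻ p, X z' p.1 p.2 ∂(M.με.prod M.μζ)) * ∫⁻ e, k z' e ∂I.μη) := by
  have hm : Measurable fun x : Shock N Eε Eζ Eη => X x.1 x.2.1 x.2.2.1 * k x.1 x.2.2.2 := by
    refine measurable_from_prod_countable_right fun z' => ?_
    exact ((hX z').comp (by fun_prop : Measurable fun p : Eε × Eζ × Eη => (p.1, p.2.1))).mul
      ((hk z').comp (by fun_prop))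
  rw [lintegral_step M I z hm]
  refine Finset.sum_congr rfl fun z' _ => ?_
  congr 1
  have h1 : ∫⁻ p : Eε × Eζ × Eη, X z' p.1 p.2.1 * k z' p.2.2 ∂(M.με.prod (M.μζ.prod I.μη)) =
      ∫⁻ e, ∫⁻ f, ∫⁻ h, X z' e f * k z' h ∂I.μη ∂M.μζ ∂M.με := by
    have hm' : Measurable fun p : Eε × Eζ × Eη => X z' p.1 p.2.1 * k z' p.2.2 :=
      hm.comp (measurable_prodMk_left (x := z'))
    rw [lintegral_prod _ hm'.aemeasurable]
    refine lintegral_congr fun e => ?_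
    have hm'' : Measurable fun p : Eζ × Eη => X z' e p.1 * k z' p.2 :=
      hm'.comp (measurable_prodMk_left (x := e))
    exact lintegral_prod _ hm''.aemeasurable
  simp only at h1 ⊢
  rw [h1, lintegral_prod _ (hX z').aemeasurable, ← lintegral_mul_const]
  · refine lintegral_congr fun e => ?_
    have hm3 : Measurable fun f => X z' e f := (hX z').comp (measurable_prodMk_left (x := e))
    rw [← lintegral_mul_const _ hm3]
    exact lintegral_congr fun f => lintegral_const_mul _ (hk z')
  · exact (hX z').lintegral_prod_right'

lemma measurable_shock_income : Measurable fun x : Shock N Eε Eζ Eη => I.Y x.1 x.2.2.2 :=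
  measurable_from_prod_countable_right fun z' => (I.Y_measurable z').comp (by fun_prop)

lemma measurable_shock_disc : Measurable fun x : Shock N Eε Eζ Eη => M.β x.1 x.2.1 :=
  measurable_from_prod_countable_right fun z' => (M.β_measurable z').comp (by fun_prop)

lemma measurable_shock_ret : Measurable fun x : Shock N Eε Eζ Eη => M.R x.1 x.2.2.1 :=
  measurable_from_prod_countable_right fun z' => (M.R_measurable z').comp (by fun_prop)

/-- Integration of functions of the state, `ε` and `ζ` against the transition law, through the
matrix `P D_X`. -/
lemma lintegral_step_diagMean (z : Fin N) {X : Fin N → Eε → Eζ → ℝ}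
    (hX : ∀ z, Integrable (fun p : Eε × Eζ => X z p.1 p.2) (M.με.prod M.μζ))
    (hXm : ∀ z, Measurable fun p : Eε × Eζ => X z p.1 p.2)
    (hX0 : ∀ z e f, 0 ≤ X z e f) {k : Fin N → Eη → ℝ≥0∞} (hk : ∀ z, Measurable (k z)) :
    ∫⁻ x, ENNReal.ofReal (X x.1 x.2.1 x.2.2.1) * k x.1 x.2.2.2 ∂step M I z =
      ∑ z', ENNReal.ofReal ((M.P * M.diagMean X) z z') * ∫⁻ e, k z' e ∂I.μη := by
  rw [lintegral_step_mul M I z (X := fun z e f => ENNReal.ofReal (X z e f))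
    (fun z => (hXm z).ennreal_ofReal) hk]
  refine Finset.sum_congr rfl fun z' _ => ?_
  rw [Multiplicative.diagMean, Matrix.mul_diagonal, ENNReal.ofReal_mul (M.P_stochastic.1 z z'),
    ofReal_integral_eq_lintegral_ofReal (hX z') (ae_of_all _ fun p => hX0 z' p.1 p.2), mul_assoc]

lemma ae_step_of_ae {p : Fin N → Eε → Eζ → Eη → Prop} (z : Fin N)
    (h : ∀ z', ∀ᵐ q ∂(M.με.prod (M.μζ.prod I.μη)), p z' q.1 q.2.1 q.2.2) :
    ∀ᵐ x ∂step M I z, p x.1 x.2.1 x.2.2.1 x.2.2.2 := by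
  have hs : step M I z = ∑ z', ENNReal.ofReal (M.P z z') • shockLaw M I z' := rfl
  rw [hs, ← Measure.sum_fintype, Measure.ae_sum_iff]
  intro z'
  refine Measure.ae_smul_measure ?_ _
  have h1 : ∀ᵐ x ∂shockLaw M I z', x.1 = z' := by
    have h1 : Measure.QuasiMeasurePreserving Prod.fst (shockLaw M I z') (Measure.dirac z') :=
      Measure.quasiMeasurePreserving_fst
    refine h1.ae (p := fun y => y = z') ?_
    rw [ae_dirac_eq]
    exact Filter.eventually_pure.2 rfl
  have h2 : ∀ᵐ x ∂shockLaw M I z', p z' x.2.1 x.2.2.1 x.2.2.2 :=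
    (Measure.quasiMeasurePreserving_snd (μ := Measure.dirac z')).ae (h z')
  filter_upwards [h1, h2] with x hx1 hx2
  rw [hx1]; exact hx2

lemma ae_step_income {p : Fin N → Eη → Prop} (z : Fin N) (h : ∀ z', ∀ᵐ e ∂I.μη, p z' e) :
    ∀ᵐ x ∂step M I z, p x.1 x.2.2.2 :=
  ae_step_of_ae M I (p := fun z' _ _ e => p z' e) z fun z' =>
    (Measure.quasiMeasurePreserving_snd.comp
      (Measure.quasiMeasurePreserving_snd (μ := M.με) (ν := M.μζ.prod I.μη))).ae (h z')

lemma ae_step_ret {p : Fin N → Eζ → Prop} (z : Fin N) (h : ∀ z', ∀ᵐ e ∂M.μζ, p z' e) :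
    ∀ᵐ x ∂step M I z, p x.1 x.2.2.1 :=
  ae_step_of_ae M I (p := fun z' _ e _ => p z' e) z fun z' =>
    (Measure.quasiMeasurePreserving_fst.comp
      (Measure.quasiMeasurePreserving_snd (μ := M.με) (ν := M.μζ.prod I.μη))).ae (h z')

/-- The probability of failure at date `t + 1` is the mean of the transition probabilities of the
failure set, all zero; there are countably many dates. -/
lemma ae_forall_next {p : Shock N Eε Eζ Eη → Prop} (hp : MeasurableSet {x | p x}) (z : Fin N)
    (h : ∀ z', ∀ᵐ x ∂step M I z', p x) : ∀ᵐ ω ∂pathLaw M I z, ∀ t, p (ω (t + 1)) := by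
  rw [ae_all_iff]
  intro t
  have hF : Measurable ({x : Shock N Eε Eζ Eη | p x}ᶜ.indicator fun _ => (1 : ℝ≥0∞)) :=
    measurable_const.indicator hp.compl
  have := lintegral_mul_next M I z t (G := fun _ => 1) measurable_const hF
  have h0 : ∀ z', ∫⁻ x, {x : Shock N Eε Eζ Eη | p x}ᶜ.indicator (fun _ => (1 : ℝ≥0∞)) x
      ∂step M I z' = 0 := by
    intro z'
    rw [lintegral_indicator hp.compl]
    rw [setLIntegral_one]
    exact h z'
  simp only [one_mul, h0, lintegral_zero] at this
  have hm : Measurable fun ω : Path N Eε Eζ Eη =>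
      {x : Shock N Eε Eζ Eη | p x}ᶜ.indicator (fun _ => (1 : ℝ≥0∞)) (ω (t + 1)) :=
    hF.comp (measurable_path_apply (t + 1))
  rw [lintegral_eq_zero_iff hm] at this
  filter_upwards [this] with ω hω
  by_contra hc
  simp [Set.indicator, hc] at hω

lemma map_one_pathLaw (z : Fin N) : (pathLaw M I z).map (fun ω => ω 1) = step M I z := by
  ext s hs
  rw [Measure.map_apply (measurable_path_apply 1) hs]
  have := lintegral_next_zero M I z (measurable_const.indicator hs : Measurable
    (s.indicator fun _ => (1 : ℝ≥0∞)))
  rw [lintegral_indicator hs, setLIntegral_const, one_mul] at this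
  rw [← this, ← one_mul (pathLaw M I z _), ← setLIntegral_const, ← lintegral_indicator]
  · rfl
  · exact measurable_path_apply 1 hs

lemma ae_next_zero {p : Shock N Eε Eζ Eη → Prop} (z : Fin N)
    (h : ∀ᵐ x ∂step M I z, p x) : ∀ᵐ ω ∂pathLaw M I z, p (ω 1) := by
  rw [← map_one_pathLaw] at h
  exact ae_of_ae_map (measurable_pi_apply _).aemeasurable h

end Markov

/-! ### Concavity estimates for utility and regular variation of marginal utility. -/

section Utility

variable {u : ℝ → EReal}

lemma InadaUtility.coe_toReal (hu : InadaUtility u) {c : ℝ} (hc : 0 < c) :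
    (((u c).toReal : ℝ) : EReal) = u c :=
  EReal.coe_toReal (hu.finite c hc).2 (hu.finite c hc).1

lemma InadaUtility.hasDerivAt (hu : InadaUtility u) {c : ℝ} (hc : 0 < c) :
    HasDerivAt (fun x => (u x).toReal) (marginal u c) c :=
  ((hu.contDiffOn.differentiableOn (by norm_num)).differentiableAt
    (Ioi_mem_nhds hc)).hasDerivAt

lemma InadaUtility.differentiableOn_marginal (hu : InadaUtility u) :
    DifferentiableOn ℝ (marginal u) (Set.Ioi 0) :=
  (hu.contDiffOn.deriv_of_isOpen (m := 1) isOpen_Ioi (by norm_num)).differentiableOn (by norm_num)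

lemma InadaUtility.continuousOn_marginal (hu : InadaUtility u) :
    ContinuousOn (marginal u) (Set.Ioi 0) := hu.differentiableOn_marginal.continuousOn

lemma InadaUtility.strictAntiOn_marginal (hu : InadaUtility u) :
    StrictAntiOn (marginal u) (Set.Ioi 0) := by
  refine strictAntiOn_of_deriv_neg (convex_Ioi 0) hu.continuousOn_marginal fun x hx => ?_
  rw [interior_Ioi] at hx
  exact hu.marginal_deriv_neg x hx

lemma InadaUtility.marginal_anti (hu : InadaUtility u) {x y : ℝ} (hx : 0 < x) (hxy : x ≤ y) :
    marginal u y ≤ marginal u x :=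
  hu.strictAntiOn_marginal.antitoneOn (Set.mem_Ioi.2 hx) (Set.mem_Ioi.2 (hx.trans_le hxy)) hxy

lemma InadaUtility.le_of_marginal_le (hu : InadaUtility u) {x y : ℝ} (hx : 0 < x) (hy : 0 < y)
    (h : marginal u y ≤ marginal u x) : x ≤ y := by
  by_contra! hc
  exact absurd (hu.strictAntiOn_marginal (Set.mem_Ioi.2 hy) (Set.mem_Ioi.2 hx) hc) (not_lt.2 h)

lemma InadaUtility.exists_mvt (hu : InadaUtility u) {x y : ℝ} (hx : 0 < x) (hxy : x < y) :
    ∃ m ∈ Set.Ioo x y, (u y).toReal - (u x).toReal = marginal u m * (y - x) := by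
  obtain ⟨m, hm, h⟩ := exists_hasDerivAt_eq_slope (fun x => (u x).toReal) (marginal u) hxy
    (fun t ht => (hu.hasDerivAt (hx.trans_le ht.1)).continuousAt.continuousWithinAt)
    (fun t ht => hu.hasDerivAt (hx.trans ht.1))
  refine ⟨m, hm, ?_⟩
  rw [h, div_mul_cancel₀ _ (sub_ne_zero.2 hxy.ne')]

lemma InadaUtility.sub_le (hu : InadaUtility u) {x y : ℝ} (hx : 0 < x) (hxy : x ≤ y) :
    (u y).toReal - (u x).toReal ≤ marginal u x * (y - x) := by
  rcases hxy.eq_or_lt with rfl | hlt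
  · simp
  · obtain ⟨m, hm, h⟩ := hu.exists_mvt hx hlt
    rw [h]
    exact mul_le_mul_of_nonneg_right (hu.marginal_anti hx hm.1.le) (sub_nonneg.2 hxy)

lemma InadaUtility.le_sub (hu : InadaUtility u) {x y : ℝ} (hx : 0 < x) (hxy : x ≤ y) :
    marginal u y * (y - x) ≤ (u y).toReal - (u x).toReal := by
  rcases hxy.eq_or_lt with rfl | hlt
  · simp
  · obtain ⟨m, hm, h⟩ := hu.exists_mvt hx hlt
    rw [h]
    exact mul_le_mul_of_nonneg_right (hu.marginal_anti (hx.trans hm.1) hm.2.le) (sub_nonneg.2 hxy)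

lemma InadaUtility.mono (hu : InadaUtility u) {x y : ℝ} (hx : 0 ≤ x) (hxy : x ≤ y) :
    u x ≤ u y := by
  rcases hx.eq_or_lt with rfl | hx
  · rcases hxy.eq_or_lt with rfl | hy
    · exact le_rfl
    · exact hu.zero_le y hy
  · rw [← hu.coe_toReal hx, ← hu.coe_toReal (hx.trans_le hxy), EReal.coe_le_coe_iff]
    have := hu.le_sub hx hxy
    have h2 := mul_nonneg (hu.marginal_pos y (hx.trans_le hxy)).le (sub_nonneg.2 hxy)
    linarith

/-- Nothing is known about `u` at negative arguments; monotonicity, hence measurability, is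
available only after truncation at `0`. -/
lemma InadaUtility.measurable_max (hu : InadaUtility u) : Measurable fun x => u (max x 0) :=
  Monotone.measurable fun _ _ h => hu.mono (le_max_right _ _) (max_le_max_right 0 h)

lemma InadaUtility.pos_eq (hu : InadaUtility u) {c : ℝ} (hc : 0 < c) :
    (u c).toENNReal = ENNReal.ofReal (u c).toReal :=
  EReal.toENNReal_of_ne_top (hu.finite c hc).2

lemma InadaUtility.neg_eq (hu : InadaUtility u) {c : ℝ} (hc : 0 < c) :
    (-u c).toENNReal = ENNReal.ofReal (-(u c).toReal) := by
  rw [← hu.coe_toReal hc, ← EReal.coe_neg, EReal.toENNReal_of_ne_top (EReal.coe_ne_top _),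
    EReal.toReal_coe, EReal.toReal_coe]

/-- Utility comparisons are kept in subtraction-free form, with negative parts moved across the
inequality, so that they can be summed and integrated in `[0, ∞]` before finiteness is known. -/
lemma ofReal_add_ofReal_neg_le {x y k : ℝ} (hk : 0 ≤ k) (h : x ≤ y + k) :
    ENNReal.ofReal x + ENNReal.ofReal (-y) ≤
      ENNReal.ofReal y + ENNReal.ofReal (-x) + ENNReal.ofReal k := by
  have e : ∀ r : ℝ, ENNReal.ofReal r = ENNReal.ofReal (max r 0) := fun r => by
    rcases le_total r 0 with h | h
    · rw [max_eq_right h, ENNReal.ofReal_zero, ENNReal.ofReal_of_nonpos h]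
    · rw [max_eq_left h]
  rw [e x, e (-y), e y, e (-x), ← ENNReal.ofReal_add (le_max_right _ _) (le_max_right _ _),
    ← ENNReal.ofReal_add (le_max_right _ _) (le_max_right _ _),
    ← ENNReal.ofReal_add (add_nonneg (le_max_right _ _) (le_max_right _ _)) hk]
  refine ENNReal.ofReal_le_ofReal ?_
  have h1 : ∀ r : ℝ, max r 0 = r + max (-r) 0 := fun r => by
    rcases le_total r 0 with h | h
    · rw [max_eq_right h, max_eq_left (by linarith)]; ring
    · rw [max_eq_left h, max_eq_right (by linarith)]; ring
  have := h1 x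
  have := h1 y
  linarith

lemma ofReal_add_ofReal_neg_add_le {x y k : ℝ} (hk : 0 ≤ k) (h : x + k ≤ y) :
    ENNReal.ofReal x + ENNReal.ofReal (-y) + ENNReal.ofReal k ≤
      ENNReal.ofReal y + ENNReal.ofReal (-x) := by
  have e : ∀ r : ℝ, ENNReal.ofReal r = ENNReal.ofReal (max r 0) := fun r => by
    rcases le_total r 0 with h | h
    · rw [max_eq_right h, ENNReal.ofReal_zero, ENNReal.ofReal_of_nonpos h]
    · rw [max_eq_left h]
  rw [e x, e (-y), e y, e (-x), ← ENNReal.ofReal_add (le_max_right _ _) (le_max_right _ _),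
    ← ENNReal.ofReal_add (le_max_right _ _) (le_max_right _ _),
    ← ENNReal.ofReal_add (add_nonneg (le_max_right _ _) (le_max_right _ _)) hk]
  refine ENNReal.ofReal_le_ofReal ?_
  have h1 : ∀ r : ℝ, max r 0 = r + max (-r) 0 := fun r => by
    rcases le_total r 0 with h | h
    · rw [max_eq_right h, max_eq_left (by linarith)]; ring
    · rw [max_eq_left h, max_eq_right (by linarith)]; ring
  have := h1 x
  have := h1 y
  linarith

lemma marginalExt_of_pos {c : ℝ} (hc : 0 < c) :
    marginalExt u c = ENNReal.ofReal (marginal u c) := by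
  simp [marginalExt, hc]

lemma InadaUtility.antitone_marginalExt (hu : InadaUtility u) : Antitone (marginalExt u) := by
  intro x y hxy
  by_cases hx : 0 < x
  · rw [marginalExt_of_pos hx, marginalExt_of_pos (hx.trans_le hxy)]
    exact ENNReal.ofReal_le_ofReal (hu.marginal_anti hx hxy)
  · simp [marginalExt, hx]

lemma InadaUtility.measurable_marginalExt (hu : InadaUtility u) : Measurable (marginalExt u) :=
  hu.antitone_marginalExt.measurable

/-- Reducing consumption from `x` to `y` costs at most `u'(y) (x - y)`. -/
lemma InadaUtility.loss_le (hu : InadaUtility u) {x y : ℝ} (hy : 0 < y) (hyx : y ≤ x) :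
    (u x).toENNReal + (-u y).toENNReal ≤
      (u y).toENNReal + (-u x).toENNReal + marginalExt u y * ENNReal.ofReal (x - y) := by
  rw [hu.pos_eq hy, hu.neg_eq hy, hu.pos_eq (hy.trans_le hyx), hu.neg_eq (hy.trans_le hyx),
    marginalExt_of_pos hy, ← ENNReal.ofReal_mul (hu.marginal_pos y hy).le]
  have := hu.sub_le hy hyx
  exact ofReal_add_ofReal_neg_le
    (mul_nonneg (hu.marginal_pos y hy).le (sub_nonneg.2 hyx)) (by linarith)

/-- Raising consumption from `x` to `y` gains at least `u'(y) (y - x)`. -/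
lemma InadaUtility.le_gain (hu : InadaUtility u) {x y : ℝ} (hx : 0 < x) (hxy : x ≤ y) :
    (u x).toENNReal + (-u y).toENNReal + marginalExt u y * ENNReal.ofReal (y - x) ≤
      (u y).toENNReal + (-u x).toENNReal := by
  have hy := hx.trans_le hxy
  rw [hu.pos_eq hy, hu.neg_eq hy, hu.pos_eq hx, hu.neg_eq hx,
    marginalExt_of_pos hy, ← ENNReal.ofReal_mul (hu.marginal_pos y hy).le]
  have := hu.le_sub hx hxy
  exact ofReal_add_ofReal_neg_add_le
    (mul_nonneg (hu.marginal_pos y hy).le (sub_nonneg.2 hxy)) (by linarith)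

/-- Covers `x = 0`, where `u` may be `-∞`: the tangent estimate is applied from the midpoint, which
costs half the increment, and monotonicity does the rest. -/
lemma InadaUtility.le_gain_half (hu : InadaUtility u) {x y : ℝ} (hx : 0 ≤ x) (hxy : x < y) :
    (u x).toENNReal + (-u y).toENNReal + marginalExt u y * ENNReal.ofReal ((y - x) / 2) ≤
      (u y).toENNReal + (-u x).toENNReal := by
  have h := hu.le_gain (x := (x + y) / 2) (y := y) (by linarith) (by linarith)
  rw [show y - (x + y) / 2 = (y - x) / 2 by ring] at h
  have hm : u x ≤ u ((x + y) / 2) := hu.mono hx (by linarith)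
  calc _ ≤ (u ((x + y) / 2)).toENNReal + (-u y).toENNReal +
        marginalExt u y * ENNReal.ofReal ((y - x) / 2) := by
        gcongr; exact EReal.toENNReal_le_toENNReal hm
    _ ≤ _ := h
    _ ≤ _ := by gcongr; exact EReal.toENNReal_le_toENNReal (EReal.neg_le_neg_iff.2 hm)

/-- The tangent at `1` lies above a concave function. Linear growth lets discounted wealth dominate
the positive part of utility. -/
lemma InadaUtility.pos_le (hu : InadaUtility u) {c : ℝ} (hc : 0 ≤ c) :
    (u c).toENNReal ≤
      ENNReal.ofReal (|(u 1).toReal| + marginal u 1) * (ENNReal.ofReal c + 1) := by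
  have h1 := hu.marginal_pos 1 one_pos
  have habs := le_abs_self (u 1).toReal
  have habs' := abs_nonneg (u 1).toReal
  rcases le_total c 1 with h | h
  · calc (u c).toENNReal ≤ (u 1).toENNReal := EReal.toENNReal_le_toENNReal (hu.mono hc h)
      _ = ENNReal.ofReal (u 1).toReal := hu.pos_eq one_pos
      _ ≤ ENNReal.ofReal (|(u 1).toReal| + marginal u 1) :=
        ENNReal.ofReal_le_ofReal (by linarith)
      _ ≤ _ := le_mul_of_one_le_right' (by simp)
  · rw [hu.pos_eq (by linarith), ← ENNReal.ofReal_one, ← ENNReal.ofReal_add hc zero_le_one,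
      ← ENNReal.ofReal_mul (by linarith)]
    refine ENNReal.ofReal_le_ofReal ?_
    have := hu.sub_le one_pos h
    nlinarith

/-- The tangent at `c`, evaluated at `1`, bounds the fall of utility near zero by `u'(c)`. This
makes `E u'(Y) < ∞` usable. -/
lemma InadaUtility.neg_le (hu : InadaUtility u) {c : ℝ} (hc : 0 ≤ c) :
    (-u c).toENNReal ≤ ENNReal.ofReal |(u 1).toReal| + marginalExt u c := by
  rcases hc.eq_or_lt with rfl | hc
  · simp [marginalExt]
  · rw [hu.neg_eq hc, marginalExt_of_pos hc,
      ← ENNReal.ofReal_add (abs_nonneg _) (hu.marginal_pos c hc).le]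
    refine ENNReal.ofReal_le_ofReal ?_
    have habs := neg_le_abs (u 1).toReal
    have hp := hu.marginal_pos c hc
    rcases le_total c 1 with h | h
    · have := hu.sub_le hc h
      nlinarith
    · have := hu.le_sub one_pos h
      have := mul_nonneg hp.le (sub_nonneg.2 h)
      linarith

lemma InadaUtility.exists_marginal_gt (hu : InadaUtility u) (K : ℝ) :
    ∃ b > 0, K < marginal u b := by
  have h := (hu.marginal_zero.eventually_gt_atTop K).and self_mem_nhdsWithin
  obtain ⟨b, hb1, hb2⟩ := h.exists
  exact ⟨b, hb2, hb1⟩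

/-- Regular variation is insensitive to additive perturbations of the argument. -/
lemma InadaUtility.tendsto_ratio (hu : InadaUtility u) {γ : ℝ}
    (hrv : RegularlyVarying (marginal u) (-γ)) {l q : ℝ} (hl : 0 < l) (hq : 0 ≤ q) :
    Tendsto (fun a => marginal u (l * a + q) / marginal u a) atTop (𝓝 (l ^ (-γ))) := by
  rw [tendsto_order]
  constructor
  · intro b hb
    have hcont : ContinuousAt (fun x : ℝ => x ^ (-γ)) l :=
      Real.continuousAt_rpow_const _ _ (Or.inl hl.ne')
    -- For any `m > l` the shift `q` is eventually below `(m - l) a`; continuity of the power allows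
    -- `m` close to `l`.
    have hev : ∀ᶠ x in 𝓝[>] l, b < x ^ (-γ) :=
      (hcont.tendsto.eventually_const_lt hb).filter_mono nhdsWithin_le_nhds
    obtain ⟨m, hm1, hm2⟩ := (hev.and self_mem_nhdsWithin).exists
    have hm2 : l < m := hm2
    filter_upwards [(hrv m (hl.trans hm2)).eventually_const_lt hm1,
      eventually_ge_atTop (q / (m - l)), eventually_gt_atTop 0] with a h1 h2 h3
    refine h1.trans_le ?_
    have h4 : l * a + q ≤ m * a := by
      rw [div_le_iff₀ (by linarith)] at h2
      linarith
    exact div_le_div_of_nonneg_right (hu.marginal_anti (by positivity) h4)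
      (hu.marginal_pos a h3).le
  · intro b hb
    filter_upwards [(hrv l hl).eventually_lt_const hb, eventually_gt_atTop 0] with a h1 h3
    refine lt_of_le_of_lt ?_ h1
    exact div_le_div_of_nonneg_right (hu.marginal_anti (by positivity) (by linarith))
      (hu.marginal_pos a h3).le

end Utility

/-! ### Adaptedness and signs of the basic processes. -/

section Adapted

variable {N : ℕ} {Eε Eζ Eη : Type*} [MeasurableSpace Eε] [MeasurableSpace Eζ] [MeasurableSpace Eη]
variable (M : Multiplicative N Eε Eζ) (I : Income N Eη)

lemma measurable_state {s t : ℕ} (h : s ≤ t) :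
    Measurable[info t] (state (N := N) (Eε := Eε) (Eζ := Eζ) (Eη := Eη) s) :=
  measurable_fst.comp (measurable_coord h)

lemma measurable_discAt {s t : ℕ} (h : s ≤ t) :
    Measurable[info t] (discAt (Eη := Eη) M s) :=
  (measurable_shock_disc M).comp (measurable_coord h)

lemma measurable_retAt {s t : ℕ} (h : s ≤ t) : Measurable[info t] (retAt (Eη := Eη) M s) :=
  (measurable_shock_ret M).comp (measurable_coord h)

lemma measurable_incAt {s t : ℕ} (h : s ≤ t) :
    Measurable[info t] (incAt (Eε := Eε) (Eζ := Eζ) I s) :=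
  (measurable_shock_income I).comp (measurable_coord h)

lemma measurable_cumDisc (t : ℕ) : Measurable[info t] (cumDisc (Eη := Eη) M t) := by
  unfold cumDisc
  refine Finset.measurable_fun_prod _ fun i hi => measurable_discAt M ?_
  have := Finset.mem_range.1 hi
  omega

lemma measurable_wealth {a : ℝ} {C : ℕ → Path N Eε Eζ Eη → ℝ}
    (hC : ∀ t, Measurable[info t] (C t)) (t : ℕ) : Measurable[info t] (wealth M I a C t) := by
  induction t with
  | zero => exact measurable_const
  | succ t ih =>
    have hle := (info (N := N) (Eε := Eε) (Eζ := Eζ) (Eη := Eη)).mono (Nat.le_succ t)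
    exact ((measurable_retAt M le_rfl).mul ((ih.mono hle le_rfl).sub ((hC t).mono hle le_rfl))).add
      (measurable_incAt I le_rfl)

lemma info_le (t : ℕ) : info (N := N) (Eε := Eε) (Eζ := Eζ) (Eη := Eη) t ≤ MeasurableSpace.pi :=
  info.le t

lemma discAt_nonneg (t : ℕ) (ω : Path N Eε Eζ Eη) : 0 ≤ discAt M t ω := M.β_nonneg _ _

lemma retAt_nonneg (t : ℕ) (ω : Path N Eε Eζ Eη) : 0 ≤ retAt M t ω := M.R_nonneg _ _

lemma incAt_nonneg (t : ℕ) (ω : Path N Eε Eζ Eη) : 0 ≤ incAt I t ω := I.Y_nonneg _ _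

lemma cumDisc_nonneg (t : ℕ) (ω : Path N Eε Eζ Eη) : 0 ≤ cumDisc M t ω :=
  Finset.prod_nonneg fun _ _ => M.β_nonneg _ _

lemma cumDisc_succ (t : ℕ) (ω : Path N Eε Eζ Eη) :
    cumDisc M (t + 1) ω = cumDisc M t ω * discAt M (t + 1) ω := Finset.prod_range_succ _ _

end Adapted

/-! ### Summability of discounted products by Lyapunov functions. -/

section Lyapunov

variable {N : ℕ} {Eε Eζ Eη : Type*} [MeasurableSpace Eε] [MeasurableSpace Eζ] [MeasurableSpace Eη]
variable (M : Multiplicative N Eε Eζ) (I : Income N Eη)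

lemma tsum_le_of_decreasing {x y : ℕ → ℝ≥0∞} (h : ∀ t, x (t + 1) + y t ≤ x t) :
    ∑' t, y t ≤ x 0 := by
  have h1 : ∀ n, x n + ∑ t ∈ Finset.range n, y t ≤ x 0 := by
    intro n
    induction n with
    | zero => simp
    | succ n ih =>
      rw [Finset.sum_range_succ]
      calc x (n + 1) + (∑ t ∈ Finset.range n, y t + y n)
          = x (n + 1) + y n + ∑ t ∈ Finset.range n, y t := by ring
        _ ≤ x n + ∑ t ∈ Finset.range n, y t := by gcongr; exact h n
        _ ≤ _ := ih
  exact ENNReal.tsum_le_of_sum_range_le fun n => le_add_self.trans (h1 n)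

/-- The product `∏_{i=1}^t X_i` of a multiplicative shock `X(Z, ε, ζ)`. -/
def cumProd (X : Fin N → Eε → Eζ → ℝ) (t : ℕ) (ω : Path N Eε Eζ Eη) : ℝ :=
  ∏ i ∈ Finset.range t, X (ω (i + 1)).1 (ω (i + 1)).2.1 (ω (i + 1)).2.2.1

lemma sum_ofReal_mul {A : Fin N → ℝ} (hA : ∀ j, 0 ≤ A j) {w : Fin N → ℝ} (hw : ∀ j, 0 ≤ w j) :
    ∑ j, ENNReal.ofReal (A j) * ENNReal.ofReal (w j) = ENNReal.ofReal (∑ j, A j * w j) := by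
  rw [ENNReal.ofReal_sum_of_nonneg fun j _ => mul_nonneg (hA j) (hw j)]
  exact Finset.sum_congr rfl fun j _ => (ENNReal.ofReal_mul (hA j)).symm

lemma diagMean_mul_nonneg {X : Fin N → Eε → Eζ → ℝ} (hX0 : ∀ z e f, 0 ≤ X z e f) (i j : Fin N) :
    0 ≤ (M.P * M.diagMean X) i j := by
  rw [Multiplicative.diagMean, Matrix.mul_diagonal]
  exact mul_nonneg (M.P_stochastic.1 i j) (integral_nonneg fun p => hX0 j p.1 p.2)

variable {X : Fin N → Eε → Eζ → ℝ}

lemma measurable_shock_mult (hXm : ∀ z, Measurable fun p : Eε × Eζ => X z p.1 p.2) :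
    Measurable fun x : Shock N Eε Eζ Eη => X x.1 x.2.1 x.2.2.1 :=
  measurable_from_prod_countable_right fun z' =>
    (hXm z').comp (by fun_prop : Measurable fun p : Eε × Eζ × Eη => (p.1, p.2.1))

lemma measurable_cumProd (hXm : ∀ z, Measurable fun p : Eε × Eζ => X z p.1 p.2) (t : ℕ) :
    Measurable[info t] (cumProd (Eη := Eη) X t) := by
  unfold cumProd
  refine Finset.measurable_fun_prod _ fun i hi => (measurable_shock_mult hXm).comp
    (measurable_coord ?_)
  have := Finset.mem_range.1 hi
  omega

lemma cumProd_nonneg (hX0 : ∀ z e f, 0 ≤ X z e f) (t : ℕ) (ω : Path N Eε Eζ Eη) :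
    0 ≤ cumProd X t ω := Finset.prod_nonneg fun _ _ => hX0 _ _ _

lemma cumProd_succ (t : ℕ) (ω : Path N Eε Eζ Eη) : cumProd X (t + 1) ω =
    cumProd X t ω * X (ω (t + 1)).1 (ω (t + 1)).2.1 (ω (t + 1)).2.2.1 :=
  Finset.prod_range_succ _ _

lemma lintegral_step_diagMean_vec
    (hX : ∀ z, Integrable (fun p : Eε × Eζ => X z p.1 p.2) (M.με.prod M.μζ))
    (hXm : ∀ z, Measurable fun p : Eε × Eζ => X z p.1 p.2) (hX0 : ∀ z e f, 0 ≤ X z e f)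
    {w : Fin N → ℝ} (hw : ∀ j, 0 ≤ w j) (z : Fin N) :
    ∫⁻ x, ENNReal.ofReal (X x.1 x.2.1 x.2.2.1) * ENNReal.ofReal (w x.1) ∂step M I z =
      ENNReal.ofReal (∑ j, (M.P * M.diagMean X) z j * w j) := by
  rw [lintegral_step_diagMean M I z hX hXm hX0 (k := fun z _ => ENNReal.ofReal (w z))
    (fun _ => measurable_const), ← sum_ofReal_mul (fun j => diagMean_mul_nonneg M hX0 z j) hw]
  simp

/-- With `w = 1 + P D_X w`, the quantity `E ∏X · w(Z_t)` drops at each step by exactly `E ∏X`, so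
the drops sum to at most its initial value `w(z)`. -/
lemma tsum_lintegral_cumProd_lt_top
    (hX : ∀ z, Integrable (fun p : Eε × Eζ => X z p.1 p.2) (M.με.prod M.μζ))
    (hXm : ∀ z, Measurable fun p : Eε × Eζ => X z p.1 p.2) (hX0 : ∀ z e f, 0 ≤ X z e f)
    (hr : specRad (M.P * M.diagMean X) < 1) (z : Fin N) :
    ∑' t, ∫⁻ ω, ENNReal.ofReal (cumProd X t ω) ∂pathLaw M I z < ⊤ := by
  obtain ⟨w, hw1, hw⟩ := exists_eq_add_mulVec _ (diagMean_mul_nonneg M hX0) hr (fun _ => 1)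
    (fun _ => zero_le_one)
  have hw0 : ∀ j, 0 ≤ w j := fun j => zero_le_one.trans (hw1 j)
  refine lt_of_le_of_lt (tsum_le_of_decreasing (x := fun t =>
    ∫⁻ ω, ENNReal.ofReal (cumProd X t ω) * ENNReal.ofReal (w (state t ω)) ∂pathLaw M I z) ?_) ?_
  · intro t
    have hm : Measurable[info t] fun ω : Path N Eε Eζ Eη => ENNReal.ofReal (cumProd X t ω) :=
      (measurable_cumProd hXm t).ennreal_ofReal
    have hF : Measurable fun x : Shock N Eε Eζ Eη =>
        ENNReal.ofReal (X x.1 x.2.1 x.2.2.1) * ENNReal.ofReal (w x.1) :=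
      (measurable_shock_mult hXm).ennreal_ofReal.mul
        ((measurable_of_finite w).comp measurable_fst).ennreal_ofReal
    have h1 : ∀ ω : Path N Eε Eζ Eη, ENNReal.ofReal (cumProd X (t + 1) ω) *
        ENNReal.ofReal (w (state (t + 1) ω)) = ENNReal.ofReal (cumProd X t ω) *
        (fun x : Shock N Eε Eζ Eη => ENNReal.ofReal (X x.1 x.2.1 x.2.2.1) *
          ENNReal.ofReal (w x.1)) (ω (t + 1)) := by
      intro ω
      rw [cumProd_succ, ENNReal.ofReal_mul (cumProd_nonneg hX0 t ω), mul_assoc]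
      rfl
    simp_rw [h1]
    rw [lintegral_mul_next M I z t hm hF, ← lintegral_add_right _ (hm.mono (info_le t) le_rfl)]
    refine lintegral_mono fun ω => ?_
    simp only
    rw [lintegral_step_diagMean_vec M I hX hXm hX0 hw0, hw (state t ω),
      ENNReal.ofReal_add zero_le_one (Finset.sum_nonneg fun j _ =>
        mul_nonneg (diagMean_mul_nonneg M hX0 _ j) (hw0 j)), mul_add, add_comm,
      ENNReal.ofReal_one, mul_one]
  · have h2 : ∀ᵐ ω ∂pathLaw M I z, ENNReal.ofReal (cumProd X 0 ω) *
        ENNReal.ofReal (w (state 0 ω)) = ENNReal.ofReal (w z) := by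
      filter_upwards [state_zero_ae M I z] with ω hω
      simp [cumProd, hω]
    rw [lintegral_congr_ae h2]
    simp

/-- Conditionally on date `t`, the factors of date `t + 1` have mean at most a constant independent
of the state; what remains is the sum without `k`. -/
lemma tsum_lintegral_cumProd_mul_lt_top
    (hX : ∀ z, Integrable (fun p : Eε × Eζ => X z p.1 p.2) (M.με.prod M.μζ))
    (hXm : ∀ z, Measurable fun p : Eε × Eζ => X z p.1 p.2) (hX0 : ∀ z e f, 0 ≤ X z e f)
    (hr : specRad (M.P * M.diagMean X) < 1) {k : Fin N → Eη → ℝ≥0∞}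
    (hk : ∀ z, Measurable (k z)) (hkf : ∀ z, ∫⁻ e, k z e ∂I.μη < ⊤) (z : Fin N) :
    ∑' t, ∫⁻ ω, ENNReal.ofReal (cumProd X (t + 1) ω) * k (ω (t + 1)).1 (ω (t + 1)).2.2.2
      ∂pathLaw M I z < ⊤ := by
  set B : ℝ≥0∞ := ∑ i, ∑ j, ENNReal.ofReal ((M.P * M.diagMean X) i j) * ∫⁻ e, k j e ∂I.μη with hB
  have hBf : B < ⊤ := ENNReal.sum_lt_top.2 fun i _ => ENNReal.sum_lt_top.2 fun j _ =>
    ENNReal.mul_lt_top ENNReal.ofReal_lt_top (hkf j)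
  have hle : ∀ t, ∫⁻ ω, ENNReal.ofReal (cumProd X (t + 1) ω) * k (ω (t + 1)).1 (ω (t + 1)).2.2.2
      ∂pathLaw M I z ≤ (∫⁻ ω, ENNReal.ofReal (cumProd X t ω) ∂pathLaw M I z) * B := by
    intro t
    have hm : Measurable[info t] fun ω : Path N Eε Eζ Eη => ENNReal.ofReal (cumProd X t ω) :=
      (measurable_cumProd hXm t).ennreal_ofReal
    have hkm : Measurable fun x : Shock N Eε Eζ Eη => k x.1 x.2.2.2 :=
      measurable_from_prod_countable_right fun z' => (hk z').comp (by fun_prop)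
    have hF : Measurable fun x : Shock N Eε Eζ Eη =>
        ENNReal.ofReal (X x.1 x.2.1 x.2.2.1) * k x.1 x.2.2.2 :=
      (measurable_shock_mult hXm).ennreal_ofReal.mul hkm
    have h1 : ∀ ω : Path N Eε Eζ Eη, ENNReal.ofReal (cumProd X (t + 1) ω) *
        k (ω (t + 1)).1 (ω (t + 1)).2.2.2 = ENNReal.ofReal (cumProd X t ω) *
        (fun x : Shock N Eε Eζ Eη => ENNReal.ofReal (X x.1 x.2.1 x.2.2.1) *
          k x.1 x.2.2.2) (ω (t + 1)) := by
      intro ω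
      rw [cumProd_succ, ENNReal.ofReal_mul (cumProd_nonneg hX0 t ω), mul_assoc]
    simp_rw [h1]
    rw [lintegral_mul_next M I z t hm hF, ← lintegral_mul_const _ (hm.mono (info_le t) le_rfl)]
    refine lintegral_mono fun ω => ?_
    simp only
    rw [lintegral_step_diagMean M I _ hX hXm hX0 hk]
    gcongr
    exact Finset.single_le_sum (f := fun i => ∑ j, ENNReal.ofReal ((M.P * M.diagMean X) i j) *
      ∫⁻ e, k j e ∂I.μη) (fun _ _ => zero_le) (Finset.mem_univ _)
  refine (ENNReal.tsum_le_tsum hle).trans_lt ?_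
  rw [ENNReal.tsum_mul_right]
  exact ENNReal.mul_lt_top (tsum_lintegral_cumProd_lt_top M I hX hXm hX0 hr z) hBf

end Lyapunov

/-! ### Growth of discounted wealth. -/

section Growth

variable {N : ℕ} {Eε Eζ Eη : Type*} [MeasurableSpace Eε] [MeasurableSpace Eζ] [MeasurableSpace Eη]
variable (M : Multiplicative N Eε Eζ) (I : Income N Eη)

variable {M I}

lemma Multiplicative.Impatient.integrable_β_prod (hM : M.Impatient) (z : Fin N) :
    Integrable (fun p : Eε × Eζ => M.β z p.1) (M.με.prod M.μζ) :=
  (hM.integrable_β z).comp_fst _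

lemma measurable_β_prod (M : Multiplicative N Eε Eζ) (z : Fin N) :
    Measurable fun p : Eε × Eζ => M.β z p.1 := (M.β_measurable z).comp measurable_fst

lemma measurable_βR_prod (M : Multiplicative N Eε Eζ) (z : Fin N) :
    Measurable fun p : Eε × Eζ => M.β z p.1 * M.R z p.2 :=
  ((M.β_measurable z).comp measurable_fst).mul ((M.R_measurable z).comp measurable_snd)

lemma Multiplicative.βR_nonneg (M : Multiplicative N Eε Eζ) (z : Fin N) (e : Eε) (f : Eζ) :
    0 ≤ M.β z e * M.R z f := mul_nonneg (M.β_nonneg z e) (M.R_nonneg z f)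

/-- Discounted expected wealth is summable along every feasible plan. -/
lemma tsum_lintegral_disc_wealth_lt_top (hM : M.Impatient)
    (hY : ∀ z, Integrable (I.Y z) I.μη) {a : ℝ} {z : Fin N}
    {C : ℕ → Path N Eε Eζ Eη → ℝ} (hC : Feasible M I a z C) :
    ∑' t, ∫⁻ ω, ENNReal.ofReal (cumDisc M t ω) *
      (ENNReal.ofReal (wealth M I a C t ω) + 1) ∂pathLaw M I z < ⊤ := by
  have hA0 : ∀ i j, 0 ≤ M.PDβR i j := diagMean_mul_nonneg M M.βR_nonneg
  have hB0 : ∀ i j, 0 ≤ M.PDβ i j := diagMean_mul_nonneg M fun z e _ => M.β_nonneg z e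
  obtain ⟨w, hw1, hw⟩ := exists_eq_add_mulVec _ hA0 hM.specRad_βR (fun _ => 1)
    (fun _ => zero_le_one)
  have hw0 : ∀ j, 0 ≤ w j := fun j => zero_le_one.trans (hw1 j)
  have hYb : ∀ j, 0 ≤ ∫ e, I.Y j e ∂I.μη := fun j => integral_nonneg (I.Y_nonneg j)
  -- The Lyapunov function is `∏β · (a_t w(Z_t) + q(Z_t))`. The term in `w` loses `a_t` per step
  -- through `w = 1 + P D_{βR} w`, but new income adds `ρ`; the equation `q = 1 + ρ + P D_β q`
  -- compensates this and supplies the remaining `1`.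
  set ρ : Fin N → ℝ := fun i => ∑ j, M.PDβ i j * ((∫ e, I.Y j e ∂I.μη) * w j) with hρ
  have hρ0 : ∀ i, 0 ≤ ρ i := fun i => Finset.sum_nonneg fun j _ =>
    mul_nonneg (hB0 i j) (mul_nonneg (hYb j) (hw0 j))
  obtain ⟨q, hq1, hq⟩ := exists_eq_add_mulVec _ hB0 hM.specRad_β (fun i => 1 + ρ i)
    (fun i => add_nonneg zero_le_one (hρ0 i))
  have hq0 : ∀ j, 0 ≤ q j := fun j => (add_nonneg zero_le_one (hρ0 j)).trans (hq1 j)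
  have hwm : Measurable fun x : Shock N Eε Eζ Eη => ENNReal.ofReal (w x.1) :=
    ((measurable_of_finite w).comp measurable_fst).ennreal_ofReal
  have hqm : Measurable fun x : Shock N Eε Eζ Eη => ENNReal.ofReal (q x.1) :=
    ((measurable_of_finite q).comp measurable_fst).ennreal_ofReal
  have hβm := (measurable_shock_disc (Eη := Eη) M).ennreal_ofReal
  have hβRm := (measurable_shock_mult (Eη := Eη) (X := fun z e f => M.β z e * M.R z f)
    (measurable_βR_prod M)).ennreal_ofReal
  set F1 : Shock N Eε Eζ Eη → ℝ≥0∞ := fun x =>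
    ENNReal.ofReal (M.β x.1 x.2.1 * M.R x.1 x.2.2.1) * ENNReal.ofReal (w x.1) with hF1
  set F2 : Shock N Eε Eζ Eη → ℝ≥0∞ := fun x => ENNReal.ofReal (M.β x.1 x.2.1) *
    (ENNReal.ofReal (I.Y x.1 x.2.2.2) * ENNReal.ofReal (w x.1)) with hF2
  set F3 : Shock N Eε Eζ Eη → ℝ≥0∞ := fun x =>
    ENNReal.ofReal (M.β x.1 x.2.1) * ENNReal.ofReal (q x.1) with hF3
  have hF1m : Measurable F1 := hβRm.mul hwm
  have hF2m : Measurable F2 := hβm.mul ((measurable_shock_income I).ennreal_ofReal.mul hwm)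
  have hF3m : Measurable F3 := hβm.mul hqm
  have i1 : ∀ i, ∫⁻ x, F1 x ∂step M I i = ENNReal.ofReal (∑ j, M.PDβR i j * w j) := fun i =>
    lintegral_step_diagMean_vec M I hM.integrable_βR (measurable_βR_prod M) M.βR_nonneg hw0 i
  have i3 : ∀ i, ∫⁻ x, F3 x ∂step M I i = ENNReal.ofReal (∑ j, M.PDβ i j * q j) := fun i =>
    lintegral_step_diagMean_vec M I (X := fun z e _ => M.β z e) hM.integrable_β_prod
      (measurable_β_prod M) (fun z e _ => M.β_nonneg z e) hq0 i
  have i2 : ∀ i, ∫⁻ x, F2 x ∂step M I i = ENNReal.ofReal (ρ i) := by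
    intro i
    have := lintegral_step_diagMean M I i (X := fun z e _ => M.β z e) hM.integrable_β_prod
      (measurable_β_prod M) (fun z e _ => M.β_nonneg z e)
      (k := fun z e => ENNReal.ofReal (I.Y z e) * ENNReal.ofReal (w z))
      (fun z => (I.Y_measurable z).ennreal_ofReal.mul_const _)
    rw [hF2, this, hρ]
    simp only
    rw [← sum_ofReal_mul (A := fun j => M.PDβ i j) (hB0 i)
      (fun j => mul_nonneg (hYb j) (hw0 j))]
    refine Finset.sum_congr rfl fun j _ => ?_
    rw [lintegral_mul_const _ (I.Y_measurable j).ennreal_ofReal,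
      ENNReal.ofReal_mul (hYb j), ofReal_integral_eq_lintegral_ofReal (hY j)
        (ae_of_all _ (I.Y_nonneg j))]
    rfl
  have hCW : ∀ᵐ ω ∂pathLaw M I z, ∀ t, 0 ≤ C t ω ∧ C t ω ≤ wealth M I a C t ω := hC.constraint
  refine lt_of_le_of_lt (tsum_le_of_decreasing (x := fun t =>
    ∫⁻ ω, ENNReal.ofReal (cumDisc M t ω) * (ENNReal.ofReal (wealth M I a C t ω) *
      ENNReal.ofReal (w (state t ω)) + ENNReal.ofReal (q (state t ω))) ∂pathLaw M I z) ?_) ?_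
  · intro t
    have hD : Measurable[info t] fun ω : Path N Eε Eζ Eη => ENNReal.ofReal (cumDisc M t ω) :=
      (measurable_cumDisc M t).ennreal_ofReal
    have hW : Measurable[info t] fun ω : Path N Eε Eζ Eη =>
        ENNReal.ofReal (wealth M I a C t ω) := (measurable_wealth M I hC.adapted t).ennreal_ofReal
    have hDW : Measurable[info t] fun ω : Path N Eε Eζ Eη =>
        ENNReal.ofReal (cumDisc M t ω) * ENNReal.ofReal (wealth M I a C t ω) := hD.mul hW
    have hb : ∀ᵐ ω ∂pathLaw M I z, ENNReal.ofReal (cumDisc M (t + 1) ω) *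
        (ENNReal.ofReal (wealth M I a C (t + 1) ω) * ENNReal.ofReal (w (state (t + 1) ω)) +
          ENNReal.ofReal (q (state (t + 1) ω))) ≤
        ENNReal.ofReal (cumDisc M t ω) * ENNReal.ofReal (wealth M I a C t ω) * F1 (ω (t + 1)) +
        (ENNReal.ofReal (cumDisc M t ω) * F2 (ω (t + 1)) +
          ENNReal.ofReal (cumDisc M t ω) * F3 (ω (t + 1))) := by
      filter_upwards [hCW] with ω hω
      have h0 := (hω t).1
      have hw' : 0 ≤ wealth M I a C t ω := h0.trans (hω t).2
      have hle : ENNReal.ofReal (wealth M I a C (t + 1) ω) ≤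
          ENNReal.ofReal (retAt M (t + 1) ω) * ENNReal.ofReal (wealth M I a C t ω) +
            ENNReal.ofReal (incAt I (t + 1) ω) := by
        rw [← ENNReal.ofReal_mul (retAt_nonneg M _ _), ← ENNReal.ofReal_add
          (mul_nonneg (retAt_nonneg M _ _) hw') (incAt_nonneg I _ _)]
        refine ENNReal.ofReal_le_ofReal ?_
        rw [wealth]
        gcongr
        · exact retAt_nonneg M _ _
        · linarith
      calc _ ≤ ENNReal.ofReal (cumDisc M (t + 1) ω) *
          ((ENNReal.ofReal (retAt M (t + 1) ω) * ENNReal.ofReal (wealth M I a C t ω) +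
            ENNReal.ofReal (incAt I (t + 1) ω)) * ENNReal.ofReal (w (state (t + 1) ω)) +
          ENNReal.ofReal (q (state (t + 1) ω))) := by gcongr
        _ = _ := by
          rw [cumDisc_succ, ENNReal.ofReal_mul (cumDisc_nonneg M t ω), hF1, hF2, hF3]
          simp only
          rw [ENNReal.ofReal_mul (M.β_nonneg _ _)]
          simp only [discAt, retAt, incAt, state]
          ring
    calc _ ≤ (∫⁻ ω, (ENNReal.ofReal (cumDisc M t ω) * ENNReal.ofReal (wealth M I a C t ω) *
          F1 (ω (t + 1)) + (ENNReal.ofReal (cumDisc M t ω) * F2 (ω (t + 1)) +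
          ENNReal.ofReal (cumDisc M t ω) * F3 (ω (t + 1)))) ∂pathLaw M I z) +
          ∫⁻ ω, ENNReal.ofReal (cumDisc M t ω) *
      (ENNReal.ofReal (wealth M I a C t ω) + 1) ∂pathLaw M I z := by
          gcongr ?_ + _
          exact lintegral_mono_ae hb
      _ = _ := by
        have m0 := info_le (N := N) (Eε := Eε) (Eζ := Eζ) (Eη := Eη) t
        have hD' := hD.mono m0 le_rfl
        have hDW' := hDW.mono m0 le_rfl
        have c1 : Measurable fun ω : Path N Eε Eζ Eη => F1 (ω (t + 1)) :=
          hF1m.comp (measurable_path_apply (t + 1))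
        have c2 : Measurable fun ω : Path N Eε Eζ Eη => F2 (ω (t + 1)) :=
          hF2m.comp (measurable_path_apply (t + 1))
        rw [lintegral_add_left (hDW'.fun_mul c1), lintegral_add_left (hD'.fun_mul c2),
          lintegral_mul_next M I z t hDW hF1m, lintegral_mul_next M I z t hD hF2m,
          lintegral_mul_next M I z t hD hF3m]
        simp_rw [i1, i2, i3]
        have st : Measurable fun ω : Path N Eε Eζ Eη => state t ω :=
          (measurable_state le_rfl).mono m0 le_rfl
        have s1 : ∀ g : Fin N → ℝ≥0∞, Measurable fun ω : Path N Eε Eζ Eη => g (state t ω) :=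
          fun g => (measurable_of_finite g).comp st
        rw [← lintegral_add_left (hD'.fun_mul (s1 fun i => ENNReal.ofReal (ρ i))),
          ← lintegral_add_left (hDW'.fun_mul (s1 fun i => ENNReal.ofReal (∑ j, M.PDβR i j * w j))),
          ← lintegral_add_right _ (hD'.fun_mul ((hW.mono m0 le_rfl).fun_add measurable_const))]
        refine lintegral_congr fun ω => ?_
        have e1 : ENNReal.ofReal (w (state t ω)) =
            1 + ENNReal.ofReal (∑ j, M.PDβR (state t ω) j * w j) := by
          rw [hw (state t ω), ENNReal.ofReal_add zero_le_one (Finset.sum_nonneg fun j _ =>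
            mul_nonneg (hA0 _ j) (hw0 j)), ENNReal.ofReal_one]
        have e2 : ENNReal.ofReal (q (state t ω)) =
            1 + ENNReal.ofReal (ρ (state t ω)) +
              ENNReal.ofReal (∑ j, M.PDβ (state t ω) j * q j) := by
          rw [hq (state t ω), ENNReal.ofReal_add (add_nonneg zero_le_one (hρ0 _))
            (Finset.sum_nonneg fun j _ => mul_nonneg (hB0 _ j) (hq0 j)),
            ENNReal.ofReal_add zero_le_one (hρ0 _), ENNReal.ofReal_one]
        rw [e1, e2]
        ring
  · have h2 : ∀ᵐ ω ∂pathLaw M I z, ENNReal.ofReal (cumDisc M 0 ω) *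
        (ENNReal.ofReal (wealth M I a C 0 ω) * ENNReal.ofReal (w (state 0 ω)) +
          ENNReal.ofReal (q (state 0 ω))) =
        ENNReal.ofReal a * ENNReal.ofReal (w z) + ENNReal.ofReal (q z) := by
      filter_upwards [state_zero_ae M I z] with ω hω
      simp [cumDisc, hω, wealth]
    rw [lintegral_congr_ae h2]
    simp [ENNReal.mul_lt_top]

end Growth

/-! ### Finiteness of lifetime utility and comparison with deviations. -/

section Value

variable {N : ℕ} {Eε Eζ Eη : Type*} [MeasurableSpace Eε] [MeasurableSpace Eζ] [MeasurableSpace Eη]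
variable {M : Multiplicative N Eε Eζ} {I : Income N Eη}

variable {u : ℝ → EReal} {a : ℝ} {z : Fin N} {C C' : ℕ → Path N Eε Eζ Eη → ℝ}

/-- Positive part of discounted utility at date `t`. -/
def posPart (M : Multiplicative N Eε Eζ) (u : ℝ → EReal) (C : ℕ → Path N Eε Eζ Eη → ℝ) (t : ℕ)
    (ω : Path N Eε Eζ Eη) : ℝ≥0∞ := ENNReal.ofReal (cumDisc M t ω) * (u (C t ω)).toENNReal

/-- Negative part of discounted utility at date `t`. -/
def negPart (M : Multiplicative N Eε Eζ) (u : ℝ → EReal) (C : ℕ → Path N Eε Eζ Eη → ℝ) (t : ℕ)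
    (ω : Path N Eε Eζ Eη) : ℝ≥0∞ := ENNReal.ofReal (cumDisc M t ω) * (-u (C t ω)).toENNReal

lemma measurable_ofReal_cumDisc (M : Multiplicative N Eε Eζ) (t : ℕ) :
    Measurable fun ω : Path N Eε Eζ Eη => ENNReal.ofReal (cumDisc M t ω) :=
  ((measurable_cumDisc M t).mono (info_le t) le_rfl).ennreal_ofReal

lemma Feasible.measurable (hC : Feasible M I a z C) (t : ℕ) : Measurable (C t) :=
  (hC.adapted t).mono (info_le t) le_rfl

lemma Feasible.aemeasurable_posPart (hu : InadaUtility u) (hC : Feasible M I a z C) (t : ℕ) :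
    AEMeasurable (posPart M u C t) (pathLaw M I z) := by
  refine (measurable_ofReal_cumDisc M t).aemeasurable.mul ?_
  refine AEMeasurable.congr (f := fun ω => (u (max (C t ω) 0)).toENNReal)
    (measurable_ereal_toENNReal.comp (hu.measurable_max.comp (hC.measurable t))).aemeasurable ?_
  filter_upwards [hC.constraint] with ω hω
  rw [max_eq_left (hω t).1]

lemma Feasible.aemeasurable_negPart (hu : InadaUtility u) (hC : Feasible M I a z C) (t : ℕ) :
    AEMeasurable (negPart M u C t) (pathLaw M I z) := by
  refine (measurable_ofReal_cumDisc M t).aemeasurable.mul ?_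
  refine AEMeasurable.congr (f := fun ω => (-u (max (C t ω) 0)).toENNReal)
    (measurable_ereal_toENNReal.comp
      (measurable_neg.comp (hu.measurable_max.comp (hC.measurable t)))).aemeasurable ?_
  filter_upwards [hC.constraint] with ω hω
  rw [max_eq_left (hω t).1]

/-- Utility grows at most linearly and consumption is at most wealth. -/
lemma Feasible.lintegral_posPart_lt_top (hu : InadaUtility u) (hM : M.Impatient)
    (hI : I.Admissible u) (hC : Feasible M I a z C) :
    ∫⁻ ω, ∑' t, posPart M u C t ω ∂pathLaw M I z < ⊤ := by
  rw [lintegral_tsum fun t => hC.aemeasurable_posPart hu t]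
  set A := ENNReal.ofReal (|(u 1).toReal| + marginal u 1) with hA
  have hle : ∀ t, ∫⁻ ω, posPart M u C t ω ∂pathLaw M I z ≤ A *
      ∫⁻ ω, ENNReal.ofReal (cumDisc M t ω) *
        (ENNReal.ofReal (wealth M I a C t ω) + 1) ∂pathLaw M I z := by
    intro t
    rw [← lintegral_const_mul' _ _ ENNReal.ofReal_ne_top]
    refine lintegral_mono_ae ?_
    filter_upwards [hC.constraint] with ω hω
    rw [posPart, mul_left_comm]
    gcongr
    refine (hu.pos_le (hω t).1).trans ?_
    gcongr
    exact (hω t).2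
  refine (ENNReal.tsum_le_tsum hle).trans_lt ?_
  rw [ENNReal.tsum_mul_left]
  exact ENNReal.mul_lt_top ENNReal.ofReal_lt_top
    (tsum_lintegral_disc_wealth_lt_top hM hI.integrable_Y hC)

/-- The plan that consumes all wealth at every date. -/
def autarky (I : Income N Eη) (a : ℝ) : ℕ → Path N Eε Eζ Eη → ℝ
  | 0, _ => a
  | t + 1, ω => incAt I (t + 1) ω

lemma wealth_autarky (t : ℕ) (ω : Path N Eε Eζ Eη) :
    wealth M I a (autarky I a) t ω = autarky I a t ω := by
  induction t with
  | zero => rfl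
  | succ t ih => simp [wealth, ih, autarky]

lemma feasible_autarky (ha : 0 ≤ a) : Feasible M I a z (autarky I a) where
  adapted t := by
    cases t with
    | zero => exact measurable_const
    | succ t => exact measurable_incAt I le_rfl
  constraint := by
    refine ae_of_all _ fun ω t => ⟨?_, (wealth_autarky t ω).ge⟩
    cases t with
    | zero => exact ha
    | succ t => exact incAt_nonneg I _ ω

lemma measurable_marginalExt_income (hu : InadaUtility u) (z : Fin N) :
    Measurable fun e => marginalExt u (I.Y z e) :=
  hu.measurable_marginalExt.comp (I.Y_measurable z)

/-- Autarky is a benchmark of finite value: after date `0` it consumes `Y`, whose marginal utility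
is integrable. -/
lemma lintegral_negPart_autarky_lt_top (hu : InadaUtility u) (hM : M.Impatient)
    (hI : I.Admissible u) (ha : 0 < a) :
    ∫⁻ ω, ∑' t, negPart M u (autarky I a) t ω ∂pathLaw M I z < ⊤ := by
  have hC : Feasible M I a z (autarky I a) := feasible_autarky ha.le
  rw [lintegral_tsum fun t => hC.aemeasurable_negPart hu t]
  have hD : ∑' t, ∫⁻ ω, ENNReal.ofReal (cumDisc M t ω) ∂pathLaw M I z < ⊤ :=
    tsum_lintegral_cumProd_lt_top M I (X := fun z e _ => M.β z e) hM.integrable_β_prod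
      (measurable_β_prod M) (fun z e _ => M.β_nonneg z e) hM.specRad_β z
  have hE : ∑' t, ∫⁻ ω, ENNReal.ofReal (cumDisc M (t + 1) ω) *
      marginalExt u (incAt I (t + 1) ω) ∂pathLaw M I z < ⊤ :=
    tsum_lintegral_cumProd_mul_lt_top M I (X := fun z e _ => M.β z e) hM.integrable_β_prod
      (measurable_β_prod M) (fun z e _ => M.β_nonneg z e) hM.specRad_β
      (measurable_marginalExt_income hu) hI.marginal_Y z
  set A := ENNReal.ofReal |(u 1).toReal|
  have hle : ∀ t, ∫⁻ ω, negPart M u (autarky I a) t ω ∂pathLaw M I z ≤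
      A * (∫⁻ ω, ENNReal.ofReal (cumDisc M t ω) ∂pathLaw M I z) +
      ∫⁻ ω, ENNReal.ofReal (cumDisc M t ω) * marginalExt u (autarky I a t ω) ∂pathLaw M I z := by
    intro t
    rw [← lintegral_const_mul' _ _ ENNReal.ofReal_ne_top, ← lintegral_add_left
      ((measurable_ofReal_cumDisc M t).const_mul A)]
    refine lintegral_mono_ae ?_
    filter_upwards [hC.constraint] with ω hω
    rw [negPart, mul_comm A, ← mul_add]
    gcongr
    exact hu.neg_le (hω t).1
  refine (ENNReal.tsum_le_tsum hle).trans_lt ?_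
  rw [ENNReal.tsum_add, ENNReal.tsum_mul_left]
  refine ENNReal.add_lt_top.2 ⟨ENNReal.mul_lt_top ENNReal.ofReal_lt_top hD, ?_⟩
  rw [tsum_eq_zero_add' ENNReal.summable]
  refine ENNReal.add_lt_top.2 ⟨?_, hE⟩
  simp [cumDisc, autarky, marginalExt_of_pos ha]

lemma ereal_sub_le_sub {p n p' n' : ℝ≥0∞} (hp : p ≠ ⊤) (hn : n ≠ ⊤) (hp' : p' ≠ ⊤) (hn' : n' ≠ ⊤)
    (h : (p' : EReal) - (n' : EReal) ≤ (p : EReal) - (n : EReal)) : p' + n ≤ p + n' := by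
  lift p to NNReal using hp
  lift n to NNReal using hn
  lift p' to NNReal using hp'
  lift n' to NNReal using hn'
  have e : ∀ x : NNReal, ((x : ℝ≥0∞) : EReal) = ((x : ℝ) : EReal) := fun x => rfl
  rw [e, e, e, e, ← EReal.coe_sub, ← EReal.coe_sub, EReal.coe_le_coe_iff] at h
  have : (p' : ℝ) + n ≤ p + n' := by linarith
  exact_mod_cast this

/-- Otherwise the solution would have value `-∞` and lose to autarky. -/
lemma Solves.lintegral_negPart_lt_top (hu : InadaUtility u) (hM : M.Impatient)
    (hI : I.Admissible u) (ha : 0 < a) (hS : Solves M I u a z C) :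
    ∫⁻ ω, ∑' t, negPart M u C t ω ∂pathLaw M I z < ⊤ := by
  by_contra hc
  have hc : ∫⁻ ω, ∑' t, negPart M u C t ω ∂pathLaw M I z = ⊤ := not_lt_top_iff.1 hc
  have h := hS.optimal _ (feasible_autarky ha.le)
  have hp := (hS.feasible.lintegral_posPart_lt_top hu hM hI).ne
  have hn := (lintegral_negPart_autarky_lt_top (z := z) hu hM hI ha).ne
  unfold lifetimeUtility at h
  change _ ≤ ((∫⁻ ω, ∑' t, posPart M u C t ω ∂pathLaw M I z : ℝ≥0∞) : EReal) -
    ((∫⁻ ω, ∑' t, negPart M u C t ω ∂pathLaw M I z : ℝ≥0∞) : EReal) at h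
  change ((∫⁻ ω, ∑' t, posPart M u (autarky I a) t ω ∂pathLaw M I z : ℝ≥0∞) : EReal) -
    ((∫⁻ ω, ∑' t, negPart M u (autarky I a) t ω ∂pathLaw M I z : ℝ≥0∞) : EReal) ≤ _ at h
  have hpa := ((feasible_autarky (M := M) (I := I) (z := z) ha.le).lintegral_posPart_lt_top
    hu hM hI).ne
  rw [hc] at h
  lift (∫⁻ ω, ∑' t, posPart M u C t ω ∂pathLaw M I z) to NNReal using hp with p
  lift (∫⁻ ω, ∑' t, posPart M u (autarky I a) t ω ∂pathLaw M I z) to NNReal using hpa with p'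
  lift (∫⁻ ω, ∑' t, negPart M u (autarky I a) t ω ∂pathLaw M I z) to NNReal using hn with n'
  have e : ∀ x : NNReal, ((x : ℝ≥0∞) : EReal) = ((x : ℝ) : EReal) := fun x => rfl
  rw [e, e, e, ← EReal.coe_sub] at h
  rw [EReal.coe_ennreal_top, EReal.sub_top, le_bot_iff] at h
  exact EReal.coe_ne_bot _ h

/-- First-order principle: if a feasible deviation `C'` gains `g` and loses `l` relative to a
solution `C`, then the total expected gain is at most the total expected loss. -/
lemma Solves.lintegral_gain_le (hu : InadaUtility u) (hM : M.Impatient)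
    (hI : I.Admissible u) (ha : 0 < a) (hS : Solves M I u a z C) (hC' : Feasible M I a z C')
    {g l : ℕ → Path N Eε Eζ Eη → ℝ≥0∞}
    (h : ∀ᵐ ω ∂pathLaw M I z, ∀ t, posPart M u C t ω + negPart M u C' t ω + g t ω ≤
      posPart M u C' t ω + negPart M u C t ω + l t ω) :
    ∫⁻ ω, ∑' t, g t ω ∂pathLaw M I z ≤ ∫⁻ ω, ∑' t, l t ω ∂pathLaw M I z := by
  have hopt := hS.optimal _ hC'
  have hp := (hS.feasible.lintegral_posPart_lt_top hu hM hI).ne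
  have hp' := (hC'.lintegral_posPart_lt_top hu hM hI).ne
  have hn := (hS.lintegral_negPart_lt_top hu hM hI ha).ne
  have mp : AEMeasurable (fun ω => ∑' t, posPart M u C t ω) (pathLaw M I z) :=
    AEMeasurable.tsum (hS.feasible.aemeasurable_posPart hu)
  have mn : AEMeasurable (fun ω => ∑' t, negPart M u C t ω) (pathLaw M I z) :=
    AEMeasurable.tsum (hS.feasible.aemeasurable_negPart hu)
  have mp' : AEMeasurable (fun ω => ∑' t, posPart M u C' t ω) (pathLaw M I z) :=
    AEMeasurable.tsum (hC'.aemeasurable_posPart hu)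
  have mn' : AEMeasurable (fun ω => ∑' t, negPart M u C' t ω) (pathLaw M I z) :=
    AEMeasurable.tsum (hC'.aemeasurable_negPart hu)
  have hsum : ∫⁻ ω, ((∑' t, posPart M u C t ω) + ((∑' t, negPart M u C' t ω) + ∑' t, g t ω))
      ∂pathLaw M I z ≤ ∫⁻ ω, ((∑' t, posPart M u C' t ω) + ((∑' t, negPart M u C t ω) +
        ∑' t, l t ω)) ∂pathLaw M I z := by
    refine lintegral_mono_ae ?_
    filter_upwards [h] with ω hω
    rw [← ENNReal.tsum_add, ← ENNReal.tsum_add, ← ENNReal.tsum_add, ← ENNReal.tsum_add]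
    refine ENNReal.tsum_le_tsum fun t => ?_
    rw [← add_assoc, ← add_assoc]
    exact hω t
  rw [lintegral_add_left' mp, lintegral_add_left' mn', lintegral_add_left' mp',
    lintegral_add_left' mn] at hsum
  change ((∫⁻ ω, ∑' t, posPart M u C' t ω ∂pathLaw M I z : ℝ≥0∞) : EReal) -
    ((∫⁻ ω, ∑' t, negPart M u C' t ω ∂pathLaw M I z : ℝ≥0∞) : EReal) ≤
    ((∫⁻ ω, ∑' t, posPart M u C t ω ∂pathLaw M I z : ℝ≥0∞) : EReal) -
    ((∫⁻ ω, ∑' t, negPart M u C t ω ∂pathLaw M I z : ℝ≥0∞) : EReal) at hopt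
  -- A deviation may have value `-∞`. Then the left side of `hsum` is infinite, while the utility
  -- terms on the right are finite, so the total loss is infinite.
  by_cases hn' : ∫⁻ ω, ∑' t, negPart M u C' t ω ∂pathLaw M I z = ⊤
  · rw [hn', top_add, add_top, top_le_iff, ENNReal.add_eq_top, ENNReal.add_eq_top] at hsum
    rcases hsum with h1 | h1 | h1
    · exact absurd h1 hp'
    · exact absurd h1 hn
    · rw [h1]; exact le_top
  · have h2 := ereal_sub_le_sub hp hn hp' hn' hopt
    have h3 : (∫⁻ ω, ∑' t, posPart M u C t ω ∂pathLaw M I z) +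
        (∫⁻ ω, ∑' t, negPart M u C' t ω ∂pathLaw M I z) + ∫⁻ ω, ∑' t, g t ω ∂pathLaw M I z ≤
        (∫⁻ ω, ∑' t, posPart M u C t ω ∂pathLaw M I z) +
        (∫⁻ ω, ∑' t, negPart M u C' t ω ∂pathLaw M I z) + ∫⁻ ω, ∑' t, l t ω ∂pathLaw M I z := by
      rw [← add_assoc, ← add_assoc] at hsum
      exact hsum.trans (by gcongr)
    exact (ENNReal.add_le_add_iff_left (ENNReal.add_ne_top.2 ⟨hp, hn'⟩)).1 h3

end Value

/-! ### The two deviations: saving for one period, and borrowing with gradual repayment. -/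

section Deviations

variable {N : ℕ} {Eε Eζ Eη : Type*} [MeasurableSpace Eε] [MeasurableSpace Eζ] [MeasurableSpace Eη]
variable {M : Multiplicative N Eε Eζ} {I : Income N Eη}

variable {u : ℝ → EReal} {a : ℝ} {z : Fin N} {C : ℕ → Path N Eε Eζ Eη → ℝ}

lemma InadaUtility.continuousAt_marginalExt (hu : InadaUtility u) {c : ℝ} (hc : 0 < c) :
    ContinuousAt (marginalExt u) c := by
  have h : marginalExt u =ᶠ[𝓝 c] fun x => ENNReal.ofReal (marginal u x) := by
    filter_upwards [Ioi_mem_nhds hc] with x hx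
    exact marginalExt_of_pos hx
  refine ContinuousAt.congr ?_ h.symm
  exact ENNReal.continuous_ofReal.continuousAt.comp
    (hu.continuousOn_marginal.continuousAt (Ioi_mem_nhds hc))

/-- Consume `ε` less at date `0` and the proceeds at date `1`. -/
def savePlan (M : Multiplicative N Eε Eζ) (C : ℕ → Path N Eε Eζ Eη → ℝ) (ε : ℝ) :
    ℕ → Path N Eε Eζ Eη → ℝ
  | 0, ω => C 0 ω - ε
  | 1, ω => C 1 ω + retAt M 1 ω * ε
  | t + 2, ω => C (t + 2) ω

lemma wealth_savePlan_add_two (ε : ℝ) (t : ℕ) (ω : Path N Eε Eζ Eη) :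
    wealth M I a (savePlan M C ε) (t + 2) ω = wealth M I a C (t + 2) ω := by
  induction t with
  | zero => simp only [wealth, savePlan]; ring
  | succ t ih =>
    rw [show t + 1 + 2 = (t + 2) + 1 from rfl, wealth, ih]
    rfl

lemma Feasible.savePlan (hC : Feasible M I a z C) {ε : ℝ} (hε : 0 ≤ ε)
    (h0 : ∀ᵐ ω ∂pathLaw M I z, ε ≤ C 0 ω) : Feasible M I a z (savePlan M C ε) where
  adapted t := by
    match t with
    | 0 => exact (hC.adapted 0).sub_const ε
    | 1 => exact (hC.adapted 1).add ((measurable_retAt M le_rfl).mul_const ε)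
    | t + 2 => exact hC.adapted (t + 2)
  constraint := by
    filter_upwards [hC.constraint, h0] with ω hω h0 t
    match t with
    | 0 =>
      have := (hω 0).2
      simp only [IncomeFluctuation.savePlan, wealth] at this ⊢
      exact ⟨by linarith, by linarith⟩
    | 1 =>
      have := hω 1
      have hR := mul_nonneg (retAt_nonneg M 1 ω) hε
      simp only [IncomeFluctuation.savePlan, wealth] at this ⊢
      exact ⟨by linarith, by linarith⟩
    | t + 2 =>
      rw [wealth_savePlan_add_two]
      exact hω (t + 2)

lemma cumDisc_one (ω : Path N Eε Eζ Eη) : cumDisc M 1 ω = discAt M 1 ω := by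
  simp [cumDisc]

/-- Euler inequality: the marginal value of saving does not exceed the marginal utility of
consumption. -/
lemma Solves.euler_ge (hu : InadaUtility u) (hM : M.Impatient) (hI : I.Admissible u) (ha : 0 < a)
    (hS : Solves M I u a z C) {c₀ : ℝ} (hc₀ : 0 < c₀) (h0 : ∀ᵐ ω ∂pathLaw M I z, C 0 ω = c₀)
    (h1 : ∀ᵐ ω ∂pathLaw M I z, 0 < C 1 ω) :
    ∫⁻ ω, ENNReal.ofReal (discAt M 1 ω * retAt M 1 ω) * marginalExt u (C 1 ω) ∂pathLaw M I z ≤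
      marginalExt u c₀ := by
  -- Concavity prices the gain and the loss at the marginal utilities after the deviation.
  have key : ∀ ε, 0 < ε → ε < c₀ →
      ∫⁻ ω, ENNReal.ofReal (discAt M 1 ω * retAt M 1 ω) *
        marginalExt u (C 1 ω + retAt M 1 ω * ε) ∂pathLaw M I z ≤ marginalExt u (c₀ - ε) := by
    intro ε hε hεc
    have hfe : Feasible M I a z (savePlan M C ε) := hS.feasible.savePlan hε.le
      (h0.mono fun ω hω => by rw [hω]; exact hεc.le)
    have hgl := hS.lintegral_gain_le hu hM hI ha hfe
      (g := fun t ω => if t = 1 then ENNReal.ofReal (discAt M 1 ω) *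
        (marginalExt u (C 1 ω + retAt M 1 ω * ε) * ENNReal.ofReal (retAt M 1 ω * ε)) else 0)
      (l := fun t _ => if t = 0 then marginalExt u (c₀ - ε) * ENNReal.ofReal ε else 0) ?_
    · simp only [tsum_ite_eq, lintegral_const, measure_univ, mul_one] at hgl
      have e : ∀ ω : Path N Eε Eζ Eη, ENNReal.ofReal (discAt M 1 ω) *
          (marginalExt u (C 1 ω + retAt M 1 ω * ε) * ENNReal.ofReal (retAt M 1 ω * ε)) =
          ENNReal.ofReal (discAt M 1 ω * retAt M 1 ω) *
            marginalExt u (C 1 ω + retAt M 1 ω * ε) * ENNReal.ofReal ε := by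
        intro ω
        rw [ENNReal.ofReal_mul (retAt_nonneg M 1 ω), ENNReal.ofReal_mul (discAt_nonneg M 1 ω)]
        ring
      simp_rw [e] at hgl
      rw [lintegral_mul_const' _ _ ENNReal.ofReal_ne_top] at hgl
      exact (ENNReal.mul_le_mul_iff_left (by simpa using hε) ENNReal.ofReal_ne_top).1 hgl
    · filter_upwards [h0, h1] with ω hω0 hω1 t
      match t with
      | 0 =>
        have := hu.loss_le (x := c₀) (y := c₀ - ε) (by linarith) (by linarith)
        simpa [posPart, negPart, savePlan, hω0, cumDisc] using this
      | 1 =>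
        have := hu.le_gain (x := C 1 ω) (y := C 1 ω + retAt M 1 ω * ε) hω1
          (le_add_of_nonneg_right (mul_nonneg (retAt_nonneg M 1 ω) hε.le))
        rw [add_sub_cancel_left] at this
        simp only [posPart, negPart, savePlan, cumDisc_one, one_ne_zero, if_false, add_zero,
          if_true, ← mul_add]
        gcongr
      | t + 2 => simp [posPart, negPart, savePlan]
  -- The shift by `2` keeps the deviation strictly below `c₀` already at `n = 0`. As the integral is
  -- to be bounded from above, Fatou's lemma suffices for the limit.
  have hlim : Tendsto (fun n : ℕ => c₀ / (n + 2)) atTop (𝓝 0) := by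
    have : Tendsto (fun n : ℕ => ((n : ℝ) + 2)) atTop atTop :=
      tendsto_atTop_add_const_right _ _ tendsto_natCast_atTop_atTop
    exact this.const_div_atTop _
  have hpos : ∀ n : ℕ, 0 < c₀ / (n + 2) := fun n => by positivity
  have hlt : ∀ n : ℕ, c₀ / (n + 2) < c₀ := fun n =>
    div_lt_self hc₀ (by have : (0 : ℝ) ≤ n := n.cast_nonneg; linarith)
  have hR1 : Measurable (retAt (Eη := Eη) M 1) :=
    (measurable_retAt M le_rfl).mono (info_le 1) le_rfl
  have hβ1 : Measurable (discAt (Eη := Eη) M 1) :=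
    (measurable_discAt M le_rfl).mono (info_le 1) le_rfl
  have hC1 := hS.feasible.measurable 1
  have hfatou := lintegral_liminf_le (μ := pathLaw M I z) (u := atTop) (f := fun (n : ℕ) ω =>
    ENNReal.ofReal (discAt M 1 ω * retAt M 1 ω) *
      marginalExt u (C 1 ω + retAt M 1 ω * (c₀ / (n + 2))))
    (fun n => (hβ1.mul hR1).ennreal_ofReal.mul
      (hu.measurable_marginalExt.comp (hC1.add (hR1.mul_const _))))
  have hrhs : Tendsto (fun n : ℕ => marginalExt u (c₀ - c₀ / (n + 2))) atTop
      (𝓝 (marginalExt u c₀)) := by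
    refine (hu.continuousAt_marginalExt hc₀).tendsto.comp ?_
    simpa using hlim.const_sub c₀
  calc _ = ∫⁻ ω, liminf (fun n : ℕ => ENNReal.ofReal (discAt M 1 ω * retAt M 1 ω) *
      marginalExt u (C 1 ω + retAt M 1 ω * (c₀ / (n + 2)))) atTop ∂pathLaw M I z := by
        refine lintegral_congr_ae ?_
        filter_upwards [h1] with ω hω
        refine (Tendsto.liminf_eq ?_).symm
        refine ENNReal.Tendsto.const_mul ?_ (Or.inr ENNReal.ofReal_ne_top)
        refine (hu.continuousAt_marginalExt hω).tendsto.comp ?_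
        simpa using (hlim.const_mul (retAt M 1 ω)).const_add (C 1 ω)
    _ ≤ _ := hfatou
    _ ≤ liminf (fun n : ℕ => marginalExt u (c₀ - c₀ / (n + 2))) atTop :=
        liminf_le_liminf (Eventually.of_forall fun n => key _ (hpos n) (hlt n))
    _ = _ := hrhs.liminf_eq

/-- Extra savings still to be repaid after date `t`, when `ε` more is consumed at date `0` and
later consumption is cut down to the floor `φ` until the extra consumption is repaid. -/
def leftover (M : Multiplicative N Eε Eζ) (C φ : ℕ → Path N Eε Eζ Eη → ℝ) (ε : ℝ) :
    ℕ → Path N Eε Eζ Eη → ℝ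
  | 0, _ => ε
  | t + 1, ω => retAt M (t + 1) ω * leftover M C φ ε t ω -
      min (retAt M (t + 1) ω * leftover M C φ ε t ω) (max (C (t + 1) ω - φ (t + 1) ω) 0)

/-- The cut in consumption at date `t`. -/
def cut (M : Multiplicative N Eε Eζ) (C φ : ℕ → Path N Eε Eζ Eη → ℝ) (ε : ℝ) :
    ℕ → Path N Eε Eζ Eη → ℝ
  | 0, _ => -ε
  | t + 1, ω => min (retAt M (t + 1) ω * leftover M C φ ε t ω) (max (C (t + 1) ω - φ (t + 1) ω) 0)

/-- Consume `ε` more at date `0`, then cut consumption as long as it exceeds the floor `φ`. -/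
def borrowPlan (M : Multiplicative N Eε Eζ) (C φ : ℕ → Path N Eε Eζ Eη → ℝ) (ε : ℝ) (t : ℕ)
    (ω : Path N Eε Eζ Eη) : ℝ := C t ω - cut M C φ ε t ω

variable {φ : ℕ → Path N Eε Eζ Eη → ℝ} {ε : ℝ}

lemma leftover_nonneg (hε : 0 ≤ ε) (t : ℕ) (ω : Path N Eε Eζ Eη) : 0 ≤ leftover M C φ ε t ω := by
  cases t with
  | zero => exact hε
  | succ t => exact sub_nonneg.2 (min_le_left _ _)

lemma cut_succ_nonneg (hε : 0 ≤ ε) (t : ℕ) (ω : Path N Eε Eζ Eη) :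
    0 ≤ cut M C φ ε (t + 1) ω :=
  le_min (mul_nonneg (retAt_nonneg M _ ω) (leftover_nonneg hε t ω)) (le_max_right _ _)

lemma leftover_le (hε : 0 ≤ ε) (t : ℕ) (ω : Path N Eε Eζ Eη) :
    leftover M C φ ε t ω ≤ (∏ i ∈ Finset.range t, retAt M (i + 1) ω) * ε := by
  induction t with
  | zero => simp [leftover]
  | succ t ih =>
    rw [Finset.prod_range_succ]
    have h1 : leftover M C φ ε (t + 1) ω ≤ retAt M (t + 1) ω * leftover M C φ ε t ω :=
      sub_le_self _ (cut_succ_nonneg hε t ω)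
    have h2 := mul_le_mul_of_nonneg_left ih (retAt_nonneg M (t + 1) ω)
    calc _ ≤ _ := h1
      _ ≤ _ := h2
      _ = _ := by ring

lemma cut_succ_le (hε : 0 ≤ ε) (t : ℕ) (ω : Path N Eε Eζ Eη) :
    cut M C φ ε (t + 1) ω ≤ (∏ i ∈ Finset.range (t + 1), retAt M (i + 1) ω) * ε := by
  rw [Finset.prod_range_succ]
  calc _ ≤ retAt M (t + 1) ω * leftover M C φ ε t ω := min_le_left _ _
    _ ≤ _ := mul_le_mul_of_nonneg_left (leftover_le hε t ω) (retAt_nonneg M (t + 1) ω)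
    _ = _ := by ring

/-- Identifies `leftover` as the shortfall of savings relative to the original plan. -/
lemma savings_borrowPlan (t : ℕ) (ω : Path N Eε Eζ Eη) :
    wealth M I a (borrowPlan M C φ ε) t ω - borrowPlan M C φ ε t ω =
      wealth M I a C t ω - C t ω - leftover M C φ ε t ω := by
  induction t with
  | zero => simp only [wealth, borrowPlan, cut, leftover]; ring
  | succ t ih =>
    rw [wealth, ih, wealth]
    simp only [borrowPlan, cut, leftover]
    ring

/-- A cut stops at the floor, and consumption already below the floor is left alone. -/
lemma min_le_borrowPlan (t : ℕ) (ω : Path N Eε Eζ Eη) :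
    min (C (t + 1) ω) (φ (t + 1) ω) ≤ borrowPlan M C φ ε (t + 1) ω := by
  have h : cut M C φ ε (t + 1) ω ≤ max (C (t + 1) ω - φ (t + 1) ω) 0 := min_le_right _ _
  rw [borrowPlan]
  rcases le_total (C (t + 1) ω) (φ (t + 1) ω) with h1 | h1
  · rw [max_eq_right (by linarith)] at h
    rw [min_eq_left h1]; linarith
  · rw [max_eq_left (by linarith)] at h
    rw [min_eq_right h1]; linarith

lemma measurable_leftover (hC : ∀ t, Measurable[info t] (C t)) (hφ : ∀ t, Measurable[info t] (φ t))
    (t : ℕ) : Measurable[info t] (leftover M C φ ε t) := by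
  induction t with
  | zero => exact measurable_const
  | succ t ih =>
    have hle := (info (N := N) (Eε := Eε) (Eζ := Eζ) (Eη := Eη)).mono (Nat.le_succ t)
    have h1 := (measurable_retAt (Eη := Eη) M (le_refl (t + 1))).mul (ih.mono hle le_rfl)
    exact h1.sub (h1.min (((hC (t + 1)).sub (hφ (t + 1))).max measurable_const))

lemma measurable_cut (hC : ∀ t, Measurable[info t] (C t)) (hφ : ∀ t, Measurable[info t] (φ t))
    (t : ℕ) : Measurable[info t] (cut M C φ ε t) := by
  cases t with
  | zero => exact measurable_const
  | succ t =>
    have hle := (info (N := N) (Eε := Eε) (Eζ := Eζ) (Eη := Eη)).mono (Nat.le_succ t)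
    have h1 := (measurable_retAt (Eη := Eη) M (le_refl (t + 1))).mul
      ((measurable_leftover (M := M) (ε := ε) hC hφ t).mono hle le_rfl)
    exact h1.min (((hC (t + 1)).sub (hφ (t + 1))).max measurable_const)

/-- Either the debt is fully repaid at the date in question and savings equal the original ones, or
the cut reaches the floor, so that consumption is at most `φ ≤ Y` and current income alone pays for
it. -/
lemma Feasible.borrowPlan (hC : Feasible M I a z C) (hφm : ∀ t, Measurable[info t] (φ t))
    (hφ0 : ∀ t ω, 0 ≤ φ t ω) (hφY : ∀ t ω, φ t ω ≤ incAt I t ω) (hε : 0 ≤ ε)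
    (h0 : ∀ᵐ ω ∂pathLaw M I z, ε ≤ a - C 0 ω) : Feasible M I a z (borrowPlan M C φ ε) where
  adapted t := (hC.adapted t).sub (measurable_cut hC.adapted hφm t)
  constraint := by
    filter_upwards [hC.constraint, h0] with ω hω h0 t
    have hs : ∀ t, 0 ≤ wealth M I a (IncomeFluctuation.borrowPlan M C φ ε) t ω -
        IncomeFluctuation.borrowPlan M C φ ε t ω := by
      intro t
      induction t with
      | zero =>
        simp only [wealth, IncomeFluctuation.borrowPlan, cut]
        linarith
      | succ t ih =>
        rcases le_total (retAt M (t + 1) ω * leftover M C φ ε t ω)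
          (max (C (t + 1) ω - φ (t + 1) ω) 0) with h | h
        · rw [savings_borrowPlan, leftover, min_eq_left h]
          have := (hω (t + 1)).2
          linarith
        · have hY := hφY (t + 1) ω
          have hm := mul_nonneg (retAt_nonneg M (t + 1) ω) ih
          have hb : IncomeFluctuation.borrowPlan M C φ ε (t + 1) ω ≤ φ (t + 1) ω := by
            simp only [IncomeFluctuation.borrowPlan, cut]
            rw [min_eq_right h]
            linarith [le_max_left (C (t + 1) ω - φ (t + 1) ω) 0]
          rw [wealth]
          linarith
    refine ⟨?_, sub_nonneg.1 (hs t)⟩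
    cases t with
    | zero =>
      have := (hω 0).1
      simp only [IncomeFluctuation.borrowPlan, cut]
      linarith
    | succ t => exact (le_min (hω (t + 1)).1 (hφ0 (t + 1) ω)).trans (min_le_borrowPlan t ω)

/-- The gain from consuming `ε` more at date `0` is at most the expected loss from the later
cuts. -/
lemma Solves.borrow_gain_le (hu : InadaUtility u) (hM : M.Impatient) (hI : I.Admissible u)
    (ha : 0 < a) (hS : Solves M I u a z C) {c₀ : ℝ} (h0 : ∀ᵐ ω ∂pathLaw M I z, C 0 ω = c₀)
    (hφm : ∀ t, Measurable[info t] (φ t)) (hφ0 : ∀ t ω, 0 ≤ φ t ω)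
    (hφpos : ∀ᵐ ω ∂pathLaw M I z, ∀ t, 0 < φ (t + 1) ω)
    (hφY : ∀ t ω, φ t ω ≤ incAt I t ω) (hε : 0 ≤ ε) (hεa : ε ≤ a - c₀) {g₀ : ℝ≥0∞}
    (hg : (u c₀).toENNReal + (-u (c₀ + ε)).toENNReal + g₀ ≤
      (u (c₀ + ε)).toENNReal + (-u c₀).toENNReal) :
    g₀ ≤ ∫⁻ ω, ∑' t, ENNReal.ofReal (cumDisc M (t + 1) ω) *
      (marginalExt u (borrowPlan M C φ ε (t + 1) ω) *
        ENNReal.ofReal (cut M C φ ε (t + 1) ω)) ∂pathLaw M I z := by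
  have hfe : Feasible M I a z (borrowPlan M C φ ε) := hS.feasible.borrowPlan hφm hφ0 hφY hε
    (h0.mono fun ω hω => by rw [hω]; exact hεa)
  have hgl := hS.lintegral_gain_le hu hM hI ha hfe
    (g := fun t _ => if t = 0 then g₀ else 0)
    (l := fun t ω => if t = 0 then 0 else ENNReal.ofReal (cumDisc M t ω) *
      (marginalExt u (borrowPlan M C φ ε t ω) * ENNReal.ofReal (cut M C φ ε t ω))) ?_
  · simp only [tsum_ite_eq, lintegral_const, measure_univ, mul_one] at hgl
    refine hgl.trans_eq (lintegral_congr fun ω => ?_)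
    rw [tsum_eq_zero_add' ENNReal.summable]
    simp
  · filter_upwards [h0, hφpos] with ω hω0 hω1 t
    match t with
    | 0 => simpa [posPart, negPart, borrowPlan, cut, hω0, cumDisc] using hg
    | t + 1 =>
      simp only [posPart, negPart, Nat.add_eq_zero_iff, one_ne_zero, and_false, if_false, add_zero]
      rw [← mul_add, ← mul_add, ← mul_add]
      refine mul_le_mul' le_rfl ?_
      have hmin := min_le_borrowPlan (M := M) (C := C) (φ := φ) (ε := ε) t ω
      -- Without a cut nothing changes. A positive cut requires `C > φ`, and consumption then stays
      -- at or above `φ > 0`, where the tangent estimate applies.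
      rcases (cut_succ_nonneg (M := M) (C := C) (φ := φ) hε t ω).eq_or_lt with h | h
      · have e : borrowPlan M C φ ε (t + 1) ω = C (t + 1) ω := by rw [borrowPlan, ← h, sub_zero]
        rw [e]
        exact le_self_add
      · have hgt : φ (t + 1) ω < C (t + 1) ω := by
          by_contra! hc
          have : cut M C φ ε (t + 1) ω ≤ max (C (t + 1) ω - φ (t + 1) ω) 0 := min_le_right _ _
          rw [max_eq_right (by linarith)] at this
          linarith
        rw [min_eq_right hgt.le] at hmin
        have := hu.loss_le (x := C (t + 1) ω) (y := borrowPlan M C φ ε (t + 1) ω)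
          ((hω1 t).trans_le hmin) (by rw [borrowPlan]; linarith)
        rwa [show C (t + 1) ω - borrowPlan M C φ ε (t + 1) ω = cut M C φ ε (t + 1) ω by
          rw [borrowPlan]; ring] at this

/-- A cut never exceeds the compounded debt `∏R · ε`, and it leaves consumption at or above `φ`. The
bound is linear in `ε`, so after division by `ε` it is an `ε`-free majorant. -/
lemma borrow_loss_le (hu : InadaUtility u) (hε : 0 ≤ ε) (t : ℕ) (ω : Path N Eε Eζ Eη) :
    ENNReal.ofReal (cumDisc M (t + 1) ω) * (marginalExt u (borrowPlan M C φ ε (t + 1) ω) *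
      ENNReal.ofReal (cut M C φ ε (t + 1) ω)) ≤
    ENNReal.ofReal (cumProd (fun z e f => M.β z e * M.R z f) (t + 1) ω) *
      marginalExt u (φ (t + 1) ω) * ENNReal.ofReal ε := by
  have e : cumProd (fun z e f => M.β z e * M.R z f) (t + 1) ω =
      cumDisc M (t + 1) ω * ∏ i ∈ Finset.range (t + 1), retAt M (i + 1) ω :=
    Finset.prod_mul_distrib
  have hp : 0 ≤ ∏ i ∈ Finset.range (t + 1), retAt M (i + 1) ω :=
    Finset.prod_nonneg fun i _ => retAt_nonneg M _ ω
  rw [e, ENNReal.ofReal_mul (cumDisc_nonneg M _ ω), mul_assoc, mul_assoc]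
  refine mul_le_mul' le_rfl ?_
  rcases (cut_succ_nonneg (M := M) (C := C) (φ := φ) hε t ω).eq_or_lt with h | h
  · simp [← h]
  · have hgt : φ (t + 1) ω < C (t + 1) ω := by
      by_contra! hc
      have : cut M C φ ε (t + 1) ω ≤ max (C (t + 1) ω - φ (t + 1) ω) 0 := min_le_right _ _
      rw [max_eq_right (by linarith)] at this
      linarith
    have hmin := min_le_borrowPlan (M := M) (C := C) (φ := φ) (ε := ε) t ω
    rw [min_eq_right hgt.le] at hmin
    calc _ ≤ marginalExt u (φ (t + 1) ω) *
          ENNReal.ofReal ((∏ i ∈ Finset.range (t + 1), retAt M (i + 1) ω) * ε) := by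
          gcongr
          · exact hu.antitone_marginalExt hmin
          · exact cut_succ_le hε t ω
      _ = _ := by rw [ENNReal.ofReal_mul hp]; ring

end Deviations

/-! ### Positivity of consumption and the Euler inequalities for the consumption function. -/

section Policy

variable {N : ℕ} {Eε Eζ Eη : Type*} [MeasurableSpace Eε] [MeasurableSpace Eζ] [MeasurableSpace Eη]
variable {M : Multiplicative N Eε Eζ} {I : Income N Eη}

variable {u : ℝ → EReal} {a : ℝ} {z : Fin N} {c : ℝ → Fin N → ℝ}

/-- Income truncated from above at `b`. -/
def incFloor (I : Income N Eη) (b : ℝ) (t : ℕ) (ω : Path N Eε Eζ Eη) : ℝ := min (incAt I t ω) b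

/-- Marginal utility is infinite at zero income, which integrability excludes almost surely. -/
lemma Income.Admissible.income_pos (hu : InadaUtility u) (hI : I.Admissible u) (z : Fin N) :
    ∀ᵐ e ∂I.μη, 0 < I.Y z e := by
  filter_upwards [ae_lt_top (measurable_marginalExt_income hu z) (hI.marginal_Y z).ne] with e he
  by_contra hc
  simp [marginalExt, hc] at he

lemma Income.Admissible.incAt_pos (hu : InadaUtility u) (hI : I.Admissible u)
    (M : Multiplicative N Eε Eζ) (z : Fin N) :
    ∀ᵐ ω ∂pathLaw M I z, ∀ t, 0 < incAt I (t + 1) ω :=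
  ae_forall_next M I (p := fun x => 0 < I.Y x.1 x.2.2.2)
    (measurableSet_lt measurable_const (measurable_shock_income I)) z
    (fun z' => ae_step_income M I z' (hI.income_pos hu))

lemma measurable_incFloor (b : ℝ) (t : ℕ) :
    Measurable[info t] (incFloor (Eε := Eε) (Eζ := Eζ) I b t) :=
  (measurable_incAt I le_rfl).min measurable_const

/-- The cumulative marginal loss of the cuts down to truncated income. -/
def floorLoss (M : Multiplicative N Eε Eζ) (I : Income N Eη) (u : ℝ → EReal) (b : ℝ)
    (ω : Path N Eε Eζ Eη) : ℝ≥0∞ :=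
  ∑' t, ENNReal.ofReal (cumProd (fun z e f => M.β z e * M.R z f) (t + 1) ω) *
    marginalExt u (incFloor I b (t + 1) ω)

lemma lintegral_floorLoss_lt_top (hu : InadaUtility u) (hM : M.Impatient) (hI : I.Admissible u)
    {b : ℝ} (hb : 0 < b) (z : Fin N) : ∫⁻ ω, floorLoss M I u b ω ∂pathLaw M I z < ⊤ := by
  have hkm : ∀ z, Measurable fun e => marginalExt u (min (I.Y z e) b) := fun z =>
    hu.measurable_marginalExt.comp ((I.Y_measurable z).min measurable_const)
  have hk : ∀ z, ∫⁻ e, marginalExt u (min (I.Y z e) b) ∂I.μη < ⊤ := by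
    intro z
    have hle : ∀ e, marginalExt u (min (I.Y z e) b) ≤ marginalExt u (I.Y z e) + marginalExt u b := by
      intro e
      rcases min_choice (I.Y z e) b with h | h <;> rw [h]
      · exact le_self_add
      · exact le_add_self
    refine (lintegral_mono hle).trans_lt ?_
    rw [lintegral_add_right _ measurable_const, lintegral_const, measure_univ, mul_one,
      marginalExt_of_pos hb]
    exact ENNReal.add_lt_top.2 ⟨hI.marginal_Y z, ENNReal.ofReal_lt_top⟩
  have := tsum_lintegral_cumProd_mul_lt_top M I (X := fun z e f => M.β z e * M.R z f)
    hM.integrable_βR (measurable_βR_prod M) M.βR_nonneg hM.specRad_βR hkm hk z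
  unfold floorLoss
  rw [lintegral_tsum]
  · exact this
  · intro t
    refine (Measurable.mul ?_ ?_).aemeasurable
    · exact ((measurable_cumProd (X := fun z e f => M.β z e * M.R z f) (measurable_βR_prod M)
        (t + 1)).mono (info_le _) le_rfl).ennreal_ofReal
    · exact hu.measurable_marginalExt.comp ((measurable_incFloor b (t + 1)).mono (info_le _) le_rfl)

lemma exists_floorLoss_bound (hu : InadaUtility u) (hM : M.Impatient) (hI : I.Admissible u)
    {b : ℝ} (hb : 0 < b) :
    ∃ K : ℝ, 0 ≤ K ∧ ∀ z, ∫⁻ ω, floorLoss M I u b ω ∂pathLaw M I z ≤ ENNReal.ofReal K := by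
  refine ⟨∑ z, (∫⁻ ω, floorLoss M I u b ω ∂pathLaw M I z).toReal,
    Finset.sum_nonneg fun _ _ => ENNReal.toReal_nonneg, fun z => ?_⟩
  rw [← ENNReal.ofReal_toReal (lintegral_floorLoss_lt_top hu hM hI hb z).ne]
  exact ENNReal.ofReal_le_ofReal (Finset.single_le_sum
    (f := fun z => (∫⁻ ω, floorLoss M I u b ω ∂pathLaw M I z).toReal)
    (fun _ _ => ENNReal.toReal_nonneg) (Finset.mem_univ z))

lemma Solves.borrow_gain_le_floorLoss (hu : InadaUtility u) (hM : M.Impatient)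
    (hI : I.Admissible u) (ha : 0 < a) {C : ℕ → Path N Eε Eζ Eη → ℝ} (hS : Solves M I u a z C)
    {c₀ : ℝ} (h0 : ∀ᵐ ω ∂pathLaw M I z, C 0 ω = c₀) {b : ℝ} (hb : 0 < b) {ε : ℝ} (hε : 0 ≤ ε)
    (hεa : ε ≤ a - c₀) {g₀ : ℝ≥0∞}
    (hg : (u c₀).toENNReal + (-u (c₀ + ε)).toENNReal + g₀ ≤
      (u (c₀ + ε)).toENNReal + (-u c₀).toENNReal) :
    g₀ ≤ (∫⁻ ω, floorLoss M I u b ω ∂pathLaw M I z) * ENNReal.ofReal ε := by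
  refine (hS.borrow_gain_le hu hM hI ha h0 (φ := incFloor I b) (measurable_incFloor b)
    (fun t ω => le_min (incAt_nonneg I t ω) hb.le) ?_ (fun t ω => min_le_left _ _) hε hεa hg).trans ?_
  · filter_upwards [hI.incAt_pos hu M z] with ω hω t
    exact lt_min (hω t) hb
  · rw [← lintegral_mul_const' _ _ ENNReal.ofReal_ne_top]
    refine lintegral_mono fun ω => ?_
    simp only [floorLoss]
    rw [← ENNReal.tsum_mul_right]
    exact ENNReal.tsum_le_tsum fun t => borrow_loss_le hu hε t ω

/-- A consumer who saves has marginal utility bounded by a constant; in particular consumption is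
positive. -/
lemma Solves.pos_and_marginal_le (hu : InadaUtility u) (hM : M.Impatient)
    (hI : I.Admissible u) (ha : 0 < a) {C : ℕ → Path N Eε Eζ Eη → ℝ} (hS : Solves M I u a z C)
    {c₀ : ℝ} (h0 : ∀ᵐ ω ∂pathLaw M I z, C 0 ω = c₀) (hc₀ : 0 ≤ c₀) {b : ℝ} (hb : 0 < b) {K : ℝ}
    (hK0 : 0 ≤ K) (hK : ∫⁻ ω, floorLoss M I u b ω ∂pathLaw M I z ≤ ENNReal.ofReal K) :
    0 < c₀ ∧ (c₀ < a → marginal u c₀ ≤ K) := by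
  have hpos : 0 < c₀ := by
    rcases hc₀.eq_or_lt with rfl | h
    · exfalso
      -- The factor `2` pays for the halved increment in `le_gain_half`.
      obtain ⟨d, hd, hdK⟩ := hu.exists_marginal_gt (2 * K)
      have hε : 0 < min d a := lt_min hd ha
      have hg := hu.le_gain_half (x := 0) (y := 0 + min d a) le_rfl (by simpa using hε)
      have h := (hS.borrow_gain_le_floorLoss hu hM hI ha h0 hb hε.le
        (by simp) hg).trans (mul_le_mul' hK le_rfl)
      rw [zero_add, sub_zero, marginalExt_of_pos hε, ← ENNReal.ofReal_mul
        (hu.marginal_pos _ hε).le, ← ENNReal.ofReal_mul hK0,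
        ENNReal.ofReal_le_ofReal_iff (mul_nonneg hK0 hε.le)] at h
      have h2 := hu.marginal_anti hε (min_le_left d a)
      nlinarith
    · exact h
  refine ⟨hpos, fun hlt => ?_⟩
  have key : ∀ ε, 0 < ε → ε ≤ a - c₀ → marginal u (c₀ + ε) ≤ K := by
    intro ε hε hεa
    have hg := hu.le_gain (x := c₀) (y := c₀ + ε) hpos (by linarith)
    have h := (hS.borrow_gain_le_floorLoss hu hM hI ha h0 hb hε.le hεa hg).trans
      (mul_le_mul' hK le_rfl)
    have hp : 0 < c₀ + ε := by linarith
    rw [add_sub_cancel_left, marginalExt_of_pos hp, ← ENNReal.ofReal_mul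
      (hu.marginal_pos _ hp).le, ← ENNReal.ofReal_mul hK0,
      ENNReal.ofReal_le_ofReal_iff (mul_nonneg hK0 hε.le)] at h
    exact le_of_mul_le_mul_right h hε
  have hcont : ContinuousAt (marginal u) c₀ :=
    hu.continuousOn_marginal.continuousAt (Ioi_mem_nhds hpos)
  have htend : Tendsto (fun ε => marginal u (c₀ + ε)) (𝓝[>] 0) (𝓝 (marginal u c₀)) := by
    refine hcont.tendsto.comp ?_
    have : Tendsto (fun ε : ℝ => c₀ + ε) (𝓝 0) (𝓝 (c₀ + 0)) :=
      (continuous_const.add continuous_id).tendsto 0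
    rw [add_zero] at this
    exact this.mono_left nhdsWithin_le_nhds
  refine le_of_tendsto htend ?_
  filter_upwards [Ioc_mem_nhdsGT (show (0 : ℝ) < a - c₀ by linarith)] with ε hε
  exact key ε hε.1 hε.2

lemma policyPlan_zero_ae : ∀ᵐ ω ∂pathLaw M I z, policyPlan M I c a 0 ω = c a z := by
  filter_upwards [state_zero_ae M I z] with ω hω
  simp [policyPlan, policyWealth, hω]

lemma policyPlan_one_ae : ∀ᵐ ω ∂pathLaw M I z, policyPlan M I c a 1 ω =
    c (retAt M 1 ω * (a - c a z) + incAt I 1 ω) (state 1 ω) := by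
  filter_upwards [state_zero_ae M I z] with ω hω
  simp [policyPlan, policyWealth, hω]

lemma IsConsumptionFunction.bounds (hc : IsConsumptionFunction M I u c) (ha : 0 < a)
    (z : Fin N) : 0 ≤ c a z ∧ c a z ≤ a := by
  obtain ⟨ω, h1, h2⟩ := ((hc a ha z).feasible.constraint.and
    (policyPlan_zero_ae (M := M) (I := I) (a := a) (z := z) (c := c))).exists
  have := h1 0
  rwa [h2] at this

/-- There is a constant bounding the marginal utility of consumption whenever savings are
positive. -/
lemma IsConsumptionFunction.exists_marginal_bound (hc : IsConsumptionFunction M I u c)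
    (hu : InadaUtility u) (hM : M.Impatient) (hI : I.Admissible u) :
    ∃ K : ℝ, 0 ≤ K ∧ ∀ a, 0 < a → ∀ z, 0 < c a z ∧ (c a z < a → marginal u (c a z) ≤ K) := by
  obtain ⟨K, hK0, hK⟩ := exists_floorLoss_bound hu hM hI one_pos
  exact ⟨K, hK0, fun a ha z => (hc a ha z).pos_and_marginal_le hu hM hI ha policyPlan_zero_ae
    (hc.bounds ha z).1 one_pos hK0 (hK z)⟩

lemma IsConsumptionFunction.pos (hc : IsConsumptionFunction M I u c)
    (hu : InadaUtility u) (hM : M.Impatient) (hI : I.Admissible u) (ha : 0 < a) (z : Fin N) :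
    0 < c a z := by
  obtain ⟨K, -, h⟩ := hc.exists_marginal_bound hu hM hI
  exact (h a ha z).1

/-- Wealth at date `1` under the policy `c` from `(a, z)`. -/
def nextWealth (M : Multiplicative N Eε Eζ) (I : Income N Eη) (c : ℝ → Fin N → ℝ) (a : ℝ)
    (z : Fin N) (x : Shock N Eε Eζ Eη) : ℝ :=
  M.R x.1 x.2.2.1 * (a - c a z) + I.Y x.1 x.2.2.2

lemma IsConsumptionFunction.nextWealth_pos_ae (hc : IsConsumptionFunction M I u c)
    (hu : InadaUtility u) (hI : I.Admissible u) (ha : 0 < a) (z : Fin N) :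
    ∀ᵐ ω ∂pathLaw M I z, 0 < nextWealth M I c a z (ω 1) := by
  filter_upwards [hI.incAt_pos hu M z] with ω hω
  exact add_pos_of_nonneg_of_pos
    (mul_nonneg (M.R_nonneg _ _) (sub_nonneg.2 (hc.bounds ha z).2)) (hω 0)

lemma IsConsumptionFunction.euler_ge (hc : IsConsumptionFunction M I u c)
    (hu : InadaUtility u) (hM : M.Impatient) (hI : I.Admissible u) (ha : 0 < a) (z : Fin N) :
    ∫⁻ ω, ENNReal.ofReal (discAt M 1 ω * retAt M 1 ω) *
      marginalExt u (c (nextWealth M I c a z (ω 1)) (state 1 ω)) ∂pathLaw M I z ≤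
      ENNReal.ofReal (marginal u (c a z)) := by
  have hpos := hc.pos hu hM hI ha z
  rw [← marginalExt_of_pos hpos]
  have h1 : ∀ᵐ ω ∂pathLaw M I z, 0 < policyPlan M I c a 1 ω := by
    filter_upwards [policyPlan_one_ae (M := M) (I := I) (a := a) (z := z) (c := c),
      hc.nextWealth_pos_ae hu hI ha z] with ω h1 h2
    rw [h1]
    exact hc.pos hu hM hI h2 _
  refine le_of_eq_of_le (lintegral_congr_ae ?_) ((hc a ha z).euler_ge hu hM hI ha hpos
    policyPlan_zero_ae h1)
  filter_upwards [policyPlan_one_ae (M := M) (I := I) (a := a) (z := z) (c := c)] with ω h1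
  rw [h1]
  rfl

lemma leftover_succ_eq_zero {C φ : ℕ → Path N Eε Eζ Eη → ℝ} {ε : ℝ} {ω : Path N Eε Eζ Eη}
    (h : retAt M 1 ω * ε ≤ max (C 1 ω - φ 1 ω) 0) (t : ℕ) :
    leftover M C φ ε (t + 1) ω = 0 := by
  induction t with
  | zero => simp [leftover, min_eq_left h]
  | succ t ih => simp [leftover.eq_2 (t := t + 1), ih]

/-- Euler inequality: for an unconstrained consumer the marginal utility of consumption does not
exceed the marginal value of saving. -/
lemma IsConsumptionFunction.euler_le (hc : IsConsumptionFunction M I u c)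
    (hu : InadaUtility u) (hM : M.Impatient) (hI : I.Admissible u) (ha : 0 < a) (z : Fin N)
    (hca : c a z < a) :
    ENNReal.ofReal (marginal u (c a z)) ≤
    ∫⁻ ω, ENNReal.ofReal (discAt M 1 ω * retAt M 1 ω) *
      marginalExt u (c (nextWealth M I c a z (ω 1)) (state 1 ω)) ∂pathLaw M I z := by
  obtain ⟨K, hK0, hK⟩ := hc.exists_marginal_bound hu hM hI
  -- With `u'(b) > K`, a consumer who saves at date `1` consumes more than `b`; one who does not
  -- save consumes all wealth, which exceeds income if `R > 0`. Both stay strictly above the floor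
  -- `min(Y, b)`.
  obtain ⟨b, hb, hbK⟩ := hu.exists_marginal_gt K
  have hpos := (hK a ha z).1
  have hS := hc a ha z
  set C := policyPlan M I c a with hCdef
  set s := a - c a z with hs
  have hs0 : 0 < s := sub_pos.2 hca
  -- consumption at date `1` exceeds the floor whenever the return is positive
  have hfloor : ∀ᵐ ω ∂pathLaw M I z, 0 < C 1 ω ∧
      (retAt M 1 ω = 0 ∨ incFloor I b 1 ω < C 1 ω) := by
    filter_upwards [policyPlan_one_ae (M := M) (I := I) (a := a) (z := z) (c := c),
      hc.nextWealth_pos_ae hu hI ha z] with ω h1 h2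
    rw [hCdef, h1]
    change 0 < c (nextWealth M I c a z (ω 1)) (state 1 ω) ∧ (_ ∨ _ <
      c (nextWealth M I c a z (ω 1)) (state 1 ω))
    have h3 := hK _ h2 (state 1 ω)
    refine ⟨h3.1, ?_⟩
    rcases (retAt_nonneg M 1 ω).eq_or_lt with hR | hR
    · exact Or.inl hR.symm
    · right
      rcases (hc.bounds h2 (state 1 ω)).2.eq_or_lt with h4 | h4
      · rw [h4]
        refine (min_le_left _ _).trans_lt ?_
        exact lt_add_of_pos_left _ (mul_pos hR hs0)
      · refine (min_le_right _ _).trans_lt ?_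
        by_contra! h5
        have := hu.marginal_anti h3.1 h5
        linarith [h3.2 h4]
  set e : ℕ → ℝ := fun n => s / (n + 1) with he
  have hepos : ∀ n, 0 < e n := fun n => by positivity
  have hele : ∀ n, e n ≤ s := fun n =>
    div_le_self hs0.le (by have : (0 : ℝ) ≤ n := n.cast_nonneg; linarith)
  have helim : Tendsto e atTop (𝓝 0) := by
    have : Tendsto (fun n : ℕ => ((n : ℝ) + 1)) atTop atTop :=
      tendsto_atTop_add_const_right _ _ tendsto_natCast_atTop_atTop
    exact this.const_div_atTop _
  set F : ℕ → Path N Eε Eζ Eη → ℝ≥0∞ := fun n ω => ∑' t, ENNReal.ofReal (cumDisc M (t + 1) ω) *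
    (marginalExt u (borrowPlan M C (incFloor I b) (e n) (t + 1) ω) *
      ENNReal.ofReal (cut M C (incFloor I b) (e n) (t + 1) ω)) * (ENNReal.ofReal (e n))⁻¹ with hF
  have hinv : ∀ n, ENNReal.ofReal (e n) * (ENNReal.ofReal (e n))⁻¹ = 1 := fun n =>
    ENNReal.mul_inv_cancel (by simpa using hepos n) ENNReal.ofReal_ne_top
  have hstep : ∀ n, marginalExt u (c a z + e n) ≤ ∫⁻ ω, F n ω ∂pathLaw M I z := by
    intro n
    have hg := hu.le_gain (x := c a z) (y := c a z + e n) hpos (by linarith [hepos n])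
    rw [add_sub_cancel_left] at hg
    have h := hS.borrow_gain_le hu hM hI ha policyPlan_zero_ae (φ := incFloor I b)
      (measurable_incFloor b) (fun t ω => le_min (incAt_nonneg I t ω) hb.le)
      (by filter_upwards [hI.incAt_pos hu M z] with ω hω t
          exact lt_min (hω t) hb) (fun t ω => min_le_left _ _) (hepos n).le (hele n) hg
    calc marginalExt u (c a z + e n) = marginalExt u (c a z + e n) * ENNReal.ofReal (e n) *
          (ENNReal.ofReal (e n))⁻¹ := by rw [mul_assoc, hinv, mul_one]
      _ ≤ _ := mul_le_mul' h le_rfl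
      _ = _ := by
        rw [← lintegral_mul_const' _ _ (ENNReal.inv_ne_top.2 (by simpa using hepos n))]
        refine lintegral_congr fun ω => ?_
        exact ENNReal.tsum_mul_right.symm
  have hFm : ∀ n, Measurable (F n) := by
    intro n
    refine Measurable.tsum fun t => Measurable.mul_const ?_ _
    refine (measurable_ofReal_cumDisc M (t + 1)).mul (Measurable.mul ?_ ?_)
    · exact hu.measurable_marginalExt.comp (((hS.feasible.adapted (t + 1)).sub
        (measurable_cut hS.feasible.adapted (measurable_incFloor b) (t + 1))).mono
        (info_le _) le_rfl)
    · exact ((measurable_cut hS.feasible.adapted (measurable_incFloor b) (t + 1)).mono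
        (info_le _) le_rfl).ennreal_ofReal
  have hdom : ∀ n ω, F n ω ≤ floorLoss M I u b ω := by
    intro n ω
    refine ENNReal.tsum_le_tsum fun t => ?_
    calc _ ≤ ENNReal.ofReal (cumProd (fun z e f => M.β z e * M.R z f) (t + 1) ω) *
          marginalExt u (incFloor I b (t + 1) ω) * ENNReal.ofReal (e n) *
          (ENNReal.ofReal (e n))⁻¹ := mul_le_mul' (borrow_loss_le hu (hepos n).le t ω) le_rfl
      _ = _ := by rw [mul_assoc, hinv, mul_one]
  have hlim : ∀ᵐ ω ∂pathLaw M I z, Tendsto (fun n => F n ω) atTop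
      (𝓝 (ENNReal.ofReal (discAt M 1 ω * retAt M 1 ω) * marginalExt u (C 1 ω))) := by
    filter_upwards [hfloor] with ω hω
    have hR0 := retAt_nonneg M 1 ω
    have hRe : Tendsto (fun n => retAt M 1 ω * e n) atTop (𝓝 0) := by
      simpa using helim.const_mul (retAt M 1 ω)
    -- Along a fixed path a small debt is entirely repaid at date `1`, so that only the first term
    -- of `F n` survives.
    have hev : ∀ᶠ n in atTop, retAt M 1 ω * e n ≤ max (C 1 ω - incFloor I b 1 ω) 0 := by
      rcases hω.2 with h | h
      · exact Eventually.of_forall fun n => by rw [h, zero_mul]; exact le_max_right _ _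
      · filter_upwards [hRe.eventually_le_const (sub_pos.2 h)] with n hn
        exact hn.trans (le_max_left _ _)
    have hval : ∀ᶠ n in atTop, F n ω = ENNReal.ofReal (discAt M 1 ω * retAt M 1 ω) *
        marginalExt u (C 1 ω - retAt M 1 ω * e n) := by
      filter_upwards [hev] with n hn
      have hc1 : cut M C (incFloor I b) (e n) 1 ω = retAt M 1 ω * e n := min_eq_left hn
      rw [hF]
      simp only
      rw [tsum_eq_zero_add' ENNReal.summable]
      have hz : ∀ t, cut M C (incFloor I b) (e n) (t + 1 + 1) ω = 0 := by
        intro t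
        rw [cut, leftover_succ_eq_zero hn, mul_zero]
        exact min_eq_left (le_max_right _ _)
      simp only [hz, ENNReal.ofReal_zero, mul_zero, zero_mul, tsum_zero, add_zero, zero_add]
      rw [borrowPlan, hc1, cumDisc_one, ENNReal.ofReal_mul hR0,
        ENNReal.ofReal_mul (discAt_nonneg M 1 ω)]
      calc _ = ENNReal.ofReal (discAt M 1 ω) * ENNReal.ofReal (retAt M 1 ω) *
            marginalExt u (C 1 ω - retAt M 1 ω * e n) *
            (ENNReal.ofReal (e n) * (ENNReal.ofReal (e n))⁻¹) := by ring
        _ = _ := by rw [hinv, mul_one]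
    refine Tendsto.congr' (hval.mono fun n hn => hn.symm) ?_
    refine ENNReal.Tendsto.const_mul ?_ (Or.inr ENNReal.ofReal_ne_top)
    refine (hu.continuousAt_marginalExt hω.1).tendsto.comp ?_
    simpa using hRe.const_sub (C 1 ω)
  have hint := tendsto_lintegral_of_dominated_convergence (μ := pathLaw M I z) (F := F)
    (floorLoss M I u b) hFm (fun n => ae_of_all _ (hdom n))
    (lintegral_floorLoss_lt_top hu hM hI hb z).ne hlim
  have hlhs : Tendsto (fun n => marginalExt u (c a z + e n)) atTop
      (𝓝 (marginalExt u (c a z))) := by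
    refine (hu.continuousAt_marginalExt hpos).tendsto.comp ?_
    simpa using helim.const_add (c a z)
  rw [← marginalExt_of_pos hpos]
  refine (le_of_tendsto_of_tendsto' hlhs hint hstep).trans_eq (lintegral_congr_ae ?_)
  filter_upwards [policyPlan_one_ae (M := M) (I := I) (a := a) (z := z) (c := c)] with ω h1
  rw [hCdef, h1]
  rfl

end Policy

/-! ### Regular variation in the Euler inequality and the upper bound. -/

section Asymptotics

variable {N : ℕ} {Eε Eζ Eη : Type*} [MeasurableSpace Eε] [MeasurableSpace Eζ] [MeasurableSpace Eη]
variable {M : Multiplicative N Eε Eζ} {I : Income N Eη}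

variable {u : ℝ → EReal} {γ : ℝ}

lemma PD_integrand_nonneg (M : Multiplicative N Eε Eζ) (γ : ℝ) (z : Fin N) (e : Eε) (f : Eζ) :
    0 ≤ M.β z e * M.R z f * M.R z f ^ (-γ) :=
  mul_nonneg (M.βR_nonneg z e f) (Real.rpow_nonneg (M.R_nonneg z f) _)

lemma PD_nonneg (M : Multiplicative N Eε Eζ) (γ : ℝ) (i j : Fin N) : 0 ≤ M.PD γ i j :=
  diagMean_mul_nonneg M (PD_integrand_nonneg M γ) i j

lemma measurable_PD_integrand (M : Multiplicative N Eε Eζ) (γ : ℝ) (z : Fin N) :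
    Measurable fun p : Eε × Eζ => M.β z p.1 * M.R z p.2 * M.R z p.2 ^ (-γ) :=
  (measurable_βR_prod M z).mul (((M.R_measurable z).comp measurable_snd).pow_const _)

/-- By the return gap, `R^{-γ} ≤ δ^{-γ}` wherever `R ≠ 0`, and elsewhere `βR` vanishes. -/
lemma integrable_PD_integrand (hM : M.Impatient) (hR : M.ReturnGap) (hγ : 0 < γ) (z : Fin N) :
    Integrable (fun p : Eε × Eζ => M.β z p.1 * M.R z p.2 * M.R z p.2 ^ (-γ))
      (M.με.prod M.μζ) := by
  obtain ⟨δ, hδ, hgap⟩ := hR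
  refine ((hM.integrable_βR z).mul_const (δ ^ (-γ))).mono'
    (measurable_PD_integrand M γ z).aestronglyMeasurable ?_
  filter_upwards [(Measure.quasiMeasurePreserving_snd (μ := M.με) (ν := M.μζ)).ae (hgap z)] with p hp
  rw [Real.norm_of_nonneg (PD_integrand_nonneg M γ z p.1 p.2)]
  rcases hp with hp | hp
  · simp [hp]
  · exact mul_le_mul_of_nonneg_left (Real.rpow_le_rpow_of_nonpos hδ hp (by linarith))
      (M.βR_nonneg z _ _)

lemma measurable_shock_βR (M : Multiplicative N Eε Eζ) :
    Measurable fun x : Shock N Eε Eζ Eη => ENNReal.ofReal (M.β x.1 x.2.1 * M.R x.1 x.2.2.1) :=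
  (measurable_shock_mult (X := fun z e f => M.β z e * M.R z f) (measurable_βR_prod M)).ennreal_ofReal

/-- The weighted marginal value `E_z β R g(Z') u'(v(Z') R a + q)`. -/
def eulerIntegral (M : Multiplicative N Eε Eζ) (I : Income N Eη) (u : ℝ → EReal) (g v : Fin N → ℝ)
    (q : Shock N Eε Eζ Eη → ℝ) (z : Fin N) (a : ℝ) : ℝ≥0∞ :=
  ∫⁻ x, ENNReal.ofReal (M.β x.1 x.2.1 * M.R x.1 x.2.2.1) * (ENNReal.ofReal (g x.1) *
    marginalExt u (v x.1 * M.R x.1 x.2.2.1 * a + q x)) ∂step M I z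

lemma measurable_eulerIntegrand (hu : InadaUtility u) (g v : Fin N → ℝ)
    {q : Shock N Eε Eζ Eη → ℝ} (hq : Measurable q) (a : ℝ) :
    Measurable fun x : Shock N Eε Eζ Eη => ENNReal.ofReal (M.β x.1 x.2.1 * M.R x.1 x.2.2.1) *
      (ENNReal.ofReal (g x.1) * marginalExt u (v x.1 * M.R x.1 x.2.2.1 * a + q x)) := by
  refine (measurable_shock_βR M).mul (Measurable.mul ?_ (hu.measurable_marginalExt.comp ?_))
  · exact ((measurable_of_finite g).comp measurable_fst).ennreal_ofReal
  · exact ((((measurable_of_finite v).comp measurable_fst).mul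
      (measurable_shock_ret M)).mul_const a).add hq

/-- The additive term `q` disappears here. Pointwise, regular variation gives the limit `(vR)^{-γ}`.
For domination, `R = 0` contributes nothing, and `R ≥ δ` keeps the argument above a fixed multiple
of `a`. -/
lemma tendsto_eulerIntegral (hu : InadaUtility u) (hrv : RegularlyVarying (marginal u) (-γ))
    (hM : M.Impatient) (hR : M.ReturnGap) (hγ : 0 < γ) {g v : Fin N → ℝ} (hg : ∀ z, 0 ≤ g z)
    (hv : ∀ z, 0 < v z) {q : Shock N Eε Eζ Eη → ℝ} (hqm : Measurable q) (hq : ∀ x, 0 ≤ q x)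
    (z : Fin N) :
    Tendsto (fun a => eulerIntegral M I u g v q z a * (ENNReal.ofReal (marginal u a))⁻¹) atTop
      (𝓝 (ENNReal.ofReal (∑ j, M.PD γ z j * (g j * v j ^ (-γ))))) := by
  have hgap := hR
  obtain ⟨δ, hδ, hgap⟩ := hgap
  have hR0 : ∀ᵐ x ∂step M I z, M.R x.1 x.2.2.1 = 0 ∨ δ ≤ M.R x.1 x.2.2.1 :=
    ae_step_ret M I (p := fun z e => M.R z e = 0 ∨ δ ≤ M.R z e) z hgap
  obtain ⟨m, hm0, hm⟩ : ∃ m > 0, ∀ j, m ≤ v j := by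
    obtain ⟨j, -, hj⟩ := Finset.exists_min_image Finset.univ v ⟨z, Finset.mem_univ z⟩
    exact ⟨v j, hv j, fun i => hj i (Finset.mem_univ i)⟩
  obtain ⟨G, hG⟩ : ∃ G, ∀ j, g j ≤ G := by
    obtain ⟨j, -, hj⟩ := Finset.exists_max_image Finset.univ g ⟨z, Finset.mem_univ z⟩
    exact ⟨g j, fun i => hj i (Finset.mem_univ i)⟩
  have hlimval : ∫⁻ x, ENNReal.ofReal (M.β x.1 x.2.1 * M.R x.1 x.2.2.1) *
      (ENNReal.ofReal (g x.1) * ENNReal.ofReal ((v x.1 * M.R x.1 x.2.2.1) ^ (-γ))) ∂step M I z =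
      ENNReal.ofReal (∑ j, M.PD γ z j * (g j * v j ^ (-γ))) := by
    rw [Multiplicative.PD, ← lintegral_step_diagMean_vec M I
      (X := fun z e f => M.β z e * M.R z f * M.R z f ^ (-γ)) (integrable_PD_integrand hM hR hγ)
      (measurable_PD_integrand M γ) (PD_integrand_nonneg M γ)
      (fun j => mul_nonneg (hg j) (Real.rpow_nonneg (hv j).le _)) z]
    refine lintegral_congr fun x => ?_
    rw [← ENNReal.ofReal_mul (hg _), ← ENNReal.ofReal_mul (M.βR_nonneg _ _ _),
      ← ENNReal.ofReal_mul (PD_integrand_nonneg M γ _ _ _),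
      Real.mul_rpow (hv _).le (M.R_nonneg _ _)]
    congr 1
    ring
  rw [← hlimval]
  have heq : ∀ᶠ a : ℝ in atTop, ∫⁻ x, ENNReal.ofReal (M.β x.1 x.2.1 * M.R x.1 x.2.2.1) *
      (ENNReal.ofReal (g x.1) * marginalExt u (v x.1 * M.R x.1 x.2.2.1 * a + q x)) *
        (ENNReal.ofReal (marginal u a))⁻¹ ∂step M I z =
      eulerIntegral M I u g v q z a * (ENNReal.ofReal (marginal u a))⁻¹ := by
    filter_upwards [eventually_gt_atTop 0] with a ha
    rw [lintegral_mul_const' _ _ (ENNReal.inv_ne_top.2 (by simpa using hu.marginal_pos a ha))]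
    rfl
  refine Tendsto.congr' heq ?_
  set B : ℝ := (m * δ) ^ (-γ) + 1 with hB
  have hB0 : 0 ≤ B := add_nonneg (Real.rpow_nonneg (by positivity) _) zero_le_one
  refine tendsto_lintegral_filter_of_dominated_convergence
    (fun x => ENNReal.ofReal (M.β x.1 x.2.1 * M.R x.1 x.2.2.1) *
      (ENNReal.ofReal G * ENNReal.ofReal B)) ?_ ?_ ?_ ?_
  · exact Eventually.of_forall fun a => (measurable_eulerIntegrand hu g v hqm a).mul_const _
  · have hev : ∀ᶠ a in atTop, marginal u (m * δ * a) / marginal u a < B :=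
      (hrv (m * δ) (by positivity)).eventually_lt_const (by rw [hB]; linarith)
    filter_upwards [hev, eventually_gt_atTop 0] with a ha ha0
    filter_upwards [hR0] with x hx
    rcases hx with hx | hx
    · simp [hx]
    · rw [mul_assoc, mul_assoc]
      refine mul_le_mul' le_rfl (mul_le_mul' (ENNReal.ofReal_le_ofReal (hG _)) ?_)
      have harg : m * δ * a ≤ v x.1 * M.R x.1 x.2.2.1 * a + q x := by
        have : m * δ ≤ v x.1 * M.R x.1 x.2.2.1 := mul_le_mul (hm _) hx hδ.le (hv _).le
        have := mul_le_mul_of_nonneg_right this ha0.le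
        linarith [hq x]
      calc _ ≤ marginalExt u (m * δ * a) * (ENNReal.ofReal (marginal u a))⁻¹ :=
            mul_le_mul' (hu.antitone_marginalExt harg) le_rfl
        _ = ENNReal.ofReal (marginal u (m * δ * a) / marginal u a) := by
            rw [marginalExt_of_pos (by positivity), ENNReal.ofReal_div_of_pos
              (hu.marginal_pos a ha0), div_eq_mul_inv]
        _ ≤ _ := ENNReal.ofReal_le_ofReal ha.le
  · rw [lintegral_mul_const' _ _ (ENNReal.mul_ne_top ENNReal.ofReal_ne_top ENNReal.ofReal_ne_top)]
    refine ENNReal.mul_ne_top ?_ (ENNReal.mul_ne_top ENNReal.ofReal_ne_top ENNReal.ofReal_ne_top)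
    have := lintegral_step_diagMean_vec M I (X := fun z e f => M.β z e * M.R z f)
      hM.integrable_βR (measurable_βR_prod M) M.βR_nonneg (w := fun _ => 1)
      (fun _ => zero_le_one) z
    simp only [ENNReal.ofReal_one, mul_one] at this
    rw [this]
    exact ENNReal.ofReal_ne_top
  · filter_upwards [hR0] with x hx
    rcases hx with hx | hx
    · simp [hx]
    · simp_rw [mul_assoc]
      refine ENNReal.Tendsto.const_mul ?_ (Or.inr ENNReal.ofReal_ne_top)
      refine ENNReal.Tendsto.const_mul ?_ (Or.inr ENNReal.ofReal_ne_top)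
      have hl : 0 < v x.1 * M.R x.1 x.2.2.1 := mul_pos (hv _) (hδ.trans_le hx)
      have ht := ENNReal.tendsto_ofReal (hu.tendsto_ratio hrv hl (hq x))
      refine Tendsto.congr' ?_ ht
      filter_upwards [eventually_gt_atTop 0] with a ha
      rw [ENNReal.ofReal_div_of_pos (hu.marginal_pos a ha), div_eq_mul_inv, ← mul_assoc,
        marginalExt_of_pos (by linarith [mul_pos hl ha, hq x])]

lemma eventually_eulerIntegral_le (hu : InadaUtility u) (hrv : RegularlyVarying (marginal u) (-γ))
    (hM : M.Impatient) (hR : M.ReturnGap) (hγ : 0 < γ) {g v : Fin N → ℝ} (hg : ∀ z, 0 ≤ g z)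
    (hv : ∀ z, 0 < v z) {q : Shock N Eε Eζ Eη → ℝ} (hqm : Measurable q) (hq : ∀ x, 0 ≤ q x)
    {z : Fin N} {L : ℝ} (hL : ∑ j, M.PD γ z j * (g j * v j ^ (-γ)) < L) :
    ∀ᶠ a in atTop, eulerIntegral M I u g v q z a ≤ ENNReal.ofReal (L * marginal u a) := by
  have h0 : 0 ≤ ∑ j, M.PD γ z j * (g j * v j ^ (-γ)) := Finset.sum_nonneg fun j _ =>
    mul_nonneg (PD_nonneg M γ z j) (mul_nonneg (hg j) (Real.rpow_nonneg (hv j).le _))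
  filter_upwards [(tendsto_eulerIntegral (I := I) hu hrv hM hR hγ hg hv hqm hq z).eventually_lt_const
    ((ENNReal.ofReal_lt_ofReal_iff (h0.trans_lt hL)).2 hL), eventually_gt_atTop 0] with a h ha
  have hne : ENNReal.ofReal (marginal u a) ≠ 0 := by simpa using hu.marginal_pos a ha
  rw [ENNReal.ofReal_mul (h0.trans hL.le)]
  rw [← div_eq_mul_inv] at h
  exact (ENNReal.div_le_iff hne ENNReal.ofReal_ne_top).1 h.le

lemma eventually_lt_eulerIntegral (hu : InadaUtility u) (hrv : RegularlyVarying (marginal u) (-γ))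
    (hM : M.Impatient) (hR : M.ReturnGap) (hγ : 0 < γ) {g v : Fin N → ℝ} (hg : ∀ z, 0 ≤ g z)
    (hv : ∀ z, 0 < v z) {q : Shock N Eε Eζ Eη → ℝ} (hqm : Measurable q) (hq : ∀ x, 0 ≤ q x)
    {z : Fin N} {L : ℝ} (hL0 : 0 ≤ L) (hL : L < ∑ j, M.PD γ z j * (g j * v j ^ (-γ))) :
    ∀ᶠ a in atTop, ENNReal.ofReal (L * marginal u a) < eulerIntegral M I u g v q z a := by
  filter_upwards [(tendsto_eulerIntegral (I := I) hu hrv hM hR hγ hg hv hqm hq z).eventually_const_lt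
    ((ENNReal.ofReal_lt_ofReal_iff (hL0.trans_lt hL)).2 hL), eventually_gt_atTop 0] with a h ha
  have hne : ENNReal.ofReal (marginal u a) ≠ 0 := by simpa using hu.marginal_pos a ha
  rw [ENNReal.ofReal_mul hL0]
  rw [← div_eq_mul_inv] at h
  exact (ENNReal.lt_div_iff_mul_lt (Or.inl hne) (Or.inl ENNReal.ofReal_ne_top)).1 h

lemma lintegral_path_eulerIntegrand (hu : InadaUtility u) (g v : Fin N → ℝ)
    {q : Shock N Eε Eζ Eη → ℝ} (hq : Measurable q) (z : Fin N) (a : ℝ) :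
    ∫⁻ ω, ENNReal.ofReal (discAt M 1 ω * retAt M 1 ω) * (ENNReal.ofReal (g (state 1 ω)) *
      marginalExt u (v (state 1 ω) * retAt M 1 ω * a + q (ω 1))) ∂pathLaw M I z =
      eulerIntegral M I u g v q z a :=
  lintegral_next_zero M I z (measurable_eulerIntegrand (M := M) hu g v hq a)

/-- If the average propensity to consume is asymptotically at most `1 / s`, then it is
asymptotically at most `1 / (1 + (P D s^γ)^{1/γ})`. -/
lemma IsConsumptionFunction.upper_step {c : ℝ → Fin N → ℝ} (hc : IsConsumptionFunction M I u c)
    (hu : InadaUtility u) (hrv : RegularlyVarying (marginal u) (-γ)) (hI : I.Admissible u)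
    (hM : M.Impatient) (hR : M.ReturnGap) (hγ : 0 < γ) {s : Fin N → ℝ} (hs : ∀ z, 0 < s z)
    (hup : ∀ z, ∀ θ, (s z)⁻¹ < θ → ∀ᶠ a in atTop, c a z ≤ θ * a) (z : Fin N) {θ : ℝ}
    (hθ : (1 + (∑ j, M.PD γ z j * s j ^ γ) ^ γ⁻¹)⁻¹ < θ) : ∀ᶠ a in atTop, c a z ≤ θ * a := by
  rcases le_or_gt 1 θ with h1 | h1
  · filter_upwards [eventually_gt_atTop 0] with a ha
    have := (hc.bounds ha z).2
    nlinarith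
  set H := ∑ j, M.PD γ z j * s j ^ γ with hH
  have hH0 : 0 ≤ H := Finset.sum_nonneg fun j _ =>
    mul_nonneg (PD_nonneg M γ z j) (Real.rpow_nonneg (hs j).le _)
  have hHr : 0 ≤ H ^ γ⁻¹ := Real.rpow_nonneg hH0 _
  have hθ0 : 0 < θ := lt_of_le_of_lt (inv_nonneg.2 (by linarith)) hθ
  -- The hypothesis on `θ` amounts to `θ^{-γ} < H (1-θ)^{-γ}`. If `c > θ a`, savings are below
  -- `(1-θ) a`, and asymptotically the marginal value of saving is at least `H (1-θ)^{-γ} u'(a)`,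
  -- above `u'(θ a) ≥ u'(c)`, against `euler_ge`.
  have hlt : (1 - θ) / θ < H ^ γ⁻¹ := by
    have h2 : 1 < θ * (1 + H ^ γ⁻¹) := by
      rwa [inv_lt_iff_one_lt_mul₀ (by linarith)] at hθ
    rw [div_lt_iff₀ hθ0]
    linarith
  have hlt2 : ((1 - θ) / θ) ^ γ < H := by
    have := Real.rpow_lt_rpow (div_nonneg (by linarith) hθ0.le) hlt hγ
    rwa [← Real.rpow_mul hH0, inv_mul_cancel₀ hγ.ne', Real.rpow_one] at this
  have h1θ : 0 < 1 - θ := by linarith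
  have hsum0 : ∑ j, M.PD γ z j * (1 * ((((s j)⁻¹ + 0) * (1 - θ)) ^ (-γ))) =
      H * (1 - θ) ^ (-γ) := by
    rw [hH, Finset.sum_mul]
    refine Finset.sum_congr rfl fun j _ => ?_
    rw [add_zero, Real.mul_rpow (inv_nonneg.2 (hs j).le) h1θ.le, Real.inv_rpow (hs j).le,
      Real.rpow_neg (hs j).le, inv_inv]
    ring
  have hgt : θ ^ (-γ) < ∑ j, M.PD γ z j * (1 * ((((s j)⁻¹ + 0) * (1 - θ)) ^ (-γ))) := by
    rw [hsum0]
    have h3 : θ ^ (-γ) = ((1 - θ) / θ) ^ γ * (1 - θ) ^ (-γ) := by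
      rw [Real.div_rpow h1θ.le hθ0.le, Real.rpow_neg h1θ.le, Real.rpow_neg hθ0.le]
      have := (Real.rpow_pos_of_pos h1θ γ).ne'
      field_simp
    rw [h3]
    exact mul_lt_mul_of_pos_right hlt2 (Real.rpow_pos_of_pos h1θ _)
  -- The bound on `c` is available only with slopes strictly above `1/s`; continuity provides a
  -- slope `1/s + η` that preserves the strict inequality.
  have hcont : ContinuousAt (fun η : ℝ => ∑ j, M.PD γ z j *
      (1 * ((((s j)⁻¹ + η) * (1 - θ)) ^ (-γ)))) 0 := by
    refine tendsto_finsetSum _ fun j _ => ?_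
    refine Tendsto.const_mul _ (Tendsto.const_mul _ ?_)
    have hp : 0 < ((s j)⁻¹ + 0) * (1 - θ) := by
      have := inv_pos.2 (hs j)
      rw [add_zero]; positivity
    have hca : ContinuousAt (fun η : ℝ => ((s j)⁻¹ + η) * (1 - θ)) 0 := by fun_prop
    exact hca.rpow_const (Or.inl hp.ne')
  obtain ⟨η, hη1, hη2⟩ := (((hcont.tendsto.eventually_const_lt hgt).filter_mono
    (nhdsWithin_le_nhds (s := Set.Ioi 0))).and self_mem_nhdsWithin).exists
  have hη : 0 < η := hη2
  have hsη : ∀ j, 0 < (s j)⁻¹ + η := fun j => add_pos (inv_pos.2 (hs j)) hη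
  obtain ⟨L, hL1, hL2⟩ := exists_between hη1
  have hA : ∃ A : ℝ, 0 < A ∧ ∀ j, ∀ a ≥ A, c a j ≤ ((s j)⁻¹ + η) * a := by
    have hev : ∀ᶠ a in atTop, ∀ j, c a j ≤ ((s j)⁻¹ + η) * a :=
      eventually_all.2 fun j => hup j _ (by linarith)
    obtain ⟨A, hA⟩ := eventually_atTop.1 hev
    exact ⟨max A 1, by positivity, fun j a ha => hA a ((le_max_left _ _).trans ha) j⟩
  obtain ⟨A, hA0, hA⟩ := hA
  -- An affine bound valid at every wealth level, since `c ≤ a ≤ A` below the threshold; the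
  -- constant is absorbed into `q`.
  have hcA : ∀ j a, 0 < a → c a j ≤ ((s j)⁻¹ + η) * a + A := by
    intro j a ha
    rcases le_total A a with h | h
    · have := hA j a h
      linarith
    · have := (hc.bounds ha j).2
      have := mul_pos (hsη j) ha
      linarith
  set q : Shock N Eε Eζ Eη → ℝ := fun x => ((s x.1)⁻¹ + η) * I.Y x.1 x.2.2.2 + A with hq
  have hqm : Measurable q := by
    refine (Measurable.mul ?_ (measurable_shock_income I)).add_const A
    exact (measurable_of_finite fun j => (s j)⁻¹ + η).comp measurable_fst
  have hq0 : ∀ x, 0 ≤ q x := fun x =>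
    add_nonneg (mul_nonneg (hsη _).le (I.Y_nonneg _ _)) hA0.le
  have hL0 : 0 ≤ L := (Real.rpow_nonneg hθ0.le _).trans hL1.le
  filter_upwards [eventually_lt_eulerIntegral (I := I) hu hrv hM hR hγ (g := fun _ => 1)
    (fun _ => zero_le_one) (fun j => mul_pos (hsη j) h1θ) hqm hq0 hL0 hL2,
    (hrv θ hθ0).eventually_lt_const hL1, eventually_gt_atTop 0] with a h2 h3 ha
  by_contra! hlt
  have hma := hu.marginal_pos a ha
  have hE := hc.euler_ge hu hM hI ha z
  have hle : eulerIntegral M I u (fun _ => 1) (fun j => ((s j)⁻¹ + η) * (1 - θ)) q z a ≤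
      ENNReal.ofReal (marginal u (c a z)) := by
    rw [← lintegral_path_eulerIntegrand hu _ _ hqm]
    refine le_trans (lintegral_mono_ae ?_) hE
    filter_upwards [hc.nextWealth_pos_ae hu hI ha z] with ω hω
    rw [ENNReal.ofReal_one, one_mul]
    refine mul_le_mul' le_rfl (hu.antitone_marginalExt ?_)
    refine (hcA (state 1 ω) _ hω).trans ?_
    have hw : nextWealth M I c a z (ω 1) ≤ retAt M 1 ω * ((1 - θ) * a) + incAt I 1 ω := by
      refine add_le_add_left (mul_le_mul_of_nonneg_left ?_ (retAt_nonneg M 1 ω)) _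
      linarith
    have := mul_le_mul_of_nonneg_left hw (hsη (state 1 ω)).le
    calc _ ≤ ((s (state 1 ω))⁻¹ + η) * (retAt M 1 ω * ((1 - θ) * a) + incAt I 1 ω) + A := by
          linarith
      _ = _ := by
        rw [hq]
        simp only [retAt, incAt, state]
        ring
  have h4 := h2.trans_le hle
  rw [ENNReal.ofReal_lt_ofReal_iff (hu.marginal_pos _ (by nlinarith))] at h4
  have h5 := hu.marginal_anti (by positivity) hlt.le
  rw [div_lt_iff₀ hma] at h3
  linarith

end Asymptotics

/-! ### The lower bound on a closed set of states. -/

section LowerBound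

variable {N : ℕ} {Eε Eζ Eη : Type*} [MeasurableSpace Eε] [MeasurableSpace Eζ] [MeasurableSpace Eη]
variable {M : Multiplicative N Eε Eζ} {I : Income N Eη}

variable {u : ℝ → EReal} {γ : ℝ} {c : ℝ → Fin N → ℝ} {S : Set (Fin N)} {s : Fin N → ℝ}

/-- Takes the place of a fixed-point theorem: an error bound that improves by a factor `r < 1`
becomes arbitrarily small. -/
lemma forall_pos_of_contraction {Q : ℝ → Prop} {m₀ r : ℝ} (hr0 : 0 ≤ r) (hr1 : r < 1)
    (h0 : 0 ≤ m₀) (hbase : Q m₀) (hstep : ∀ m, 0 ≤ m → Q m → Q (r * m))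
    (hmono : ∀ m m', m ≤ m' → Q m → Q m') {m : ℝ} (hm : 0 < m) : Q m := by
  have hQ : ∀ n : ℕ, Q (r ^ n * m₀) := by
    intro n
    induction n with
    | zero => simpa using hbase
    | succ n ih =>
      rw [pow_succ', mul_assoc]
      exact hstep _ (by positivity) ih
  have hlim : Tendsto (fun n : ℕ => r ^ n * m₀) atTop (𝓝 0) := by
    simpa using (tendsto_pow_atTop_nhds_zero_of_lt_one hr0 hr1).mul_const m₀
  obtain ⟨n, hn⟩ := (hlim.eventually_lt_const hm).exists
  exact hmono _ _ hn.le (hQ n)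

/-- Transitions of `P D` never leave `S`, so that from `S` the process `βR` vanishes outside `S`. -/
lemma ae_mem_or_eq_zero (hM : M.Impatient) (hR : M.ReturnGap) (hγ : 0 < γ) {z : Fin N}
    (hz : ∀ j ∉ S, M.PD γ z j = 0) :
    ∀ᵐ ω ∂pathLaw M I z, state 1 ω ∈ S ∨ discAt M 1 ω * retAt M 1 ω = 0 := by
  classical
  -- Testing with the indicator of the complement of `S` gives `βR^{1-γ} = 0` almost surely outside
  -- `S`, which forces `βR = 0`.
  have hint := lintegral_step_diagMean_vec M I
    (X := fun z e f => M.β z e * M.R z f * M.R z f ^ (-γ)) (integrable_PD_integrand hM hR hγ)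
    (measurable_PD_integrand M γ) (PD_integrand_nonneg M γ)
    (w := fun j => if j ∈ S then 0 else 1) (fun j => by split_ifs <;> norm_num) z
  have hzero : ∑ j, (M.P * M.diagMean fun z e f => M.β z e * M.R z f * M.R z f ^ (-γ)) z j *
      (if j ∈ S then (0 : ℝ) else 1) = 0 := by
    refine Finset.sum_eq_zero fun j _ => ?_
    split_ifs with h
    · simp
    · rw [mul_one]; exact hz j h
  rw [hzero, ENNReal.ofReal_zero, lintegral_eq_zero_iff] at hint
  · refine ae_next_zero M I (p := fun x => x.1 ∈ S ∨ M.β x.1 x.2.1 * M.R x.1 x.2.2.1 = 0) z ?_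
    filter_upwards [hint] with x hx
    by_cases hS : x.1 ∈ S
    · exact Or.inl hS
    · right
      simp only [hS, if_false, ENNReal.ofReal_one, mul_one, Pi.zero_apply,
        ENNReal.ofReal_eq_zero] at hx
      have h0 := le_antisymm hx (PD_integrand_nonneg M γ x.1 x.2.1 x.2.2.1)
      rcases mul_eq_zero.1 h0 with h | h
      · exact h
      · rcases (M.R_nonneg x.1 x.2.2.1).eq_or_lt with h' | h'
        · rw [← h', mul_zero]
        · exact absurd h (Real.rpow_pos_of_pos h' _).ne'
  · exact (measurable_shock_mult (X := fun z e f => M.β z e * M.R z f * M.R z f ^ (-γ))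
      (measurable_PD_integrand M γ)).ennreal_ofReal.mul
      ((measurable_of_finite fun j => if j ∈ S then (0 : ℝ) else 1).comp
        measurable_fst).ennreal_ofReal

/-- On a set `S` closed under `P D` that carries a solution of `P D s^γ ≤ (s - 1)^γ`, marginal
utility of consumption is at most a multiple of marginal utility of a fraction of wealth. -/
lemma IsConsumptionFunction.exists_marginal_le (hc : IsConsumptionFunction M I u c)
    (hu : InadaUtility u) (hrv : RegularlyVarying (marginal u) (-γ)) (hI : I.Admissible u)
    (hM : M.Impatient) (hR : M.ReturnGap) (hγ : 0 < γ) (hs : ∀ z, 1 ≤ s z)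
    (hsub : ∀ z ∈ S, ∑ j, M.PD γ z j * s j ^ γ ≤ (s z - 1) ^ γ)
    (hcl : ∀ z ∈ S, ∀ j ∉ S, M.PD γ z j = 0) :
    ∃ κ ε : ℝ, 0 < κ ∧ 0 < ε ∧ ∀ z ∈ S, ∀ a, 0 < a →
      marginal u (c a z) ≤ κ * s z ^ γ * marginal u (ε * a) := by
  obtain ⟨w, hw1, hw⟩ := exists_eq_add_mulVec M.PDβR (diagMean_mul_nonneg M M.βR_nonneg)
    hM.specRad_βR (fun _ => 1) (fun _ => zero_le_one)
  have hw0 : ∀ j, 0 ≤ w j := fun j => zero_le_one.trans (hw1 j)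
  obtain ⟨K, hK0, hK⟩ := hc.exists_marginal_bound hu hM hI
  have hx1 : ∀ j, 1 ≤ s j ^ γ := fun j => Real.one_le_rpow (hs j) hγ.le
  have hx0 : ∀ j, 0 ≤ s j ^ γ := fun j => zero_le_one.trans (hx1 j)
  -- a uniform fraction `ε` of wealth
  have hε : ∃ ε : ℝ, 0 < ε ∧ ε < 1 ∧ ∀ z ∈ S,
      ∑ j, M.PD γ z j * (s j ^ γ * (1 - ε) ^ (-γ)) < s z ^ γ := by
    have hev : ∀ᶠ ε : ℝ in 𝓝[>] 0, ∀ z, z ∈ S →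
        ∑ j, M.PD γ z j * (s j ^ γ * (1 - ε) ^ (-γ)) < s z ^ γ := by
      refine eventually_all.2 fun z => ?_
      by_cases hz : z ∈ S
      · have hcont : ContinuousAt (fun ε : ℝ => ∑ j, M.PD γ z j *
            (s j ^ γ * (1 - ε) ^ (-γ))) 0 := by
          refine tendsto_finsetSum _ fun j _ => ?_
          refine Tendsto.const_mul _ (Tendsto.const_mul _ ?_)
          have hca : ContinuousAt (fun ε : ℝ => 1 - ε) 0 := by fun_prop
          exact hca.rpow_const (Or.inl (by norm_num))
        -- The strict gap between `(s - 1)^γ` and `s^γ` leaves room for a positive `ε`.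
        have hlt : ∑ j, M.PD γ z j * (s j ^ γ * (1 - (0 : ℝ)) ^ (-γ)) < s z ^ γ := by
          simp only [sub_zero, Real.one_rpow, mul_one]
          exact (hsub z hz).trans_lt
            (Real.rpow_lt_rpow (by linarith [hs z]) (by linarith) hγ)
        filter_upwards [(hcont.tendsto.eventually_lt_const hlt).filter_mono nhdsWithin_le_nhds]
          with ε h _
        exact h
      · exact Eventually.of_forall fun ε h => absurd h hz
    obtain ⟨ε, h1, h2⟩ := (hev.and (Ioo_mem_nhdsGT (show (0 : ℝ) < 1 by norm_num))).exists
    exact ⟨ε, h2.1, h2.2, h1⟩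
  obtain ⟨ε, hε0, hε1, hεS⟩ := hε
  have h1ε : 0 < 1 - ε := by linarith
  -- beyond `B` the comparison function is a supersolution
  have hB : ∃ B : ℝ, 0 < B ∧ ∀ z ∈ S, ∀ y ≥ B,
      eulerIntegral M I u (fun j => s j ^ γ) (fun _ => 1 - ε) (fun _ => 0) z y ≤
        ENNReal.ofReal (s z ^ γ * marginal u y) := by
    have hev : ∀ᶠ y in atTop, ∀ z, z ∈ S →
        eulerIntegral M I u (fun j => s j ^ γ) (fun _ => 1 - ε) (fun _ => 0) z y ≤
          ENNReal.ofReal (s z ^ γ * marginal u y) := by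
      refine eventually_all.2 fun z => ?_
      by_cases hz : z ∈ S
      · filter_upwards [eventually_eulerIntegral_le (I := I) hu hrv hM hR hγ hx0 (fun _ => h1ε)
          (q := fun _ => 0) measurable_const (fun _ => le_rfl) (hεS z hz)] with y h _
        exact h
      · exact Eventually.of_forall fun ε h => absurd h hz
    obtain ⟨B, hB⟩ := eventually_atTop.1 hev
    exact ⟨max B 1, by positivity, fun z hz y hy => hB y ((le_max_left _ _).trans hy) z hz⟩
  obtain ⟨B, hB0, hB⟩ := hB
  have hfB := hu.marginal_pos B hB0
  -- Chosen so that `κ u'(B) = u'(B) + K`: for `εa < B` and positive savings, the bound `K` on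
  -- marginal utility already gives the claim.
  set κ : ℝ := 1 + K / marginal u B with hκ
  have hκ1 : 1 ≤ κ := by rw [hκ]; linarith [div_nonneg hK0 hfB.le]
  have hκB : κ * marginal u B = marginal u B + K := by rw [hκ]; field_simp
  have hκx : ∀ z, 1 ≤ κ * s z ^ γ := fun z => one_le_mul_of_one_le_of_one_le hκ1 (hx1 z)
  refine ⟨κ, ε, by linarith, hε0, ?_⟩
  obtain ⟨W, hW1, hW⟩ : ∃ W : ℝ, 1 ≤ W ∧ ∀ j, w j ≤ W := by
    refine ⟨1 + ∑ j, w j, by linarith [Finset.sum_nonneg fun j (_ : j ∈ Finset.univ) => hw0 j],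
      fun j => ?_⟩
    linarith [Finset.single_le_sum (fun i _ => hw0 i) (Finset.mem_univ j)]
  -- The claim is proved with an error `m w`, where `w = 1 + P D_{βR} w`. One Euler step turns `m w`
  -- into `m (w - 1) ≤ (1 - 1/W) m w`, since `w ≤ W`.
  have hQ : ∀ m > 0, ∀ z ∈ S, ∀ a, 0 < a →
      marginal u (c a z) ≤ κ * s z ^ γ * marginal u (ε * a) + m * w z := by
    intro m hm
    refine forall_pos_of_contraction (Q := fun m => ∀ z ∈ S, ∀ a, 0 < a →
      marginal u (c a z) ≤ κ * s z ^ γ * marginal u (ε * a) + m * w z) (m₀ := K) (r := 1 - W⁻¹)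
      ?_ ?_ hK0 ?_ ?_ ?_ hm
    · linarith [inv_le_one_of_one_le₀ hW1]
    · linarith [inv_pos.2 (zero_lt_one.trans_le hW1)]
    · intro z _ a ha
      have hf := hu.marginal_pos (ε * a) (by positivity)
      rcases (hc.bounds ha z).2.eq_or_lt with h | h
      · rw [h]
        have h1 := hu.marginal_anti (x := ε * a) (y := a) (by positivity) (by nlinarith)
        have h2 := mul_le_mul_of_nonneg_right (hκx z) hf.le
        have h3 := mul_nonneg hK0 (hw0 z)
        linarith
      · have h1 := (hK a ha z).2 h
        have h2 := mul_nonneg (zero_le_one.trans (hκx z)) hf.le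
        have h3 := mul_le_mul_of_nonneg_left (hw1 z) hK0
        linarith
    · intro m hm hQm z hz a ha
      -- Failure of the bound forces `c ≤ εa < a`, so `euler_le` applies, and `εa ≥ B`, so the
      -- comparison function is a supersolution.
      by_contra! hgt
      have hr0 : 0 ≤ 1 - W⁻¹ := by linarith [inv_le_one_of_one_le₀ hW1]
      have hεa : 0 < ε * a := by positivity
      have hf := hu.marginal_pos (ε * a) hεa
      have hh : κ * s z ^ γ * marginal u (ε * a) < marginal u (c a z) := by
        have := mul_nonneg (mul_nonneg hr0 hm) (hw0 z)
        linarith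
      have hcpos := (hK a ha z).1
      have hcε : c a z ≤ ε * a := by
        refine hu.le_of_marginal_le hcpos hεa ?_
        have h2 := mul_le_mul_of_nonneg_right (hκx z) hf.le
        linarith
      have hca : c a z < a := hcε.trans_lt (by nlinarith)
      have hBy : B ≤ ε * a := by
        by_contra! h
        have h1 := hu.marginal_anti hεa h.le
        have h2 : κ * marginal u B ≤ κ * s z ^ γ * marginal u (ε * a) := by
          refine mul_le_mul ?_ h1 hfB.le (zero_le_one.trans (hκx z))
          exact le_mul_of_one_le_right (by linarith) (hx1 z)
        linarith [(hK a ha z).2 hca]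
      have hE := hc.euler_le hu hM hI ha z hca
      have hbound : ∫⁻ ω, ENNReal.ofReal (discAt M 1 ω * retAt M 1 ω) *
          marginalExt u (c (nextWealth M I c a z (ω 1)) (state 1 ω)) ∂pathLaw M I z ≤
          ∫⁻ ω, (ENNReal.ofReal κ * (ENNReal.ofReal (discAt M 1 ω * retAt M 1 ω) *
            (ENNReal.ofReal (s (state 1 ω) ^ γ) *
              marginalExt u ((1 - ε) * retAt M 1 ω * (ε * a) + 0))) +
            ENNReal.ofReal m * (ENNReal.ofReal (discAt M 1 ω * retAt M 1 ω) *
              ENNReal.ofReal (w (state 1 ω)))) ∂pathLaw M I z := by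
        refine lintegral_mono_ae ?_
        filter_upwards [hc.nextWealth_pos_ae hu hI ha z,
          ae_mem_or_eq_zero (I := I) hM hR hγ (hcl z hz)] with ω hω hω2
        rcases hω2 with hS | h0
        · have h1 := hQm _ hS _ hω
          have hp := hc.pos hu hM hI hω (state 1 ω)
          have hεn : 0 < ε * nextWealth M I c a z (ω 1) := mul_pos hε0 hω
          have h2 : marginalExt u (c (nextWealth M I c a z (ω 1)) (state 1 ω)) ≤
              ENNReal.ofReal κ * (ENNReal.ofReal (s (state 1 ω) ^ γ) *
              marginalExt u ((1 - ε) * retAt M 1 ω * (ε * a) + 0)) +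
              ENNReal.ofReal m * ENNReal.ofReal (w (state 1 ω)) := by
            rw [marginalExt_of_pos hp]
            refine (ENNReal.ofReal_le_ofReal h1).trans ?_
            rw [ENNReal.ofReal_add (mul_nonneg (zero_le_one.trans (hκx _))
              (hu.marginal_pos _ hεn).le) (mul_nonneg hm (hw0 _)), ENNReal.ofReal_mul
              (zero_le_one.trans (hκx _)), ENNReal.ofReal_mul (by linarith),
              ENNReal.ofReal_mul hm, mul_assoc]
            refine add_le_add_left (mul_le_mul' le_rfl (mul_le_mul' le_rfl ?_)) _
            rw [← marginalExt_of_pos hεn]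
            refine hu.antitone_marginalExt ?_
            have h3 : retAt M 1 ω * ((1 - ε) * a) ≤ nextWealth M I c a z (ω 1) := by
              have h4 := mul_le_mul_of_nonneg_left
                (show (1 - ε) * a ≤ a - c a z by linarith) (retAt_nonneg M 1 ω)
              exact h4.trans (le_add_of_nonneg_right (I.Y_nonneg _ _))
            have := mul_le_mul_of_nonneg_left h3 hε0.le
            linarith
          calc _ ≤ _ := mul_le_mul' le_rfl h2
            _ = _ := by ring
        · simp [h0]
      have hsplit : ∫⁻ ω, (ENNReal.ofReal κ * (ENNReal.ofReal (discAt M 1 ω * retAt M 1 ω) *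
            (ENNReal.ofReal (s (state 1 ω) ^ γ) *
              marginalExt u ((1 - ε) * retAt M 1 ω * (ε * a) + 0))) +
            ENNReal.ofReal m * (ENNReal.ofReal (discAt M 1 ω * retAt M 1 ω) *
              ENNReal.ofReal (w (state 1 ω)))) ∂pathLaw M I z =
          ENNReal.ofReal κ * eulerIntegral M I u (fun j => s j ^ γ) (fun _ => 1 - ε)
            (fun _ => 0) z (ε * a) + ENNReal.ofReal m * ENNReal.ofReal (w z - 1) := by
        have hm2 : Measurable fun x : Shock N Eε Eζ Eη =>
            ENNReal.ofReal (M.β x.1 x.2.1 * M.R x.1 x.2.2.1) * ENNReal.ofReal (w x.1) :=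
          (measurable_shock_βR M).mul ((measurable_of_finite w).comp measurable_fst).ennreal_ofReal
        have hm2' : Measurable fun ω : Path N Eε Eζ Eη =>
            ENNReal.ofReal (discAt M 1 ω * retAt M 1 ω) * ENNReal.ofReal (w (state 1 ω)) :=
          hm2.comp (measurable_path_apply 1)
        have hi2 : ∫⁻ ω, ENNReal.ofReal (discAt M 1 ω * retAt M 1 ω) *
            ENNReal.ofReal (w (state 1 ω)) ∂pathLaw M I z = ENNReal.ofReal (w z - 1) := by
          refine (lintegral_next_zero M I z hm2).trans ?_
          rw [lintegral_step_diagMean_vec M I (X := fun z e f => M.β z e * M.R z f)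
            hM.integrable_βR (measurable_βR_prod M) M.βR_nonneg hw0 z]
          congr 1
          have := hw z
          simp only [Multiplicative.PDβR] at this
          linarith
        rw [lintegral_add_right _ (hm2'.const_mul _), lintegral_const_mul' _ _ ENNReal.ofReal_ne_top,
          lintegral_const_mul' _ _ ENNReal.ofReal_ne_top, hi2,
          ← lintegral_path_eulerIntegrand hu (fun j => s j ^ γ) (fun _ => 1 - ε)
            (q := fun _ => 0) measurable_const]
      have hfin := hE.trans hbound
      rw [hsplit] at hfin
      have hfin2 := hfin.trans (add_le_add_left (mul_le_mul' le_rfl (hB z hz _ hBy)) _)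
      have hwz : 0 ≤ w z - 1 := by linarith [hw1 z]
      have hsf : 0 ≤ s z ^ γ * marginal u (ε * a) := mul_nonneg (hx0 z) hf.le
      rw [← ENNReal.ofReal_mul (by linarith), ← ENNReal.ofReal_mul hm, ← ENNReal.ofReal_add
        (mul_nonneg (by linarith) hsf) (mul_nonneg hm hwz), ENNReal.ofReal_le_ofReal_iff
        (add_nonneg (mul_nonneg (by linarith) hsf) (mul_nonneg hm hwz))] at hfin2
      have hWw : W⁻¹ * w z ≤ 1 := by
        rw [inv_mul_le_iff₀ (by linarith)]
        linarith [hW z]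
      have := mul_le_mul_of_nonneg_left hWw hm
      nlinarith
    · intro m m' hmm h z hz a ha
      have := mul_le_mul_of_nonneg_right hmm (hw0 z)
      linarith [h z hz a ha]
  intro z hz a ha
  refine le_of_forall_pos_le_add fun e he => ?_
  have hwz : 0 < w z := zero_lt_one.trans_le (hw1 z)
  have := hQ (e / w z) (by positivity) z hz a ha
  rwa [div_mul_cancel₀ _ hwz.ne'] at this

/-- The average propensity to consume is bounded away from zero on `S`. -/
lemma IsConsumptionFunction.exists_lower (hc : IsConsumptionFunction M I u c)
    (hu : InadaUtility u) (hrv : RegularlyVarying (marginal u) (-γ)) (hI : I.Admissible u)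
    (hM : M.Impatient) (hR : M.ReturnGap) (hγ : 0 < γ) (hs : ∀ z, 1 ≤ s z)
    (hsub : ∀ z ∈ S, ∑ j, M.PD γ z j * s j ^ γ ≤ (s z - 1) ^ γ)
    (hcl : ∀ z ∈ S, ∀ j ∉ S, M.PD γ z j = 0) :
    ∃ η : ℝ, 0 < η ∧ ∀ z ∈ S, ∀ᶠ a in atTop, η * a ≤ c a z := by
  obtain ⟨κ, ε, hκ, hε, h⟩ := hc.exists_marginal_le hu hrv hI hM hR hγ hs hsub hcl
  have hx0 : ∀ j, 0 ≤ s j ^ γ := fun j => Real.rpow_nonneg (zero_le_one.trans (hs j)) _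
  -- With `η = X^{-1/γ}`, the limit `η^{-γ} = X` of `u'(ηa)/u'(a)` exceeds the limit `κ s^γ ε^{-γ}`
  -- of the bound on `u'(c)/u'(a)`.
  set X : ℝ := κ * (∑ j, s j ^ γ) * ε ^ (-γ) + 1 with hX
  have hX0 : 0 < X := by
    have h1 := Finset.sum_nonneg fun j (_ : j ∈ Finset.univ) => hx0 j
    have h2 := Real.rpow_nonneg hε.le (-γ)
    positivity
  refine ⟨X ^ (-γ⁻¹), Real.rpow_pos_of_pos hX0 _, fun z hz => ?_⟩
  have hη0 := Real.rpow_pos_of_pos hX0 (-γ⁻¹)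
  have hη : (X ^ (-γ⁻¹)) ^ (-γ) = X := by
    rw [← Real.rpow_mul hX0.le, neg_mul_neg, inv_mul_cancel₀ hγ.ne', Real.rpow_one]
  have ht : Tendsto (fun a => κ * s z ^ γ * (marginal u (ε * a) / marginal u a)) atTop
      (𝓝 (κ * s z ^ γ * ε ^ (-γ))) := (hrv ε hε).const_mul _
  have hlt : κ * s z ^ γ * ε ^ (-γ) < (X ^ (-γ⁻¹)) ^ (-γ) := by
    rw [hη, hX]
    have h1 := Finset.single_le_sum (fun i _ => hx0 i) (Finset.mem_univ z)
    have h2 := mul_le_mul_of_nonneg_right (mul_le_mul_of_nonneg_left h1 hκ.le)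
      (Real.rpow_nonneg hε.le (-γ))
    linarith
  filter_upwards [ht.eventually_lt (hrv _ hη0) hlt, eventually_gt_atTop 0] with a ha ha0
  have hm := hu.marginal_pos a ha0
  rw [← mul_div_assoc, div_lt_div_iff_of_pos_right hm] at ha
  refine hu.le_of_marginal_le (by positivity) (hc.pos hu hM hI ha0 z) ?_
  exact (h z hz a ha0).trans ha.le

/-- One step of the lower bound: from `c ≥ a / (t s)` to `c ≥ a / s'` whenever
`s' - 1 > t (P D s^γ)^{1/γ}`. -/
lemma IsConsumptionFunction.lower_step (hc : IsConsumptionFunction M I u c)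
    (hu : InadaUtility u) (hrv : RegularlyVarying (marginal u) (-γ)) (hI : I.Admissible u)
    (hM : M.Impatient) (hR : M.ReturnGap) (hγ : 0 < γ) (hs : ∀ z, 1 ≤ s z)
    (hcl : ∀ z ∈ S, ∀ j ∉ S, M.PD γ z j = 0) {t : ℝ} (ht : 0 < t)
    (hlow : ∀ z ∈ S, ∀ᶠ a in atTop, (t * s z)⁻¹ * a ≤ c a z) {z : Fin N} (hz : z ∈ S)
    {s' : ℝ} (hs' : 1 < s') (hlt : t ^ γ * ∑ j, M.PD γ z j * s j ^ γ < (s' - 1) ^ γ) :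
    ∀ᶠ a in atTop, s'⁻¹ * a ≤ c a z := by
  have hs0 : ∀ j, 0 < s j := fun j => zero_lt_one.trans_le (hs j)
  set θ := s'⁻¹ with hθ
  have hθ0 : 0 < θ := inv_pos.2 (by linarith)
  have hθ1 : θ < 1 := inv_lt_one_of_one_lt₀ hs'
  have h1θ : 0 < 1 - θ := by linarith
  have hv0 : ∀ j, 0 < (t * s j)⁻¹ * (1 - θ) := fun j =>
    mul_pos (inv_pos.2 (mul_pos ht (hs0 j))) h1θ
  have hsum : ∑ j, M.PD γ z j * (1 * ((t * s j)⁻¹ * (1 - θ)) ^ (-γ)) < θ ^ (-γ) := by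
    have e1 : ∑ j, M.PD γ z j * (1 * ((t * s j)⁻¹ * (1 - θ)) ^ (-γ)) =
        (t ^ γ * ∑ j, M.PD γ z j * s j ^ γ) * (1 - θ) ^ (-γ) := by
      rw [Finset.mul_sum, Finset.sum_mul]
      refine Finset.sum_congr rfl fun j _ => ?_
      have hts := mul_pos ht (hs0 j)
      rw [Real.mul_rpow (inv_nonneg.2 hts.le) h1θ.le, Real.inv_rpow hts.le,
        Real.rpow_neg hts.le, inv_inv, Real.mul_rpow ht.le (hs0 j).le]
      ring
    have e2 : θ ^ (-γ) = (s' - 1) ^ γ * (1 - θ) ^ (-γ) := by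
      have e3 : 1 - θ = θ * (s' - 1) := by
        rw [hθ, mul_sub, inv_mul_cancel₀ (by linarith), mul_one]
      have h4 : 0 < s' - 1 := by linarith
      rw [e3, Real.mul_rpow hθ0.le h4.le, Real.rpow_neg h4.le, Real.rpow_neg hθ0.le]
      have := (Real.rpow_pos_of_pos h4 γ).ne'
      field_simp
    rw [e1, e2]
    exact mul_lt_mul_of_pos_right hlt (Real.rpow_pos_of_pos h1θ _)
  obtain ⟨L, hL1, hL2⟩ := exists_between hsum
  obtain ⟨δ, hδ, hgap⟩ := hR
  have hA : ∃ A : ℝ, ∀ j ∈ S, ∀ a ≥ A, (t * s j)⁻¹ * a ≤ c a j := by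
    have hev : ∀ᶠ a in atTop, ∀ j, j ∈ S → (t * s j)⁻¹ * a ≤ c a j :=
      eventually_all.2 fun j => by
        by_cases hj : j ∈ S
        · filter_upwards [hlow j hj] with a ha _
          exact ha
        · exact Eventually.of_forall fun a h => absurd h hj
    obtain ⟨A, hA⟩ := eventually_atTop.1 hev
    exact ⟨A, fun j hj a ha => hA a ha j hj⟩
  obtain ⟨A, hA⟩ := hA
  have hRae : ∀ᵐ ω ∂pathLaw M I z, retAt M 1 ω = 0 ∨ δ ≤ retAt M 1 ω :=
    ae_next_zero M I z (ae_step_ret M I (p := fun z e => M.R z e = 0 ∨ δ ≤ M.R z e) z hgap)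
  -- If `R ≥ δ` and savings exceed `(1-θ) a`, the threshold `A / (δ (1-θ))` puts next-period wealth
  -- above `A`, where the bound assumed on `c` holds; `R = 0` contributes nothing.
  filter_upwards [eventually_eulerIntegral_le (I := I) hu hrv hM ⟨δ, hδ, hgap⟩ hγ
    (g := fun _ => 1) (fun _ => zero_le_one) hv0 (q := fun _ => 0) measurable_const
    (fun _ => le_rfl) hL1, (hrv θ hθ0).eventually_const_lt hL2, eventually_gt_atTop 0,
    eventually_ge_atTop (A / (δ * (1 - θ)))] with a h2 h3 ha hAa
  by_contra! hlt
  have hma := hu.marginal_pos a ha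
  have hcpos := hc.pos hu hM hI ha z
  have hE := hc.euler_le hu hM hI ha z (hlt.trans (by nlinarith))
  have hle : ENNReal.ofReal (marginal u (c a z)) ≤
      eulerIntegral M I u (fun _ => 1) (fun j => (t * s j)⁻¹ * (1 - θ)) (fun _ => 0) z a := by
    rw [← lintegral_path_eulerIntegrand hu _ _ measurable_const]
    refine hE.trans (lintegral_mono_ae ?_)
    filter_upwards [hRae, ae_mem_or_eq_zero (I := I) hM ⟨δ, hδ, hgap⟩ hγ (hcl z hz)]
      with ω hω1 hω2
    rcases hω2 with hS | h0
    · rcases hω1 with hR0 | hRδ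
      · simp [hR0]
      · rw [ENNReal.ofReal_one, one_mul]
        refine mul_le_mul' le_rfl (hu.antitone_marginalExt ?_)
        have hn : retAt M 1 ω * ((1 - θ) * a) ≤ nextWealth M I c a z (ω 1) := by
          have h4 := mul_le_mul_of_nonneg_left
            (show (1 - θ) * a ≤ a - c a z by linarith) (retAt_nonneg M 1 ω)
          exact h4.trans (le_add_of_nonneg_right (I.Y_nonneg _ _))
        have hAn : A ≤ nextWealth M I c a z (ω 1) := by
          rw [div_le_iff₀ (by positivity)] at hAa
          have := mul_le_mul_of_nonneg_right hRδ (mul_pos h1θ ha).le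
          linarith
        have h5 := hA _ hS _ hAn
        have h6 := mul_le_mul_of_nonneg_left hn
          (inv_nonneg.2 (mul_pos ht (hs0 (state 1 ω))).le)
        linarith
    · simp [h0]
  have h4 := hle.trans h2
  have hL0 : 0 ≤ L := le_trans (Finset.sum_nonneg fun j _ => mul_nonneg (PD_nonneg M γ z j)
    (mul_nonneg zero_le_one (Real.rpow_nonneg (hv0 j).le _))) hL1.le
  rw [ENNReal.ofReal_le_ofReal_iff (mul_nonneg hL0 hma.le)] at h4
  have h5 := hu.marginal_anti hcpos hlt.le
  rw [lt_div_iff₀ hma] at h3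
  linarith

/-- On `S` the average propensity to consume is asymptotically at least `1 / s`. -/
lemma IsConsumptionFunction.lower (hc : IsConsumptionFunction M I u c)
    (hu : InadaUtility u) (hrv : RegularlyVarying (marginal u) (-γ)) (hI : I.Admissible u)
    (hM : M.Impatient) (hR : M.ReturnGap) (hγ : 0 < γ) (hs : ∀ z, 1 ≤ s z)
    (hsub : ∀ z ∈ S, ∑ j, M.PD γ z j * s j ^ γ ≤ (s z - 1) ^ γ)
    (hcl : ∀ z ∈ S, ∀ j ∉ S, M.PD γ z j = 0) {t : ℝ} (ht : 1 < t) :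
    ∀ z ∈ S, ∀ᶠ a in atTop, (t * s z)⁻¹ * a ≤ c a z := by
  have hs0 : ∀ j, 0 < s j := fun j => zero_lt_one.trans_le (hs j)
  obtain ⟨η, hη, hlow⟩ := hc.exists_lower hu hrv hI hM hR hγ hs hsub hcl
  obtain ⟨σ, hσ1, hσ⟩ : ∃ σ : ℝ, 1 ≤ σ ∧ ∀ j, s j ≤ σ := by
    refine ⟨1 + ∑ j, s j, by linarith [Finset.sum_nonneg fun j (_ : j ∈ Finset.univ) =>
      (hs0 j).le], fun j => ?_⟩
    linarith [Finset.single_le_sum (fun i _ => (hs0 i).le) (Finset.mem_univ j)]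
  have hσ2 : 0 < (2 * σ)⁻¹ := by positivity
  have hσ3 : (2 * σ)⁻¹ < 1 := inv_lt_one_of_one_lt₀ (by linarith)
  -- Write `t = 1 + m`. Since `(1+m)(s-1)` falls short of `(1+m)s - 1` by `m`, there is room to
  -- reduce `m` by `m/(2σ)`, which costs at most `m/2` because `s ≤ σ`; the factor `2` keeps the
  -- inequality strict.
  have key : 0 ≤ t - 1 ∧ ∀ z ∈ S, ∀ᶠ a in atTop, ((1 + (t - 1)) * s z)⁻¹ * a ≤ c a z := by
    refine forall_pos_of_contraction (Q := fun m => 0 ≤ m ∧ ∀ z ∈ S, ∀ᶠ a in atTop,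
      ((1 + m) * s z)⁻¹ * a ≤ c a z) (m₀ := η⁻¹) (r := 1 - (2 * σ)⁻¹) (by linarith) (by linarith)
      (inv_nonneg.2 hη.le) ?_ ?_ ?_ (by linarith)
    · refine ⟨inv_nonneg.2 hη.le, fun z hz => ?_⟩
      filter_upwards [hlow z hz, eventually_gt_atTop 0] with a ha ha0
      refine le_trans (mul_le_mul_of_nonneg_right ?_ ha0.le) ha
      have hη' := inv_pos.2 hη
      rw [inv_le_comm₀ (mul_pos (by linarith) (hs0 z)) hη]
      nlinarith [hs z]
    · rintro m hm ⟨-, hQ⟩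
      rcases hm.eq_or_lt with rfl | hm
      · simpa using hQ
      refine ⟨mul_nonneg (by linarith) hm.le, fun z hz => ?_⟩
      have hr : 0 < (1 - (2 * σ)⁻¹) * m := mul_pos (by linarith) hm
      have hsσ : (2 * σ)⁻¹ * s z ≤ 1 / 2 := by
        rw [inv_mul_le_iff₀ (by linarith)]
        linarith [hσ z]
      have hgt : (1 + m) * (s z - 1) < (1 + (1 - (2 * σ)⁻¹) * m) * s z - 1 := by
        have := mul_le_mul_of_nonneg_left hsσ hm.le
        nlinarith
      have hsz : 0 ≤ s z - 1 := by linarith [hs z]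
      refine hc.lower_step hu hrv hI hM hR hγ hs hcl (t := 1 + m) (by linarith) hQ hz ?_ ?_
      · have := mul_nonneg (show (0 : ℝ) ≤ 1 + m by linarith) hsz
        linarith
      · calc _ ≤ (1 + m) ^ γ * (s z - 1) ^ γ :=
              mul_le_mul_of_nonneg_left (hsub z hz) (Real.rpow_nonneg (by linarith) _)
          _ = ((1 + m) * (s z - 1)) ^ γ := (Real.mul_rpow (by linarith) hsz).symm
          _ < _ := Real.rpow_lt_rpow (mul_nonneg (by linarith) hsz) hgt hγ
    · rintro m m' hmm ⟨h0, h⟩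
      refine ⟨h0.trans hmm, fun z hz => ?_⟩
      filter_upwards [h z hz, eventually_gt_atTop 0] with a ha ha0
      refine le_trans (mul_le_mul_of_nonneg_right ?_ ha0.le) ha
      exact inv_anti₀ (mul_pos (by linarith) (hs0 z))
        (mul_le_mul_of_nonneg_right (by linarith) (hs0 z).le)
  simpa using key.2

end LowerBound

/-! ### The iteration defining the limit and the convergence of `c(a,z)/a`. -/

section MPC

variable {N : ℕ} {A : Matrix (Fin N) (Fin N) ℝ} {γ : ℝ}

/-- The iterates `s_0 = 1`, `s_{n+1} = 1 + (A s_n^γ)^{1/γ}`. -/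
def mpcIter (A : Matrix (Fin N) (Fin N) ℝ) (γ : ℝ) : ℕ → Fin N → ℝ
  | 0, _ => 1
  | n + 1, z => 1 + (∑ j, A z j * mpcIter A γ n j ^ γ) ^ γ⁻¹

/-- The states where the iterates stay bounded. -/
def mpcSupport (A : Matrix (Fin N) (Fin N) ℝ) (γ : ℝ) : Set (Fin N) :=
  {z | BddAbove (Set.range fun n => mpcIter A γ n z)}

open Classical in
/-- The limit of the iterates where it is finite, and `1` elsewhere. -/
def mpcLimit (A : Matrix (Fin N) (Fin N) ℝ) (γ : ℝ) (z : Fin N) : ℝ :=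
  if z ∈ mpcSupport A γ then ⨆ n, mpcIter A γ n z else 1

open Classical in
/-- The asymptotic marginal propensity to consume: the reciprocal of the limit of the iterates. -/
def asymptoticMPC (A : Matrix (Fin N) (Fin N) ℝ) (γ : ℝ) (z : Fin N) : ℝ :=
  if z ∈ mpcSupport A γ then (mpcLimit A γ z)⁻¹ else 0

lemma one_le_mpcIter (hA : ∀ i j, 0 ≤ A i j) (n : ℕ) (z : Fin N) : 1 ≤ mpcIter A γ n z := by
  induction n generalizing z with
  | zero => exact le_rfl
  | succ n ih =>
    refine le_add_of_nonneg_right (Real.rpow_nonneg (Finset.sum_nonneg fun j _ => ?_) _)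
    exact mul_nonneg (hA z j) (Real.rpow_nonneg (zero_le_one.trans (ih j)) _)

lemma sum_mpcIter_nonneg (hA : ∀ i j, 0 ≤ A i j) (n : ℕ) (z : Fin N) :
    0 ≤ ∑ j, A z j * mpcIter A γ n j ^ γ := Finset.sum_nonneg fun j _ =>
  mul_nonneg (hA z j) (Real.rpow_nonneg (zero_le_one.trans (one_le_mpcIter hA n j)) _)

lemma mpcIter_succ_sub_one_rpow (hA : ∀ i j, 0 ≤ A i j) (hγ : 0 < γ) (n : ℕ) (z : Fin N) :
    (mpcIter A γ (n + 1) z - 1) ^ γ = ∑ j, A z j * mpcIter A γ n j ^ γ := by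
  rw [mpcIter, add_sub_cancel_left, ← Real.rpow_mul (sum_mpcIter_nonneg hA n z),
    inv_mul_cancel₀ hγ.ne', Real.rpow_one]

lemma monotone_mpcIter (hA : ∀ i j, 0 ≤ A i j) (hγ : 0 < γ) (z : Fin N) :
    Monotone fun n => mpcIter A γ n z := by
  refine monotone_nat_of_le_succ fun n => ?_
  induction n generalizing z with
  | zero => exact one_le_mpcIter hA 1 z
  | succ n ih =>
    refine add_le_add_right (Real.rpow_le_rpow (sum_mpcIter_nonneg hA n z)
      (Finset.sum_le_sum fun j _ => mul_le_mul_of_nonneg_left ?_ (hA z j)) (inv_nonneg.2 hγ.le)) 1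
    exact Real.rpow_le_rpow (zero_le_one.trans (one_le_mpcIter hA n j)) (ih j) hγ.le

lemma mpcIter_le_mpcLimit {z : Fin N} (hz : z ∈ mpcSupport A γ) (n : ℕ) :
    mpcIter A γ n z ≤ mpcLimit A γ z := by
  rw [mpcLimit, if_pos hz]
  exact le_ciSup hz n

lemma tendsto_mpcIter (hA : ∀ i j, 0 ≤ A i j) (hγ : 0 < γ) {z : Fin N}
    (hz : z ∈ mpcSupport A γ) :
    Tendsto (fun n => mpcIter A γ n z) atTop (𝓝 (mpcLimit A γ z)) := by
  rw [mpcLimit, if_pos hz]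
  exact tendsto_atTop_ciSup (monotone_mpcIter hA hγ z) hz

/-- The default value `1` off the support makes this hold at every state, as the lower bound
requires. -/
lemma one_le_mpcLimit (hA : ∀ i j, 0 ≤ A i j) (z : Fin N) : 1 ≤ mpcLimit A γ z := by
  by_cases hz : z ∈ mpcSupport A γ
  · exact (one_le_mpcIter hA 0 z).trans (mpcIter_le_mpcLimit hz 0)
  · rw [mpcLimit, if_neg hz]

/-- If `A z j > 0`, the iterate `n + 1` at `z` controls the iterate `n` at `j`. -/
lemma mpcSupport_closed (hA : ∀ i j, 0 ≤ A i j) (hγ : 0 < γ) {z : Fin N}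
    (hz : z ∈ mpcSupport A γ) {j : Fin N} (hj : j ∉ mpcSupport A γ) : A z j = 0 := by
  by_contra hne
  have hpos : 0 < A z j := lt_of_le_of_ne (hA z j) (Ne.symm hne)
  refine hj ⟨((A z j)⁻¹ * (mpcLimit A γ z - 1) ^ γ) ^ γ⁻¹, ?_⟩
  rintro _ ⟨n, rfl⟩
  have h1 := one_le_mpcIter (γ := γ) hA n j
  have h0 : 0 ≤ mpcIter A γ n j := zero_le_one.trans h1
  have h2 : A z j * mpcIter A γ n j ^ γ ≤ (mpcLimit A γ z - 1) ^ γ := by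
    calc _ ≤ ∑ j, A z j * mpcIter A γ n j ^ γ :=
          Finset.single_le_sum (f := fun j => A z j * mpcIter A γ n j ^ γ) (fun i _ =>
            mul_nonneg (hA z i) (Real.rpow_nonneg (zero_le_one.trans (one_le_mpcIter hA n i)) _))
            (Finset.mem_univ j)
      _ = (mpcIter A γ (n + 1) z - 1) ^ γ := (mpcIter_succ_sub_one_rpow hA hγ n z).symm
      _ ≤ _ := Real.rpow_le_rpow (by linarith [one_le_mpcIter (γ := γ) hA (n + 1) z])
          (by linarith [mpcIter_le_mpcLimit hz (n + 1)]) hγ.le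
  have h3 : mpcIter A γ n j ^ γ ≤ (A z j)⁻¹ * (mpcLimit A γ z - 1) ^ γ := by
    rwa [le_inv_mul_iff₀ hpos]
  have h4 := Real.rpow_le_rpow (Real.rpow_nonneg h0 _) h3 (inv_nonneg.2 hγ.le)
  rwa [← Real.rpow_mul h0, mul_inv_cancel₀ hγ.ne', Real.rpow_one] at h4

/-- The recursion passes to the limit; states off the support, where the default value is used,
carry coefficient zero. -/
lemma sum_mpcLimit_le (hA : ∀ i j, 0 ≤ A i j) (hγ : 0 < γ) {z : Fin N}
    (hz : z ∈ mpcSupport A γ) :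
    ∑ j, A z j * mpcLimit A γ j ^ γ ≤ (mpcLimit A γ z - 1) ^ γ := by
  have ht : Tendsto (fun n => ∑ j, A z j * mpcIter A γ n j ^ γ) atTop
      (𝓝 (∑ j, A z j * mpcLimit A γ j ^ γ)) := by
    refine tendsto_finsetSum _ fun j _ => ?_
    by_cases hj : j ∈ mpcSupport A γ
    · exact ((tendsto_mpcIter hA hγ hj).rpow_const (Or.inr hγ.le)).const_mul _
    · simp [mpcSupport_closed hA hγ hz hj]
  refine le_of_tendsto' ht fun n => ?_
  rw [← mpcIter_succ_sub_one_rpow hA hγ]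
  exact Real.rpow_le_rpow (by linarith [one_le_mpcIter (γ := γ) hA (n + 1) z])
    (by linarith [mpcIter_le_mpcLimit hz (n + 1)]) hγ.le

variable {Eε Eζ Eη : Type*} [MeasurableSpace Eε] [MeasurableSpace Eζ] [MeasurableSpace Eη]
  {M : Multiplicative N Eε Eζ} {I : Income N Eη} {u : ℝ → EReal} {c : ℝ → Fin N → ℝ}

lemma IsConsumptionFunction.upper (hc : IsConsumptionFunction M I u c)
    (hu : InadaUtility u) (hrv : RegularlyVarying (marginal u) (-γ)) (hI : I.Admissible u)
    (hM : M.Impatient) (hR : M.ReturnGap) (hγ : 0 < γ) (n : ℕ) :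
    ∀ z, ∀ θ, (mpcIter (M.PD γ) γ n z)⁻¹ < θ → ∀ᶠ a in atTop, c a z ≤ θ * a := by
  induction n with
  | zero =>
    intro z θ hθ
    rw [mpcIter, inv_one] at hθ
    filter_upwards [eventually_gt_atTop 0] with a ha
    have := (hc.bounds ha z).2
    nlinarith
  | succ n ih =>
    intro z θ hθ
    exact hc.upper_step hu hrv hI hM hR hγ
      (fun j => zero_lt_one.trans_le (one_le_mpcIter (PD_nonneg M γ) n j)) ih z hθ

/-- The consumption function is asymptotically linear in wealth. -/
theorem IsConsumptionFunction.tendsto_div (hc : IsConsumptionFunction M I u c)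
    (hu : InadaUtility u) (hrv : RegularlyVarying (marginal u) (-γ)) (hI : I.Admissible u)
    (hM : M.Impatient) (hR : M.ReturnGap) (hγ : 0 < γ) (z : Fin N) :
    Tendsto (fun a => c a z / a) atTop (𝓝 (asymptoticMPC (M.PD γ) γ z)) := by
  have hA := PD_nonneg M γ
  have hup := fun n => hc.upper hu hrv hI hM hR hγ n z
  rw [tendsto_order]
  by_cases hz : z ∈ mpcSupport (M.PD γ) γ
  · have hs1 := one_le_mpcLimit (γ := γ) hA z
    have hs0 := zero_lt_one.trans_le hs1
    rw [asymptoticMPC, if_pos hz]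
    constructor
    · intro b hb
      have hcont : Tendsto (fun t : ℝ => (t * mpcLimit (M.PD γ) γ z)⁻¹) (𝓝[>] 1)
          (𝓝 ((1 * mpcLimit (M.PD γ) γ z)⁻¹)) := by
        have : ContinuousAt (fun t : ℝ => (t * mpcLimit (M.PD γ) γ z)⁻¹) 1 :=
          (continuousAt_id.mul continuousAt_const).inv₀ (by simpa using hs0.ne')
        exact this.tendsto.mono_left nhdsWithin_le_nhds
      rw [one_mul] at hcont
      obtain ⟨t, ht1, ht2⟩ := ((hcont.eventually_const_lt hb).and self_mem_nhdsWithin).exists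
      filter_upwards [hc.lower hu hrv hI hM hR hγ (one_le_mpcLimit hA)
        (fun z hz => sum_mpcLimit_le hA hγ hz) (fun z hz j hj => mpcSupport_closed hA hγ hz hj)
        ht2 z hz, eventually_gt_atTop 0] with a ha ha0
      exact ht1.trans_le ((le_div_iff₀ ha0).2 ha)
    · intro b hb
      obtain ⟨b', hb1, hb2⟩ := exists_between hb
      have ht := (tendsto_mpcIter hA hγ hz).inv₀ hs0.ne'
      obtain ⟨n, hn⟩ := (ht.eventually_lt_const hb1).exists
      filter_upwards [hup n b' hn, eventually_gt_atTop 0] with a ha ha0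
      exact ((div_le_iff₀ ha0).2 ha).trans_lt hb2
  · rw [asymptoticMPC, if_neg hz]
    constructor
    · intro b hb
      filter_upwards [eventually_gt_atTop 0] with a ha0
      exact hb.trans_le (div_nonneg (hc.bounds ha0 z).1 ha0.le)
    · intro b hb
      -- Unbounded iterates make the upper bounds `1/s_n` arbitrarily small.
      have hn : ∃ n, (b / 2)⁻¹ < mpcIter (M.PD γ) γ n z := by
        by_contra! h
        exact hz ⟨(b / 2)⁻¹, by rintro _ ⟨n, rfl⟩; exact h n⟩
      obtain ⟨n, hn⟩ := hn
      filter_upwards [hup n (b / 2) (inv_lt_of_inv_lt₀ (by positivity) hn),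
        eventually_gt_atTop 0] with a ha ha0
      exact ((div_le_iff₀ ha0).2 ha).trans_lt (by linarith)

end MPC

end IncomeFluctuation

end

open IncomeFluctuation in
theorem corollary3p4 {N : ℕ} {Eε Eζ : Type*} [MeasurableSpace Eε] [MeasurableSpace Eζ]
    (γ : ℝ) (hγ : 0 < γ) (M : Multiplicative N Eε Eζ)
    (hM : M.Impatient) (hR : M.ReturnGap) :
    ∃ cbar : Fin N → ℝ,
      ∀ (Eη : Type*) [MeasurableSpace Eη] (I : Income N Eη) (u : ℝ → EReal)
        (c : ℝ → Fin N → ℝ),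
        InadaUtility u → RegularlyVarying (marginal u) (-γ) → I.Admissible u →
        IsConsumptionFunction M I u c →
          (∀ z l, Tendsto (fun a => c a z / a) atTop (𝓝 l) → l = cbar z) ∧
          (((specRad (M.PD γ) < 1 ∧ ∀ z, 0 < liminf (fun a => c a z / a) atTop) ∨
              (1 ≤ specRad (M.PD γ) ∧ (M.PD γ).IsIrreducible)) →
            ∀ z, Tendsto (fun a => c a z / a) atTop (𝓝 (cbar z))) := by
  refine ⟨asymptoticMPC (M.PD γ) γ, fun Eη _ I u c hu hrv hI hc => ?_⟩
  have hlim := hc.tendsto_div hu hrv hI hM hR hγ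
  exact ⟨fun z l hl => tendsto_nhds_unique hl (hlim z), fun _ => hlim⟩
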